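/- Let $d\ge 1$ and let $\Omega\subset\mathbb R^d$ be a bounded open set with Lipschitz boundary. Let $a:\mathbb R^d\to\mathbb R$ be continuous, $1$-periodic in each coordinate, with $0<\alpha\le a(x)\le\beta<+\infty$ for all $x$. Let $s_\varepsilon\in(0,1)$ for $\varepsilon\in(0,1)$, with $$\lim_{\varepsilon\to0}\frac{1-s_\varepsilon}{\varepsilon^2}=0$$ (so that $s_\varepsilon\to1$), and for $u\in L^2(\Omega)$ let $$F_\varepsilon(u)=(1-s_\varepsilon)\iint_{\Omega\times\Omega}a\Big(\frac x\varepsilon\Big)\frac{|u(x)-u(y)|^2}{|x-y|^{d+2s_\varepsilon}}\,dx\,dy\in[0,+\infty],$$ which is finite exactly when $u\in W^{s_\varepsilon,2}(\Omega)$. Then there is a (necessarily unique) symmetric matrix $A_{\rm hom}\in\mathbb R^{d\times d}$ such that $$\langle A_{\rm hom}z,z\rangle=\min\Big\{\int_{(0,1)^d}a(y)|z+\nabla\varphi(y)|^2\,dy:\ \varphi\in W^{1,2}_{\rm loc}(\mathbb R^d)\ \ 1\text{-periodic}\Big\}\qquad\text{for every }z\in\mathbb R^d,$$ the minimum being attained,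 and, as $\varepsilon\to0$, the functionals $F_\varepsilon$ $\Gamma$-converge with respect to the strong topology of $L^2(\Omega)$ to $$F_{\rm hom}(u)=\begin{cases}\displaystyle\frac{\sigma_{d-1}}{2d}\int_\Omega\langle A_{\rm hom}\nabla u,\nabla u\rangle\,dx & u\in W^{1,2}(\Omega),\\ +\infty & u\in L^2(\Omega)\setminus W^{1,2}(\Omega),\end{cases}$$ where $\sigma_{d-1}=\mathcal H^{d-1}(S^{d-1})$ is the $(d-1)$-dimensional Hausdorff measure of the unit sphere of $\mathbb R^d$. That is, for every sequence $\varepsilon_j\to0$ in $(0,1)$ and every $u\in L^2(\Omega)$: (i) $F_{\rm hom}(u)\le\liminf_jF_{\varepsilon_j}(u_j)$ whenever $u_j\to u$ in $L^2(\Omega)$; (ii) there are $u_j\to u$ in $L^2(\Omega)$ with $\limsup_jF_{\varepsilon_j}(u_j)\le F_{\rm hom}(u)$. -/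

import Mathlib

open Set Filter Topology MeasureTheory
open scoped ENNReal NNReal ContDiff

/-- The Euclidean space `ℝ^d`. -/
abbrev Euc (d : ℕ) : Type := EuclideanSpace ℝ (Fin d)

/-- `Ω` has Lipschitz boundary: near each boundary point, in suitable orthonormal coordinates,
`Ω` is the set of points above the graph of a Lipschitz function of the first `d - 1` coordinates.
The direction of the graph is the unit vector `e`, and `x - ⟪e, x⟫ e` is the orthogonal
projection of `x` on the hyperplane orthogonal to `e`. -/
def HasLipschitzBoundary {d : ℕ} (Ω : Set (Euc d)) : Prop :=
  ∀ x₀ ∈ frontier Ω, ∃ e : Euc d, ‖e‖ = 1 ∧ ∃ r : ℝ, 0 < r ∧ ∃ (K : ℝ≥0) (γ : Euc d → ℝ),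
    LipschitzWith K γ ∧
      ∀ x ∈ Metric.ball x₀ r, x ∈ Ω ↔ γ (x - inner ℝ e x • e) < inner ℝ e x

/-- `f` is `1`-periodic in each coordinate direction. -/
def IsOnePeriodic {d : ℕ} {Y : Type*} (f : Euc d → Y) : Prop :=
  ∀ (i : Fin d) (x : Euc d), f (x + EuclideanSpace.single i 1) = f x

/-- The open unit cube `(0,1)^d`. -/
def unitCube (d : ℕ) : Set (Euc d) := {x | ∀ i, x i ∈ Ioo (0 : ℝ) 1}

/-- `g` is a weak (distributional) gradient of `u` in the open set `Ω`. -/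
structure IsWeakGradient {d : ℕ} (Ω : Set (Euc d)) (u : Euc d → ℝ) (g : Euc d → Euc d) :
    Prop where
  locallyIntegrable_fun : LocallyIntegrableOn u Ω
  locallyIntegrable_grad : LocallyIntegrableOn g Ω
  integral_eq : ∀ φ : Euc d → ℝ, ContDiff ℝ ∞ φ → HasCompactSupport φ → tsupport φ ⊆ Ω →
    ∀ i : Fin d, ∫ x in Ω, u x * fderiv ℝ φ x (EuclideanSpace.single i 1) =
      -∫ x in Ω, g x i * φ x

open Classical in
/-- The weak gradient of `u` in `Ω`, which is unique up to a null subset of `Ω` if it exists. -/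
noncomputable def weakGradient {d : ℕ} (Ω : Set (Euc d)) (u : Euc d → ℝ) : Euc d → Euc d :=
  if h : ∃ g, IsWeakGradient Ω u g then h.choose else 0

/-- The Sobolev space `W^{1,2}(Ω)`: functions in `L²(Ω)` with a weak gradient in `L²(Ω)`. -/
def MemW12 {d : ℕ} (Ω : Set (Euc d)) (u : Euc d → ℝ) : Prop :=
  MemLp u 2 (volume.restrict Ω) ∧
    ∃ g, IsWeakGradient Ω u g ∧ MemLp g 2 (volume.restrict Ω)

/-- The quadratic form `⟨A z, z⟩` of a matrix. -/
noncomputable def quadForm {d : ℕ} (A : Matrix (Fin d) (Fin d) ℝ) (z : Euc d) : ℝ :=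
  inner ℝ (A.toEuclideanLin z) z

/-- The values `∫_{(0,1)^d} a(y) |z + ∇φ(y)|² dy`, for `1`-periodic functions `φ` of class
`W^{1,2}_loc(ℝ^d)`; `G` is the weak gradient of `φ` on the whole space. -/
def cellEnergies {d : ℕ} (a : Euc d → ℝ) (z : Euc d) : Set ℝ :=
  {c | ∃ (φ : Euc d → ℝ) (G : Euc d → Euc d), IsOnePeriodic φ ∧ IsWeakGradient univ φ G ∧
    MemLp φ 2 (volume.restrict (unitCube d)) ∧ MemLp G 2 (volume.restrict (unitCube d)) ∧
    c = ∫ y in unitCube d, a y * ‖z + G y‖ ^ 2}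

/-- `A` is the homogenized matrix of the coefficient `a`: the symmetric matrix such that
`⟨A z, z⟩` is the minimum of the cell problem for every `z`. -/
def IsHomogenizedMatrix {d : ℕ} (a : Euc d → ℝ) (A : Matrix (Fin d) (Fin d) ℝ) : Prop :=
  A.IsSymm ∧ ∀ z : Euc d, IsLeast (cellEnergies a z) (quadForm A z)

/-- The oscillating Gagliardo energy
`(1 - s) ∬_{Ω × Ω} a(x/ε) |u(x) - u(y)|² / |x - y|^{d + 2 s} dx dy`, with values in `[0, ∞]`.
For coefficients between two positive constants it is finite exactly on `W^{s,2}(Ω)`. -/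
noncomputable def gagliardoEnergy {d : ℕ} (Ω : Set (Euc d)) (a : Euc d → ℝ) (ε s : ℝ)
    (u : Euc d → ℝ) : ℝ≥0∞ :=
  ENNReal.ofReal (1 - s) * ∫⁻ x in Ω, ∫⁻ y in Ω,
    ENNReal.ofReal (a (ε⁻¹ • x) * (|u x - u y| ^ 2 / ‖x - y‖ ^ ((d : ℝ) + 2 * s)))

/-- The surface area `ℋ^{d-1}(S^{d-1})` of the unit sphere of `ℝ^d` (for `1 ≤ d`), where `μHE[k]`
is the `k`-dimensional Hausdorff measure in the normalization which agrees with the Lebesgue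
measure on `ℝ^k`. -/
noncomputable def sphereArea (d : ℕ) : ℝ :=
  (μHE[d - 1] (Metric.sphere (0 : Euc d) 1)).toReal

open Classical in
/-- The functional `σ_{d-1}/(2d) ∫_Ω ⟨A ∇u, ∇u⟩ dx` on `W^{1,2}(Ω)`, extended by `+∞`. -/
noncomputable def homogenizedEnergy {d : ℕ} (Ω : Set (Euc d)) (A : Matrix (Fin d) (Fin d) ℝ)
    (u : Euc d → ℝ) : ℝ≥0∞ :=
  if MemW12 Ω u then
    ENNReal.ofReal (sphereArea d / (2 * d) * ∫ x in Ω, quadForm A (weakGradient Ω u x))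
  else ⊤

/-- `F₀` is the (sequential) `Γ`-limit of the sequence of functionals `F j` on `X`: the liminf
inequality holds along all convergent sequences, and each point has a recovery sequence. -/
structure IsGammaLimit {X : Type*} [TopologicalSpace X] (F : ℕ → X → ℝ≥0∞) (F₀ : X → ℝ≥0∞) :
    Prop where
  le_liminf : ∀ (u : X) (v : ℕ → X), Tendsto v atTop (𝓝 u) →
    F₀ u ≤ liminf (fun j => F j (v j)) atTop
  exists_recovery : ∀ u : X, ∃ v : ℕ → X, Tendsto v atTop (𝓝 u) ∧
    limsup (fun j => F j (v j)) atTop ≤ F₀ u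

/-- `F₀` is the `Γ`-limit of the family `F ε`, `ε ∈ (0,1)`, as `ε → 0`: it is the `Γ`-limit along
every sequence of parameters which tends to `0`. -/
def IsGammaLimitAtZero {X : Type*} [TopologicalSpace X] (F : ℝ → X → ℝ≥0∞) (F₀ : X → ℝ≥0∞) :
    Prop :=
  ∀ ε : ℕ → ℝ, (∀ j, ε j ∈ Ioo (0 : ℝ) 1) → Tendsto ε atTop (𝓝 0) →
    IsGammaLimit (fun j => F (ε j)) F₀

/-!
As `s → 1`, the kernel `(1 - s) |ξ|^{-(d + 2 s)}` concentrates at the origin, while its second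
moments stay isotropic of size `σ / (2 d)`, with `σ` the area of the unit sphere, and its higher
moments are of order `1 - s`. Hence the nonlocal energy of a function with increments
`u (x + ξ) - u x ≈ ⟪X x, ξ⟫` is close to `σ / (2 d) ∫ a(x/ε) |X|²`. The Taylor remainder of a
function oscillating at scale `ε` is of order `|ξ|² / ε` and contributes `(1 - s) / ε²` to the
energy, which is negligible by assumption. So `F_ε` behaves like the local energy
`σ / (2 d) ∫ a(x/ε) |∇u|²`, and the limit is governed by the cell problem.

**The matrix.** In `L²` of the unit cube let `q_i` be the component of `√a e_i` orthogonal to the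
weighted gradients `√a ∇ψ` of smooth periodic `ψ`. The homogenized matrix is the Gram matrix of the
`q_i` (`homMatrix`). The minimum of the cell problem is attained, because by the periodic Poincaré
inequality the closure of the weighted gradients consists of weighted weak gradients
(`exists_periodic_potential`, `isHomogenizedMatrix_homMatrix`).

**Lower bound.** For a test field `P`, the inequality `b t² ≥ 2 t q - q² / b` with
`t = u x - u (x - ξ)` and `q = ⟪P x, ξ⟫`, integrated against the kernel, bounds the nonlocal energy
from below by `σ / (2 d) (-2 ∫ u div P - ∫ |P|² / a(x/ε))`, up to the Taylor remainder of `P`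
(`dual_le_gagliardoEnergy`). This is affine in `u`, so that it passes to the limit without any
compactness for sequences of bounded energy. It is applied to `P = ∑ i, Z_i(x) P_i(x/ε)`, where the
`P_i` are smooth, periodic and divergence free and approximate the optimal fluxes `√a q_i`
(`exists_smooth_fluxes`): then `div P` stays bounded, and the limit is
`σ / (2 d) (-2 ∫ u div (A Z) - ∫ ⟨A Z, Z⟩)`. If this is bounded in `Z`, the Lax–Milgram theorem shows
that `u` lies in `W^{1,2}(Ω)` and that the supremum over `Z` is the homogenized energy
(`memW12_of_forall_dual_le`, `homogenizedEnergy_le_liminf`).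

**Upper bound.** For smooth `w` the two-scale expansions `w(x) + ε ∑ i, ∂_i w(x) ψ_i(x/ε)`, with
smooth approximate correctors `ψ_i`, form a recovery sequence up to a small error
(`exists_twoScaleExpansion_increment_le`, `gagliardoEnergy_le`, `gammaLimsupLE_of_smooth`). Smooth
functions are dense in `W^{1,2}(Ω)` since the boundary is Lipschitz (`exists_smooth_approx`), and the
`Γ`-upper limit is lower semicontinuous (`GammaLimsupLE.of_forall`).

The constant is computed with Lebesgue measure in polar coordinates, which requires that the area of
the sphere, a Hausdorff measure, is `d` times the volume of the ball (`sphereArea_eq`).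
-/

/-! ### Translations and mollification in `L^p` -/

section Mollification

variable {d : ℕ} {F : Type*} [NormedAddCommGroup F]

/-- Translations act continuously on `L^p`. -/
theorem tendsto_eLpNorm_translate_sub {p : ℝ≥0∞} (hp1 : 1 ≤ p) (hp : p ≠ ⊤)
    {f : Euc d → F} (hf : MemLp f p volume) :
    Tendsto (fun t : Euc d => eLpNorm (fun x => f (x + t) - f x) p volume) (𝓝 0) (𝓝 0) := by
  have : Fact (1 ≤ p) := ⟨hp1⟩
  let g : Euc d → C(Euc d, Euc d) := fun t => ⟨fun x => x + t, by fun_prop⟩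
  have hg : Continuous g :=
    (ContinuousMap.mk (fun a : Euc d × Euc d => a.2 + a.1) (by fun_prop)).curry.continuous
  have hgm : ∀ t, MeasurePreserving (g t) (volume : Measure (Euc d)) volume := fun t =>
    measurePreserving_add_right volume t
  have h := (continuous_const (y := hf.toLp f)).compMeasurePreservingLp hg hgm hp
  have h0 := (h.tendsto 0).edist (tendsto_const_nhds
    (x := Lp.compMeasurePreserving (g 0) (hgm 0) (hf.toLp f)))
  rw [edist_self] at h0
  refine h0.congr fun t => ?_
  rw [Lp.edist_def]
  refine eLpNorm_congr_ae ?_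
  have h1 : ∀ s, Lp.compMeasurePreserving (g s) (hgm s) (hf.toLp f) =ᵐ[volume]
      fun x => f (x + s) := fun s =>
    (Lp.coeFn_compMeasurePreserving _ (hgm s)).trans
      ((hgm s).quasiMeasurePreserving.ae_eq_comp hf.coeFn_toLp)
  filter_upwards [h1 t, h1 0] with x hx hx0
  simp only [Pi.sub_apply, hx, hx0, add_zero]

variable [NormedSpace ℝ F]

/-- The convolution of `f` with the normalized bump function `φ`. -/
noncomputable def mollify (φ : ContDiffBump (0 : Euc d)) (f : Euc d → F) : Euc d → F :=
  convolution (φ.normed volume) f (ContinuousLinearMap.lsmul ℝ ℝ) volume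

theorem mollify_apply (φ : ContDiffBump (0 : Euc d)) (f : Euc d → F) (x : Euc d) :
    mollify φ f x = ∫ t, φ.normed volume t • f (x - t) := rfl

theorem mollify_apply_swap (φ : ContDiffBump (0 : Euc d)) (f : Euc d → F) (x : Euc d) :
    mollify φ f x = ∫ y, φ.normed volume (x - y) • f y :=
  convolution_lsmul_swap

theorem contDiff_mollify (φ : ContDiffBump (0 : Euc d)) {f : Euc d → F}
    (hf : LocallyIntegrable f volume) : ContDiff ℝ ∞ (mollify φ f) :=
  φ.hasCompactSupport_normed.contDiff_convolution_left _ φ.contDiff_normed hf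

theorem integrable_mollify_integrand (φ : ContDiffBump (0 : Euc d)) {f : Euc d → F}
    (hf : LocallyIntegrable f volume) (x : Euc d) :
    Integrable (fun t => φ.normed volume t • f (x - t)) volume :=
  φ.hasCompactSupport_normed.convolutionExists_left (ContinuousLinearMap.lsmul ℝ ℝ)
    φ.continuous_normed hf x

theorem integrable_mollify_integrand_swap (φ : ContDiffBump (0 : Euc d)) {f : Euc d → F}
    (hf : LocallyIntegrable f volume) (x : Euc d) :
    Integrable (fun y => φ.normed volume (x - y) • f y) volume := by
  have h := (integrable_mollify_integrand φ hf x).comp_sub_left x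
  simpa using h

/-- The derivative of a mollification is obtained by differentiating the kernel. -/
theorem fderiv_mollify_apply (φ : ContDiffBump (0 : Euc d)) {f : Euc d → F} [CompleteSpace F]
    (hf : LocallyIntegrable f volume) (x v : Euc d) :
    fderiv ℝ (mollify φ f) x v = ∫ y, fderiv ℝ (φ.normed volume) (x - y) v • f y := by
  have hc : HasCompactSupport (fderiv ℝ (φ.normed (volume : Measure (Euc d)))) :=
    φ.hasCompactSupport_normed.fderiv ℝ
  have hcont : Continuous (fderiv ℝ (φ.normed (volume : Measure (Euc d)))) :=
    (φ.contDiff_normed (μ := volume) (n := 1)).continuous_fderiv (by norm_num)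
  have h := (φ.hasCompactSupport_normed (μ := volume)).hasFDerivAt_convolution_left
    (ContinuousLinearMap.lsmul ℝ ℝ) (φ.contDiff_normed (μ := volume) (n := 1)) hf x
  have h2 := h.fderiv
  change fderiv ℝ (mollify φ f) x = _ at h2
  rw [h2]
  have hex := hc.convolutionExists_left ((ContinuousLinearMap.lsmul ℝ ℝ).precompL (Euc d))
    hcont hf x
  rw [convolution_def, ContinuousLinearMap.integral_apply hex]
  rw [← integral_sub_left_eq_self _ volume x]
  simp [ContinuousLinearMap.precompL_apply]

/-- Jensen's inequality: a mollification is an average of translates with respect to a probability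
measure. -/
theorem enorm_mollify_sub_sq_le (φ : ContDiffBump (0 : Euc d)) {f : Euc d → F} [CompleteSpace F]
    (hf : LocallyIntegrable f volume) (x : Euc d) :
    ‖mollify φ f x - f x‖ₑ ^ 2 ≤
      ∫⁻ t, ENNReal.ofReal (φ.normed volume t) * ‖f (x - t) - f x‖ₑ ^ 2 := by
  set ρ : Euc d → ℝ := φ.normed volume with hρ
  have hint := integrable_mollify_integrand φ hf x
  have hρint : Integrable ρ volume := φ.integrable_normed
  have h1 : mollify φ f x - f x = ∫ t, ρ t • (f (x - t) - f x) := by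
    simp_rw [smul_sub]
    rw [integral_sub hint (hρint.smul_const _), integral_smul_const, mollify_apply,
      φ.integral_normed, one_smul]
  -- the probability measure whose density is the mollification kernel
  set ν : Measure (Euc d) := volume.withDensity (fun t => ENNReal.ofReal (ρ t)) with hν
  have hm : Measurable fun t => ENNReal.ofReal (ρ t) :=
    (φ.continuous_normed.measurable).ennreal_ofReal
  have hνp : IsProbabilityMeasure ν := ⟨by
    rw [hν, withDensity_apply _ MeasurableSet.univ, Measure.restrict_univ,
      ← ofReal_integral_eq_lintegral_ofReal hρint (ae_of_all _ φ.nonneg_normed),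
      φ.integral_normed, ENNReal.ofReal_one]⟩
  have hgm : AEStronglyMeasurable (fun t => f (x - t) - f x) volume := by
    refine AEStronglyMeasurable.sub ?_ aestronglyMeasurable_const
    exact hf.aestronglyMeasurable.comp_quasiMeasurePreserving
      (quasiMeasurePreserving_sub_left volume x)
  have hgν : AEStronglyMeasurable (fun t => f (x - t) - f x) ν :=
    hgm.mono_ac (withDensity_absolutelyContinuous _ _)
  have h2 : ‖mollify φ f x - f x‖ₑ ≤ eLpNorm (fun t => f (x - t) - f x) 1 ν := by
    rw [h1, eLpNorm_one_eq_lintegral_enorm, hν,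
      lintegral_withDensity_eq_lintegral_mul₀ hm.aemeasurable hgm.enorm]
    refine (enorm_integral_le_lintegral_enorm _).trans (le_of_eq ?_)
    refine lintegral_congr fun t => ?_
    rw [enorm_smul, Pi.mul_apply, Real.enorm_of_nonneg (φ.nonneg_normed t)]
  have h3 := h2.trans (eLpNorm_le_eLpNorm_of_exponent_le (p := 1) (q := 2) (by norm_num) hgν)
  calc ‖mollify φ f x - f x‖ₑ ^ 2 ≤ (eLpNorm (fun t => f (x - t) - f x) 2 ν) ^ 2 := by gcongr
    _ = ∫⁻ t, ‖f (x - t) - f x‖ₑ ^ 2 ∂ν := by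
      rw [eLpNorm_eq_lintegral_rpow_enorm_toReal (by norm_num) (by norm_num)]
      simp only [ENNReal.toReal_ofNat, ENNReal.rpow_ofNat]
      rw [← ENNReal.rpow_natCast, ← ENNReal.rpow_mul]
      norm_num
    _ = _ := by
      rw [hν, lintegral_withDensity_eq_lintegral_mul₀ hm.aemeasurable (hgm.enorm.pow_const 2)]
      rfl

theorem eLpNorm_two_sq {α G : Type*} [MeasurableSpace α] [NormedAddCommGroup G] (f : α → G)
    (μ : Measure α) : eLpNorm f 2 μ ^ 2 = ∫⁻ x, ‖f x‖ₑ ^ 2 ∂μ := by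
  rw [eLpNorm_eq_lintegral_rpow_enorm_toReal (by norm_num) (by norm_num)]
  simp only [ENNReal.toReal_ofNat, ENNReal.rpow_ofNat]
  rw [← ENNReal.rpow_natCast, ← ENNReal.rpow_mul]
  norm_num

/-- Mollification at scale `δ` moves `f` in `L²` by no more than the translations by vectors of
length at most `δ` do. -/
theorem eLpNorm_mollify_sub_le (φ : ContDiffBump (0 : Euc d)) {f : Euc d → F} [CompleteSpace F]
    (hf : MemLp f 2 volume) {η : ℝ≥0∞}
    (hη : ∀ t : Euc d, ‖t‖ ≤ φ.rOut → eLpNorm (fun x => f (x + t) - f x) 2 volume ≤ η) :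
    eLpNorm (fun x => mollify φ f x - f x) 2 volume ≤ η := by
  have hloc : LocallyIntegrable f volume := hf.locallyIntegrable (by norm_num)
  set ρ : Euc d → ℝ := φ.normed volume with hρ
  refine (ENNReal.pow_le_pow_left_iff two_ne_zero).1 ?_
  rw [eLpNorm_two_sq]
  have hm : Measurable fun t => ENNReal.ofReal (ρ t) :=
    (φ.continuous_normed.measurable).ennreal_ofReal
  have hjm : AEMeasurable (Function.uncurry fun x t : Euc d =>
      ENNReal.ofReal (ρ t) * ‖f (x - t) - f x‖ₑ ^ 2) (volume.prod volume) := by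
    refine (hm.comp measurable_snd).aemeasurable.mul ((AEStronglyMeasurable.enorm ?_).pow_const 2)
    refine AEStronglyMeasurable.sub ?_ ?_
    · exact hf.1.comp_quasiMeasurePreserving (quasiMeasurePreserving_sub volume volume)
    · exact hf.1.comp_fst
  calc ∫⁻ x, ‖mollify φ f x - f x‖ₑ ^ 2
      ≤ ∫⁻ x, ∫⁻ t, ENNReal.ofReal (ρ t) * ‖f (x - t) - f x‖ₑ ^ 2 :=
        lintegral_mono fun x => enorm_mollify_sub_sq_le φ hloc x
    _ = ∫⁻ t, ∫⁻ x, ENNReal.ofReal (ρ t) * ‖f (x - t) - f x‖ₑ ^ 2 :=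
        lintegral_lintegral_swap hjm
    _ ≤ ∫⁻ t, ENNReal.ofReal (ρ t) * η ^ 2 := by
        refine lintegral_mono fun t => ?_
        dsimp only
        rw [lintegral_const_mul' _ _ ENNReal.ofReal_ne_top]
        by_cases ht : ‖t‖ ≤ φ.rOut
        · gcongr
          have := hη (-t) (by rwa [norm_neg])
          rw [← eLpNorm_two_sq (fun x => f (x - t) - f x)]
          simp_rw [← sub_eq_add_neg] at this
          gcongr
        · have : ρ t = 0 := by
            have h0 : t ∉ Function.support (φ.normed (volume : Measure (Euc d))) := by
              rw [φ.support_normed_eq]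
              simp only [Metric.mem_ball, dist_zero_right, not_lt]
              exact (not_le.1 ht).le
            simpa using h0
          simp [this]
    _ = η ^ 2 := by
        rw [lintegral_mul_const _ hm, ← ofReal_integral_eq_lintegral_ofReal φ.integrable_normed
          (ae_of_all _ φ.nonneg_normed), φ.integral_normed, ENNReal.ofReal_one, one_mul]

/-- A bump function supported in the ball of radius `δ`. -/
noncomputable def bumpOfRadius (d : ℕ) {δ : ℝ} (hδ : 0 < δ) : ContDiffBump (0 : Euc d) :=
  ⟨δ / 2, δ, by linarith, by linarith⟩

theorem exists_forall_mollify_sub_le {f : Euc d → F} [CompleteSpace F] (hf : MemLp f 2 volume)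
    {η : ℝ≥0∞} (hη : 0 < η) :
    ∃ δ₀ > 0, ∀ φ : ContDiffBump (0 : Euc d), φ.rOut ≤ δ₀ →
      eLpNorm (fun x => mollify φ f x - f x) 2 volume ≤ η := by
  have h := tendsto_eLpNorm_translate_sub (by norm_num) (by norm_num) hf
  have h1 := (ENNReal.tendsto_nhds_zero.1 h) η hη
  obtain ⟨δ, hδ, hb⟩ := Metric.eventually_nhds_iff.1 h1
  refine ⟨δ / 2, by positivity, fun φ hφ => eLpNorm_mollify_sub_le φ hf fun t ht => hb ?_⟩
  rw [dist_zero_right]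
  linarith

end Mollification

/-! ### Periodic functions and the unit cube -/

section Periodic

variable {d : ℕ}

/-- The standard basis of `ℝ^d`, whose integral span is the lattice of periods. -/
noncomputable def stdBasis (d : ℕ) : Module.Basis (Fin d) ℝ (Euc d) :=
  (EuclideanSpace.basisFun (Fin d) ℝ).toBasis

theorem stdBasis_apply (i : Fin d) : stdBasis d i = EuclideanSpace.single i 1 := by
  simp [stdBasis]

theorem stdBasis_repr (x : Euc d) (i : Fin d) : (stdBasis d).repr x i = x i := by
  simp [stdBasis]

theorem IsOnePeriodic.add_lattice {Y : Type*} {f : Euc d → Y} (hf : IsOnePeriodic f)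
    {g : Euc d} (hg : g ∈ Submodule.span ℤ (Set.range (stdBasis d))) (x : Euc d) :
    f (g + x) = f x := by
  induction hg using Submodule.span_induction generalizing x with
  | mem y hy =>
    obtain ⟨i, rfl⟩ := hy
    rw [stdBasis_apply, add_comm]
    exact hf i x
  | zero => rw [zero_add]
  | add y z _ _ hy hz => rw [add_assoc, hy, hz]
  | smul n y _ hy =>
    induction n using Int.induction_on generalizing x with
    | zero => simp
    | succ n ih => rw [add_smul, one_smul, add_assoc, ih, hy]
    | pred n ih =>
      rw [sub_smul, one_smul, sub_add_eq_add_sub, add_sub_assoc, ih, ← hy, add_sub_cancel]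

/-- The representative of `x` modulo the lattice of periods in the half-open unit cube. -/
noncomputable def cubeFract (x : Euc d) : Euc d := ZSpan.fract (stdBasis d) x

theorem IsOnePeriodic.apply_cubeFract {Y : Type*} {f : Euc d → Y} (hf : IsOnePeriodic f)
    (x : Euc d) : f (cubeFract x) = f x := by
  have h := hf.add_lattice (ZSpan.floor (stdBasis d) x).2 (cubeFract x)
  rw [← h, cubeFract, ZSpan.fract_apply]
  congr 1
  abel

theorem isOnePeriodic_comp_cubeFract {Y : Type*} (f : Euc d → Y) :
    IsOnePeriodic fun x => f (cubeFract x) := by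
  intro i x
  have : cubeFract (x + EuclideanSpace.single i 1) = cubeFract x := by
    rw [cubeFract, ← stdBasis_apply, ZSpan.fract_add_ZSpan _ _ (Submodule.subset_span ⟨i, rfl⟩)]
    rfl
  simp only [this]

theorem cubeFract_eq_self {x : Euc d} (hx : x ∈ unitCube d) : cubeFract x = x := by
  rw [cubeFract, ZSpan.fract_eq_self, ZSpan.mem_fundamentalDomain]
  intro i
  rw [stdBasis_repr]
  exact Ioo_subset_Ico_self (hx i)

theorem measurable_cubeFract : Measurable (cubeFract : Euc d → Euc d) := by
  have h : (cubeFract : Euc d → Euc d) = fun x => WithLp.toLp 2 fun i => Int.fract (x i) := by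
    ext x i
    have := ZSpan.repr_fract_apply (stdBasis d) x i
    rw [stdBasis_repr, stdBasis_repr] at this
    exact this
  rw [h]
  refine (WithLp.measurable_toLp 2 _).comp (measurable_pi_lambda _ fun i => ?_)
  exact measurable_fract.comp (by fun_prop)

theorem isOpen_unitCube : IsOpen (unitCube d) := by
  have : unitCube d = ⋂ i, (fun x : Euc d => x i) ⁻¹' Ioo 0 1 := by
    ext x; simp [unitCube]
  rw [this]
  exact isOpen_iInter_of_finite fun i => isOpen_Ioo.preimage (by fun_prop)

theorem measurableSet_unitCube : MeasurableSet (unitCube d) := isOpen_unitCube.measurableSet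

/-- The open unit cube has volume `1` and agrees, up to a null set, with the half-open fundamental
domain of the lattice `ℤ^d`. -/
theorem volume_unitCube_and_ae_eq :
    volume (unitCube d) = 1 ∧ unitCube d =ᵐ[volume] ZSpan.fundamentalDomain (stdBasis d) := by
  have hmp := (EuclideanSpace.volume_preserving_symm_measurableEquiv_toLp (Fin d)).symm
  have h1 : volume (unitCube d) = 1 := by
    have : unitCube d = (MeasurableEquiv.toLp 2 (Fin d → ℝ)).symm ⁻¹'
        (Set.univ.pi fun _ => Ioo 0 1) := by
      ext x; simp [unitCube]
    rw [this, (EuclideanSpace.volume_preserving_symm_measurableEquiv_toLp (Fin d)).measure_preimage_equiv]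
    simp [volume_pi_pi]
  have h2 : volume (ZSpan.fundamentalDomain (stdBasis d)) = 1 := by
    have : ZSpan.fundamentalDomain (stdBasis d) = (MeasurableEquiv.toLp 2 (Fin d → ℝ)).symm ⁻¹'
        (Set.univ.pi fun _ => Ico 0 1) := by
      ext x
      simp only [ZSpan.mem_fundamentalDomain, stdBasis_repr]
      simp
    rw [this, (EuclideanSpace.volume_preserving_symm_measurableEquiv_toLp (Fin d)).measure_preimage_equiv]
    simp [volume_pi_pi]
  refine ⟨h1, ae_eq_of_subset_of_measure_ge ?_ (by rw [h1, h2])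
    measurableSet_unitCube.nullMeasurableSet (by rw [h2]; exact ENNReal.one_ne_top)⟩
  intro x hx
  rw [ZSpan.mem_fundamentalDomain]
  intro i
  rw [stdBasis_repr]
  exact Ioo_subset_Ico_self (hx i)

theorem volume_unitCube : volume (unitCube d) = 1 := volume_unitCube_and_ae_eq.1

instance : IsProbabilityMeasure (volume.restrict (unitCube d)) :=
  ⟨by rw [Measure.restrict_apply_univ, volume_unitCube]⟩


theorem restrict_unitCube_eq : (volume : Measure (Euc d)).restrict (unitCube d) =
    volume.restrict (ZSpan.fundamentalDomain (stdBasis d)) :=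
  Measure.restrict_congr_set volume_unitCube_and_ae_eq.2

instance : Countable (Submodule.span ℤ (Set.range (stdBasis d))).toAddSubgroup :=
  inferInstanceAs (Countable (Submodule.span ℤ (Set.range (stdBasis d))))

open Pointwise in
theorem preimage_add_vadd_fundamentalDomain (t : Euc d) :
    (fun x => x + t) ⁻¹' (t +ᵥ ZSpan.fundamentalDomain (stdBasis d)) =
      ZSpan.fundamentalDomain (stdBasis d) := by
  ext x
  rw [Set.mem_preimage, Set.mem_vadd_set_iff_neg_vadd_mem, vadd_eq_add, add_comm x, neg_add_cancel_left]

open Pointwise in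
theorem isAddFundamentalDomain_vadd (t : Euc d) :
    IsAddFundamentalDomain (Submodule.span ℤ (Set.range (stdBasis d))).toAddSubgroup
      (t +ᵥ ZSpan.fundamentalDomain (stdBasis d)) (volume : Measure (Euc d)) :=
  (ZSpan.isAddFundamentalDomain' (stdBasis d) (volume : Measure (Euc d))).vadd_of_comm t

open Pointwise in
theorem setLIntegral_unitCube_add {f : Euc d → ℝ≥0∞} (hf : IsOnePeriodic f) (t : Euc d) :
    ∫⁻ x in unitCube d, f (x + t) = ∫⁻ x in unitCube d, f x := by
  have hinv : ∀ (g : (Submodule.span ℤ (Set.range (stdBasis d))).toAddSubgroup) (x : Euc d),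
      f (g +ᵥ x) = f x := fun g x => hf.add_lattice g.2 x
  have h := (isAddFundamentalDomain_vadd t).setLIntegral_eq
    (ZSpan.isAddFundamentalDomain' (stdBasis d) volume) f hinv
  have h2 := (measurePreserving_add_right volume t).setLIntegral_comp_preimage_emb
    (MeasurableEquiv.addRight t).measurableEmbedding f (t +ᵥ ZSpan.fundamentalDomain (stdBasis d))
  rw [preimage_add_vadd_fundamentalDomain] at h2
  rw [restrict_unitCube_eq, ← h, h2]

theorem integrableOn_unitCube_add {F : Type*} [NormedAddCommGroup F] {f : Euc d → F}
    (hf : IsOnePeriodic f) (h : IntegrableOn f (unitCube d)) (t : Euc d) :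
    IntegrableOn (fun x => f (x + t)) (unitCube d) := by
  have hinv : ∀ (g : (Submodule.span ℤ (Set.range (stdBasis d))).toAddSubgroup) (x : Euc d),
      f (g +ᵥ x) = f x := fun g x => hf.add_lattice g.2 x
  rw [IntegrableOn, restrict_unitCube_eq] at h ⊢
  have h2 := ((isAddFundamentalDomain_vadd t).integrableOn_iff
    (ZSpan.isAddFundamentalDomain' (stdBasis d) volume) hinv).2 h
  rw [← (measurePreserving_add_right volume t).integrableOn_comp_preimage
    (MeasurableEquiv.addRight t).measurableEmbedding, preimage_add_vadd_fundamentalDomain] at h2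
  exact h2

open Pointwise in
theorem setIntegral_unitCube_add {F : Type*} [NormedAddCommGroup F] [NormedSpace ℝ F]
    {f : Euc d → F} (hf : IsOnePeriodic f) (t : Euc d) :
    ∫ x in unitCube d, f (x + t) = ∫ x in unitCube d, f x := by
  have hinv : ∀ (g : (Submodule.span ℤ (Set.range (stdBasis d))).toAddSubgroup) (x : Euc d),
      f (g +ᵥ x) = f x := fun g x => hf.add_lattice g.2 x
  have h := (isAddFundamentalDomain_vadd t).setIntegral_eq
    (ZSpan.isAddFundamentalDomain' (stdBasis d) volume) hinv
  have h2 := (measurePreserving_add_right volume t).setIntegral_preimage_emb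
    (MeasurableEquiv.addRight t).measurableEmbedding f (t +ᵥ ZSpan.fundamentalDomain (stdBasis d))
  rw [preimage_add_vadd_fundamentalDomain] at h2
  rw [restrict_unitCube_eq, ← h, h2]

/-- The integral of a periodic function over a bounded set is controlled by its integral over the
unit cube. -/
theorem exists_setLIntegral_le_unitCube (R : ℝ) :
    ∃ N : ℕ, ∀ f : Euc d → ℝ≥0∞, IsOnePeriodic f →
      ∫⁻ x in Metric.closedBall 0 R, f x ≤ N * ∫⁻ x in unitCube d, f x := by
  classical
  have hc : (Metric.closedBall (0 : Euc d) R) ⊆ ⋃ t : Euc d, (fun x => x + t) ⁻¹' unitCube d := by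
    intro x _
    refine mem_iUnion.2 ⟨WithLp.toLp 2 (fun _ => 1 / 2) - x, ?_⟩
    intro i
    simp
    norm_num
  obtain ⟨T, hT⟩ := (isCompact_closedBall (0 : Euc d) R).elim_finite_subcover _
    (fun t => isOpen_unitCube.preimage (by fun_prop)) hc
  refine ⟨T.card, fun f hf => ?_⟩
  calc ∫⁻ x in Metric.closedBall 0 R, f x
      ≤ ∫⁻ x in ⋃ t ∈ T, (fun x => x + t) ⁻¹' unitCube d, f x := lintegral_mono_set hT
    _ ≤ ∑ t ∈ T, ∫⁻ x in (fun x => x + t) ⁻¹' unitCube d, f x := by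
        clear hT
        induction T using Finset.induction_on with
        | empty => simp
        | insert a T ha ih => 
          rw [Finset.set_biUnion_insert, Finset.sum_insert ha]
          exact (lintegral_union_le _ _ _).trans (by gcongr)
    _ = ∑ t ∈ T, ∫⁻ x in unitCube d, f x := by
        refine Finset.sum_congr rfl fun t _ => ?_
        rw [← setLIntegral_unitCube_add hf (-t)]
        have h2 := (measurePreserving_add_right volume t).setLIntegral_comp_preimage_emb
          (MeasurableEquiv.addRight t).measurableEmbedding (fun x => f (x + -t)) (unitCube d)
        simp only [add_neg_cancel_right] at h2
        exact h2
    _ = T.card * ∫⁻ x in unitCube d, f x := by simp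

theorem IsOnePeriodic.exists_norm_le {F : Type*} [NormedAddCommGroup F] {f : Euc d → F}
    (hf : IsOnePeriodic f) (hc : Continuous f) : ∃ C, ∀ x, ‖f x‖ ≤ C := by
  obtain ⟨R, hR⟩ := (ZSpan.fundamentalDomain_isBounded (stdBasis d)).subset_closedBall 0
  obtain ⟨C, hC⟩ := (isCompact_closedBall (0 : Euc d) R).exists_bound_of_continuousOn
    hc.continuousOn
  refine ⟨C, fun x => ?_⟩
  rw [← hf.apply_cubeFract]
  exact hC _ (hR (ZSpan.fract_mem_fundamentalDomain _ _))

theorem isBounded_unitCube : Bornology.IsBounded (unitCube d) :=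
  (ZSpan.fundamentalDomain_isBounded (stdBasis d)).subset fun x hx => by
    rw [ZSpan.mem_fundamentalDomain]
    intro i
    rw [stdBasis_repr]
    exact Ioo_subset_Ico_self (hx i)

theorem Continuous.memLp_restrict_of_isBounded {F : Type*} [NormedAddCommGroup F] {f : Euc d → F}
    (hc : Continuous f) {s : Set (Euc d)} (hs : Bornology.IsBounded s) (p : ℝ≥0∞) :
    MemLp f p (volume.restrict s) := by
  obtain ⟨R, hR⟩ := hs.subset_closedBall 0
  obtain ⟨C, hC⟩ := (isCompact_closedBall (0 : Euc d) R).exists_bound_of_continuousOn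
    hc.continuousOn
  have h1 : MemLp f p (volume.restrict (Metric.closedBall 0 R)) := by
    have : IsFiniteMeasure (volume.restrict (Metric.closedBall (0 : Euc d) R)) :=
      ⟨by rw [Measure.restrict_apply_univ]; exact (isCompact_closedBall _ _).measure_lt_top⟩
    refine MemLp.of_bound hc.aestronglyMeasurable C ?_
    filter_upwards [ae_restrict_mem Metric.isClosed_closedBall.measurableSet] with x hx
    exact hC x hx
  exact h1.mono_measure (Measure.restrict_mono hR le_rfl)

theorem Continuous.integrableOn_of_isBounded {F : Type*} [NormedAddCommGroup F] {f : Euc d → F}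
    (hc : Continuous f) {s : Set (Euc d)} (hs : Bornology.IsBounded s) : IntegrableOn f s :=
  memLp_one_iff_integrable.1 (hc.memLp_restrict_of_isBounded hs 1)

theorem IsOnePeriodic.fderiv {F : Type*} [NormedAddCommGroup F] [NormedSpace ℝ F]
    {f : Euc d → F} (hf : IsOnePeriodic f) : IsOnePeriodic (fderiv ℝ f) := by
  intro i x
  rw [← fderiv_comp_add_right]
  congr 1
  ext y
  exact hf i y

/-- The integral over a period of a directional derivative of a periodic function vanishes. -/
theorem setIntegral_unitCube_fderiv_eq_zero {F : Type*} [NormedAddCommGroup F] [NormedSpace ℝ F]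
    [CompleteSpace F] {f : Euc d → F} (hf : IsOnePeriodic f) (hc : ContDiff ℝ 1 f) (v : Euc d) :
    ∫ x in unitCube d, fderiv ℝ f x v = 0 := by
  have hcont : Continuous fun x => fderiv ℝ f x v :=
    (hc.continuous_fderiv one_ne_zero).clm_apply continuous_const
  obtain ⟨C, hC⟩ := IsOnePeriodic.exists_norm_le (f := fun x => fderiv ℝ f x v)
    (fun i x => by simp only [hf.fderiv i x]) hcont
  have h := hasDerivAt_integral_of_dominated_loc_of_deriv_le (𝕜 := ℝ)
    (μ := volume.restrict (unitCube d)) (F := fun (t : ℝ) x => f (x + t • v))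
    (F' := fun (t : ℝ) x => fderiv ℝ f (x + t • v) v) (x₀ := 0) (bound := fun _ => C)
    (s := univ) univ_mem
    (Eventually.of_forall fun t => (hc.continuous.comp (by fun_prop)).aestronglyMeasurable)
    ((hc.continuous.comp (by fun_prop)).integrableOn_of_isBounded isBounded_unitCube)
    ((hcont.comp (by fun_prop : Continuous fun x : Euc d => x + (0 : ℝ) • v)).aestronglyMeasurable)
    (ae_of_all _ fun x t _ => hC _) (integrable_const C)
    (ae_of_all _ fun x t _ => by
      have h1 : HasDerivAt (fun t : ℝ => x + t • v) v t := by
        simpa using ((hasDerivAt_id t).smul_const v).const_add x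
      exact ((hc.differentiable one_ne_zero _).hasFDerivAt.comp_hasDerivAt t h1))
  have h2 := h.2
  simp only [setIntegral_unitCube_add hf, zero_smul, add_zero] at h2
  exact h2.unique (hasDerivAt_const _ _)

end Periodic

/-! ### Averaging of oscillating functions and the periodic Poincaré inequality -/

section Averaging

variable {d : ℕ}

/-- Rapidly oscillating periodic functions converge weakly to their mean. The integral
`∫ f(x) h(x/ε)` is averaged over the translations by `ε t`, with `t` in the unit cube; the
translations act on `f` by little in `L¹`, and average `h` exactly. -/
theorem tendsto_integral_mul_oscillating {ι : Type*} {l : Filter ι} {f h : Euc d → ℝ}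
    (hf : Integrable f) (hper : IsOnePeriodic h) (hc : Continuous h) {ε : ι → ℝ}
    (hε0 : ∀ j, ε j ≠ 0) (hε : Tendsto ε l (𝓝 0)) :
    Tendsto (fun j => ∫ x, f x * h ((ε j)⁻¹ • x)) l
      (𝓝 ((∫ x, f x) * ∫ y in unitCube d, h y)) := by
  obtain ⟨C, hC⟩ := hper.exists_norm_le hc
  obtain ⟨R, hR⟩ := isBounded_unitCube.subset_closedBall (0 : Euc d)
  have hC0 : 0 ≤ C := (norm_nonneg _).trans (hC 0)
  rw [Metric.tendsto_nhds]
  intro η hη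
  have htr := tendsto_eLpNorm_translate_sub le_rfl ENNReal.one_ne_top
    (memLp_one_iff_integrable.2 hf)
  set η' : ℝ := η / (2 * (C + 1)) with hη'
  have hη'0 : 0 < η' := by positivity
  obtain ⟨δ, hδ, hb⟩ := Metric.eventually_nhds_iff.1
    (ENNReal.tendsto_nhds_zero.1 htr (ENNReal.ofReal η') (by positivity))
  have hev : ∀ᶠ j in l, |ε j| * (|R| + 1) < δ := by
    have h1 : Tendsto (fun j => |ε j| * (|R| + 1)) l (𝓝 0) := by
      simpa using hε.abs.mul_const (|R| + 1)
    exact h1.eventually_lt_const hδ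
  filter_upwards [hev] with j hj
  set e := ε j with he
  have hI : ∀ t : Euc d, ∫ x, f x * h (e⁻¹ • x) = ∫ x, f (x + e • t) * h (e⁻¹ • x + t) := by
    intro t
    rw [← integral_add_right_eq_self (fun x => f x * h (e⁻¹ • x)) (e • t)]
    refine integral_congr_ae (ae_of_all _ fun x => ?_)
    simp only [smul_add, smul_smul, inv_mul_cancel₀ (hε0 j), he, one_smul]
  have hcont : Continuous fun z : Euc d × Euc d => h (e⁻¹ • z.2 + z.1) := by fun_prop
  have hprod : Integrable (fun z : Euc d × Euc d => f z.2 * h (e⁻¹ • z.2 + z.1))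
      ((volume.restrict (unitCube d)).prod volume) := by
    exact Integrable.mul_bdd (c := C) (hf.comp_snd _) hcont.aestronglyMeasurable
      (ae_of_all _ fun z => hC _)
  -- averaging over `t` replaces `h` by its mean
  have hJ : ∫ t in unitCube d, ∫ x, f x * h (e⁻¹ • x + t) =
      (∫ x, f x) * ∫ y in unitCube d, h y := by
    rw [integral_integral_swap hprod, ← integral_mul_const]
    refine integral_congr_ae (ae_of_all _ fun x => ?_)
    dsimp only
    rw [integral_const_mul]
    congr 1
    rw [← setIntegral_unitCube_add hper (e⁻¹ • x)]
    simp_rw [add_comm]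
  have hI' : ∫ x, f x * h (e⁻¹ • x) = ∫ t in unitCube d, ∫ x, f x * h (e⁻¹ • x) := by simp
  rw [dist_eq_norm, ← hJ, hI', ← integral_sub (integrable_const _) hprod.integral_prod_left]
  -- removing the translation from `f` costs little in `L¹`
  have hbound : ∀ t ∈ unitCube d,
      ‖(∫ x, f x * h (e⁻¹ • x)) - ∫ x, f x * h (e⁻¹ • x + t)‖ ≤ C * η' := by
    intro t ht
    have hi1 : Integrable fun x => f (x + e • t) := hf.comp_add_right _
    have hi2 : Integrable fun x => f (x + e • t) - f x := hi1.sub hf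
    have hcm : Continuous fun x : Euc d => h (e⁻¹ • x + t) := by fun_prop
    rw [hI t, ← integral_sub
      (hi1.mul_bdd (c := C) hcm.aestronglyMeasurable (ae_of_all _ fun z => hC _))
      (hf.mul_bdd (c := C) hcm.aestronglyMeasurable (ae_of_all _ fun z => hC _))]
    have hsm : dist (e • t) 0 < δ := by
      rw [dist_zero_right, norm_smul, Real.norm_eq_abs]
      refine lt_of_le_of_lt ?_ hj
      gcongr
      have := hR ht
      rw [Metric.mem_closedBall, dist_zero_right] at this
      exact this.trans ((le_abs_self R).trans (by linarith))
    have h1 := hb hsm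
    rw [eLpNorm_one_eq_lintegral_enorm, ← ofReal_integral_norm_eq_lintegral_enorm hi2,
      ENNReal.ofReal_le_ofReal_iff hη'0.le] at h1
    calc ‖∫ x, (f (x + e • t) * h (e⁻¹ • x + t) - f x * h (e⁻¹ • x + t))‖
        ≤ ∫ x, C * ‖f (x + e • t) - f x‖ := by
          refine norm_integral_le_of_norm_le (hi2.norm.const_mul C)
            (ae_of_all _ fun x => ?_)
          rw [← sub_mul, norm_mul, mul_comm]
          gcongr
          exact hC _
      _ ≤ C * η' := by
          rw [integral_const_mul]
          gcongr
  have h2 := norm_setIntegral_le_of_norm_le_const (μ := volume) (s := unitCube d)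
    (by rw [volume_unitCube]; exact ENNReal.one_lt_top) hbound
  refine h2.trans_lt ?_
  rw [measureReal_def, volume_unitCube, ENNReal.toReal_one, mul_one]
  calc C * η' ≤ (C + 1) * η' := by gcongr; linarith
    _ = η / 2 := by rw [hη']; field_simp
    _ < η := by linarith

/-- Jensen's inequality for the square: the variance is nonnegative. -/
theorem sq_integral_le_integral_sq {α : Type*} [MeasurableSpace α] {μ : Measure α}
    [IsProbabilityMeasure μ] {f : α → ℝ} (hf : MemLp f 2 μ) :
    (∫ x, f x ∂μ) ^ 2 ≤ ∫ x, f x ^ 2 ∂μ := by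
  have h := ProbabilityTheory.variance_eq_sub hf
  have h0 := ProbabilityTheory.variance_nonneg f μ
  simp only [Pi.pow_apply] at h
  linarith

/-- The increments of a periodic function over a fixed vector are bounded in `L²` by the gradient,
as they are averages of the derivative along a segment. -/
theorem setIntegral_sq_translate_sub_le {ψ : Euc d → ℝ} (hper : IsOnePeriodic ψ)
    (hc : ContDiff ℝ 1 ψ) (v : Euc d) :
    ∫ x in unitCube d, (ψ (x + v) - ψ x) ^ 2 ≤
      ‖v‖ ^ 2 * ∫ x in unitCube d, ‖fderiv ℝ ψ x‖ ^ 2 := by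
  have hdc : Continuous (fderiv ℝ ψ) := hc.continuous_fderiv one_ne_zero
  obtain ⟨C, hC⟩ := hper.fderiv.exists_norm_le hdc
  have hC0 : 0 ≤ C := (norm_nonneg _).trans (hC 0)
  have hprob : IsProbabilityMeasure ((volume : Measure ℝ).restrict (Ioc 0 1)) :=
    ⟨by rw [Measure.restrict_apply_univ]; simp⟩
  have h1 : ∀ x, (ψ (x + v) - ψ x) ^ 2 ≤
      ∫ t in Ioc (0 : ℝ) 1, ‖v‖ ^ 2 * ‖fderiv ℝ ψ (x + t • v)‖ ^ 2 := by
    intro x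
    have hline : ∀ t : ℝ, HasDerivAt (fun t : ℝ => ψ (x + t • v)) (fderiv ℝ ψ (x + t • v) v) t := by
      intro t
      have h1 : HasDerivAt (fun t : ℝ => x + t • v) v t := by
        simpa using ((hasDerivAt_id t).smul_const v).const_add x
      exact ((hc.differentiable one_ne_zero _).hasFDerivAt.comp_hasDerivAt t h1)
    have hcd : Continuous fun t : ℝ => fderiv ℝ ψ (x + t • v) v :=
      (hdc.comp (by fun_prop : Continuous fun t : ℝ => x + t • v)).clm_apply continuous_const
    have hcn : Continuous fun t : ℝ => ‖v‖ ^ 2 * ‖fderiv ℝ ψ (x + t • v)‖ ^ 2 := by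
      have := hdc.comp (by fun_prop : Continuous fun t : ℝ => x + t • v)
      exact continuous_const.mul (this.norm.pow 2)
    have hftc := intervalIntegral.integral_eq_sub_of_hasDerivAt (a := 0) (b := 1)
      (fun t _ => hline t) (hcd.intervalIntegrable _ _)
    simp only [one_smul, zero_smul, add_zero] at hftc
    rw [← hftc, intervalIntegral.integral_of_le zero_le_one]
    have hbd : ∀ t : ℝ, ‖fderiv ℝ ψ (x + t • v) v‖ ≤ C * ‖v‖ := fun t =>
      (ContinuousLinearMap.le_opNorm _ _).trans (by gcongr; exact hC _)
    refine (sq_integral_le_integral_sq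
      (MemLp.of_bound hcd.aestronglyMeasurable _ (ae_of_all _ hbd))).trans ?_
    refine integral_mono_of_nonneg (ae_of_all _ fun t => by positivity) ?_ (ae_of_all _ fun t => ?_)
    · exact (hcn.integrableOn_Icc (a := 0) (b := 1)).mono_set Ioc_subset_Icc_self
    · dsimp only
      rw [← mul_pow, ← sq_abs]
      refine pow_le_pow_left₀ (abs_nonneg _) ?_ 2
      rw [← Real.norm_eq_abs, mul_comm]
      exact ContinuousLinearMap.le_opNorm _ _
  have hcp : Continuous fun z : Euc d × ℝ => ‖v‖ ^ 2 * ‖fderiv ℝ ψ (z.1 + z.2 • v)‖ ^ 2 := by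
    have := hdc.comp (by fun_prop : Continuous fun z : Euc d × ℝ => z.1 + z.2 • v)
    exact continuous_const.mul (this.norm.pow 2)
  have hprod : Integrable (fun z : Euc d × ℝ => ‖v‖ ^ 2 * ‖fderiv ℝ ψ (z.1 + z.2 • v)‖ ^ 2)
      ((volume.restrict (unitCube d)).prod (volume.restrict (Ioc 0 1))) := by
    refine Integrable.of_bound hcp.aestronglyMeasurable (‖v‖ ^ 2 * C ^ 2) (ae_of_all _ fun z => ?_)
    rw [Real.norm_of_nonneg (by positivity)]
    gcongr
    exact hC _
  calc ∫ x in unitCube d, (ψ (x + v) - ψ x) ^ 2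
      ≤ ∫ x in unitCube d, ∫ t in Ioc (0 : ℝ) 1, ‖v‖ ^ 2 * ‖fderiv ℝ ψ (x + t • v)‖ ^ 2 :=
        integral_mono_of_nonneg (ae_of_all _ fun t => by positivity) hprod.integral_prod_left
          (ae_of_all _ h1)
    _ = ∫ t in Ioc (0 : ℝ) 1, ∫ x in unitCube d, ‖v‖ ^ 2 * ‖fderiv ℝ ψ (x + t • v)‖ ^ 2 :=
        integral_integral_swap hprod
    _ = ∫ t in Ioc (0 : ℝ) 1, ‖v‖ ^ 2 * ∫ x in unitCube d, ‖fderiv ℝ ψ x‖ ^ 2 := by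
        refine integral_congr_ae (ae_of_all _ fun t => ?_)
        dsimp only
        rw [integral_const_mul]
        congr 1
        exact setIntegral_unitCube_add (f := fun x => ‖fderiv ℝ ψ x‖ ^ 2)
          (fun i x => by simp only [hper.fderiv i x]) (t • v)
    _ = ‖v‖ ^ 2 * ∫ x in unitCube d, ‖fderiv ℝ ψ x‖ ^ 2 := by simp

theorem norm_sq_le_of_mem_unitCube {x : Euc d} (hx : x ∈ unitCube d) : ‖x‖ ^ 2 ≤ d := by
  rw [EuclideanSpace.norm_sq_eq]
  calc ∑ i, ‖x i‖ ^ 2 ≤ ∑ i : Fin d, (1 : ℝ) := by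
        refine Finset.sum_le_sum fun i _ => ?_
        have := hx i
        rw [Real.norm_of_nonneg this.1.le]
        exact pow_le_one₀ this.1.le this.2.le
    _ = d := by simp

/-- The Poincaré inequality for periodic functions: the deviation from the mean is an average of
translation increments. -/
theorem poincare_unitCube {ψ : Euc d → ℝ} (hper : IsOnePeriodic ψ) (hc : ContDiff ℝ 1 ψ) :
    ∫ x in unitCube d, (ψ x - ∫ y in unitCube d, ψ y) ^ 2 ≤
      d * ∫ x in unitCube d, ‖fderiv ℝ ψ x‖ ^ 2 := by
  obtain ⟨C, hC⟩ := hper.exists_norm_le hc.continuous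
  have hψ := hc.continuous
  have h1 : ∀ x, (ψ x - ∫ y in unitCube d, ψ y) ^ 2 ≤
      ∫ v in unitCube d, (ψ (x + v) - ψ x) ^ 2 := by
    intro x
    have hcx : Continuous fun v => ψ (x + v) := by fun_prop
    have hbd : ∀ v, ‖ψ (x + v) - ψ x‖ ≤ C + C := fun v => norm_sub_le_of_le (hC _) (hC _)
    have h2 : ∫ v in unitCube d, (ψ (x + v) - ψ x) = (∫ y in unitCube d, ψ y) - ψ x := by
      rw [integral_sub (hcx.integrableOn_of_isBounded isBounded_unitCube) (integrable_const _),
        ← setIntegral_unitCube_add hper x]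
      simp [add_comm]
    rw [← neg_sq, neg_sub, ← h2]
    exact sq_integral_le_integral_sq
      (MemLp.of_bound (by fun_prop : Continuous _).aestronglyMeasurable _ (ae_of_all _ hbd))
  have hcp : Continuous fun z : Euc d × Euc d => (ψ (z.1 + z.2) - ψ z.1) ^ 2 := by fun_prop
  have hprod : Integrable (fun z : Euc d × Euc d => (ψ (z.1 + z.2) - ψ z.1) ^ 2)
      ((volume.restrict (unitCube d)).prod (volume.restrict (unitCube d))) := by
    refine Integrable.of_bound hcp.aestronglyMeasurable ((C + C) ^ 2) (ae_of_all _ fun z => ?_)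
    rw [norm_pow]
    gcongr
    exact norm_sub_le_of_le (hC _) (hC _)
  have hdi : 0 ≤ ∫ x in unitCube d, ‖fderiv ℝ ψ x‖ ^ 2 :=
    integral_nonneg fun x => by positivity
  calc ∫ x in unitCube d, (ψ x - ∫ y in unitCube d, ψ y) ^ 2
      ≤ ∫ x in unitCube d, ∫ v in unitCube d, (ψ (x + v) - ψ x) ^ 2 :=
        integral_mono_of_nonneg (ae_of_all _ fun t => by positivity) hprod.integral_prod_left
          (ae_of_all _ h1)
    _ = ∫ v in unitCube d, ∫ x in unitCube d, (ψ (x + v) - ψ x) ^ 2 :=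
        integral_integral_swap hprod
    _ ≤ ∫ v in unitCube d, d * ∫ x in unitCube d, ‖fderiv ℝ ψ x‖ ^ 2 := by
        refine setIntegral_mono_on hprod.integral_prod_right (integrable_const _)
          measurableSet_unitCube fun v hv => ?_
        refine (setIntegral_sq_translate_sub_le hper hc v).trans ?_
        gcongr
        exact norm_sq_le_of_mem_unitCube hv
    _ = d * ∫ x in unitCube d, ‖fderiv ℝ ψ x‖ ^ 2 := by simp

end Averaging

/-! ### Weak gradients -/

section WeakGradient

variable {d : ℕ} {Ω : Set (Euc d)} {u : Euc d → ℝ} {g g' : Euc d → Euc d}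

theorem locallyIntegrableOn_apply (hg : LocallyIntegrableOn g Ω) (i : Fin d) :
    LocallyIntegrableOn (fun x => g x i) Ω := fun x hx =>
  let ⟨s, hs, h⟩ := hg x hx
  ⟨s, hs, (EuclideanSpace.proj (𝕜 := ℝ) i).integrable_comp h⟩

theorem IsWeakGradient.ae_eq (hΩ : IsOpen Ω) (h : IsWeakGradient Ω u g)
    (h' : IsWeakGradient Ω u g') : g =ᵐ[volume.restrict Ω] g' := by
  have hi : ∀ i, ∀ᵐ x, x ∈ Ω → g x i - g' x i = 0 := by
    intro i
    have hl := locallyIntegrableOn_apply h.locallyIntegrable_grad i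
    have hl' := locallyIntegrableOn_apply h'.locallyIntegrable_grad i
    refine hΩ.ae_eq_zero_of_integral_contDiff_smul_eq_zero (hl.sub hl') fun φ hφ hc hs => ?_
    have h1 := h.integral_eq φ hφ hc hs i
    have h2 := h'.integral_eq φ hφ hc hs i
    have hzero : ∀ x, x ∉ Ω → φ x = 0 := fun x hx =>
      image_eq_zero_of_notMem_tsupport fun hx' => hx (hs hx')
    have hint : ∀ f : Euc d → ℝ, LocallyIntegrableOn f Ω →
        IntegrableOn (fun x => f x * φ x) Ω := by
      intro f hf
      have h3 : IntegrableOn f (tsupport φ) := hf.integrableOn_compact_subset hs hc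
      have h4 : IntegrableOn (fun x => f x * φ x) (tsupport φ) := by
        obtain ⟨C, hC⟩ := hc.exists_bound_of_continuous hφ.continuous
        exact Integrable.mul_bdd (c := C) h3 hφ.continuous.aestronglyMeasurable (ae_of_all _ hC)
      have h5 : Integrable (fun x => f x * φ x) :=
        (integrableOn_iff_integrable_of_support_subset (fun x hx => by
          by_contra hx'
          exact hx (by simp [image_eq_zero_of_notMem_tsupport hx']))).1 h4
      exact h5.integrableOn
    have h3 : ∫ x in Ω, (g x i * φ x - g' x i * φ x) = 0 := by
      rw [integral_sub (hint _ hl) (hint _ hl')]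
      linarith
    rw [← h3, setIntegral_eq_integral_of_forall_compl_eq_zero]
    · exact integral_congr_ae (ae_of_all _ fun x => by simp only [smul_eq_mul]; ring)
    · intro x hx
      simp [hzero x hx]
  rw [Filter.EventuallyEq, ae_restrict_iff' hΩ.measurableSet]
  filter_upwards [ae_all_iff.2 hi] with x hx hxΩ
  ext i
  exact sub_eq_zero.1 (hx i hxΩ)

theorem IsWeakGradient.weakGradient_ae_eq (hΩ : IsOpen Ω) (h : IsWeakGradient Ω u g) :
    weakGradient Ω u =ᵐ[volume.restrict Ω] g := by
  have hex : ∃ g, IsWeakGradient Ω u g := ⟨g, h⟩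
  have h1 : IsWeakGradient Ω u (weakGradient Ω u) := by
    rw [weakGradient, dif_pos hex]
    exact hex.choose_spec
  exact h1.ae_eq hΩ h

/-- Testing a weak gradient with a translate of a bump function. -/
theorem IsWeakGradient.integral_bump (h : IsWeakGradient Ω u g) (φ : ContDiffBump (0 : Euc d))
    {x : Euc d} (hx : Metric.closedBall x φ.rOut ⊆ Ω) (i : Fin d) :
    ∫ y in Ω, fderiv ℝ (φ.normed volume) (x - y) (EuclideanSpace.single i 1) * u y =
      ∫ y in Ω, φ.normed volume (x - y) * g y i := by
  set ρ : Euc d → ℝ := φ.normed volume with hρ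
  have hρc : ContDiff ℝ ∞ ρ := φ.contDiff_normed
  have hcd : ContDiff ℝ ∞ fun y => ρ (x - y) := hρc.comp (by fun_prop)
  have hts : tsupport (fun y => ρ (x - y)) ⊆ Metric.closedBall x φ.rOut := by
    refine closure_minimal (fun y hy => ?_) Metric.isClosed_closedBall
    have : x - y ∈ Function.support (φ.normed (volume : Measure (Euc d))) := hy
    rw [φ.support_normed_eq, Metric.mem_ball, dist_zero_right] at this
    rw [Metric.mem_closedBall, dist_comm, dist_eq_norm]
    exact this.le
  have hcs : HasCompactSupport fun y => ρ (x - y) :=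
    (isCompact_closedBall x φ.rOut).of_isClosed_subset (isClosed_tsupport _) hts
  have h1 := h.integral_eq _ hcd hcs (hts.trans hx) i
  have h2 : ∀ y, fderiv ℝ (fun y => ρ (x - y)) y (EuclideanSpace.single i 1) =
      -fderiv ℝ ρ (x - y) (EuclideanSpace.single i 1) := by
    intro y
    have h3 := ((hρc.differentiable (by simp) (x - y)).hasFDerivAt.comp y
      ((hasFDerivAt_id y).const_sub x)).fderiv
    simp only [Function.comp_def] at h3
    rw [h3]
    simp
  simp_rw [h2, mul_neg, integral_neg, neg_inj] at h1
  simp_rw [mul_comm _ (u _), h1, mul_comm]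

/-- The gradient of a mollification, at points where the mollification kernel is supported in the
domain, is the mollification of the weak gradient. -/
theorem IsWeakGradient.fderiv_mollify_apply (hΩ : MeasurableSet Ω) (h : IsWeakGradient Ω u g)
    (hu : LocallyIntegrable (Ω.indicator u)) (hg : LocallyIntegrable (Ω.indicator g))
    (φ : ContDiffBump (0 : Euc d)) {x : Euc d} (hx : Metric.closedBall x φ.rOut ⊆ Ω) (i : Fin d) :
    fderiv ℝ (mollify φ (Ω.indicator u)) x (EuclideanSpace.single i 1) =
      mollify φ (Ω.indicator g) x i := by
  rw [_root_.fderiv_mollify_apply φ hu, mollify_apply_swap]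
  have h1 := h.integral_bump φ hx i
  rw [← integral_indicator hΩ, ← integral_indicator hΩ] at h1
  have h2 := (EuclideanSpace.proj (𝕜 := ℝ) i).integral_comp_comm
    (integrable_mollify_integrand_swap φ hg x)
  refine Eq.trans ?_ h2
  refine Eq.trans (integral_congr_ae (ae_of_all _ fun y => ?_))
    (h1.trans (integral_congr_ae (ae_of_all _ fun y => ?_)))
  · by_cases hy : y ∈ Ω <;> simp [hy]
  · by_cases hy : y ∈ Ω <;> simp [hy]

theorem IsWeakGradient.fderiv_mollify_univ_apply (h : IsWeakGradient univ u g)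
    (φ : ContDiffBump (0 : Euc d)) (x : Euc d) (i : Fin d) :
    fderiv ℝ (mollify φ u) x (EuclideanSpace.single i 1) = mollify φ g x i := by
  have hu : LocallyIntegrable u := locallyIntegrableOn_univ.1 h.locallyIntegrable_fun
  have hg : LocallyIntegrable g := locallyIntegrableOn_univ.1 h.locallyIntegrable_grad
  have := h.fderiv_mollify_apply MeasurableSet.univ (by simpa using hu) (by simpa using hg) φ
    (subset_univ (Metric.closedBall x φ.rOut)) i
  simpa using this

theorem gradient_apply (f : Euc d → ℝ) (x : Euc d) (i : Fin d) :
    gradient f x i = fderiv ℝ f x (EuclideanSpace.single i 1) := by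
  rw [← inner_gradient_left, EuclideanSpace.inner_single_right]
  simp

theorem IsWeakGradient.gradient_mollify (h : IsWeakGradient univ u g)
    (φ : ContDiffBump (0 : Euc d)) : gradient (mollify φ u) = mollify φ g := by
  ext x i
  rw [gradient_apply, h.fderiv_mollify_univ_apply]

/-- Weak gradients on the whole space are translation invariant. -/
theorem IsWeakGradient.comp_const_add (h : IsWeakGradient univ u g) (t : Euc d) :
    IsWeakGradient univ (fun x => u (t + x)) (fun x => g (t + x)) := by
  have hu : LocallyIntegrable u := locallyIntegrableOn_univ.1 h.locallyIntegrable_fun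
  have hg : LocallyIntegrable g := locallyIntegrableOn_univ.1 h.locallyIntegrable_grad
  have key : ∀ {F : Type} [NormedAddCommGroup F] {f : Euc d → F}, LocallyIntegrable f →
      LocallyIntegrable (fun x => f (t + x)) := by
    intro F _ f hf
    rw [locallyIntegrable_iff] at hf ⊢
    intro K hK
    have h1 := hf _ (hK.image (continuous_const_add t))
    rw [← (measurePreserving_add_left volume t).integrableOn_comp_preimage
      (MeasurableEquiv.addLeft t).measurableEmbedding] at h1
    rw [preimage_image_eq _ (add_right_injective t)] at h1
    exact h1
  refine ⟨locallyIntegrableOn_univ.2 (key hu), locallyIntegrableOn_univ.2 (key hg),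
    fun φ hφ hc _ i => ?_⟩
  have h1 := h.integral_eq (fun x => φ (x - t)) (hφ.comp (by fun_prop))
    (hc.comp_homeomorph (Homeomorph.subRight t)) (subset_univ _) i
  simp only [Measure.restrict_univ] at h1 ⊢
  rw [← integral_add_left_eq_self _ t, ← integral_add_left_eq_self (fun x => g x i * _) t] at h1
  simp only [fderiv_comp_sub, add_sub_cancel_left] at h1
  exact h1

end WeakGradient

section PeriodicMollification

variable {d : ℕ} {F : Type*} [NormedAddCommGroup F]

theorem IsOnePeriodic.memLp_two_closedBall {f : Euc d → F} (hf : IsOnePeriodic f)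
    (hm : AEStronglyMeasurable f volume) (h2 : MemLp f 2 (volume.restrict (unitCube d))) (R : ℝ) :
    MemLp f 2 (volume.restrict (Metric.closedBall 0 R)) := by
  obtain ⟨N, hN⟩ := exists_setLIntegral_le_unitCube (d := d) R
  refine ⟨hm.restrict, ?_⟩
  have h3 := hN (fun x => ‖f x‖ₑ ^ 2) (fun i x => by simp only [hf i x])
  rw [← eLpNorm_two_sq, ← eLpNorm_two_sq] at h3
  have h4 : eLpNorm f 2 (volume.restrict (Metric.closedBall 0 R)) ^ 2 < ⊤ :=
    h3.trans_lt (ENNReal.mul_lt_top (ENNReal.natCast_lt_top N) (ENNReal.pow_lt_top h2.2))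
  by_contra hcon
  rw [not_lt, top_le_iff] at hcon
  simp [hcon] at h4

theorem IsOnePeriodic.locallyIntegrable {f : Euc d → F} (hf : IsOnePeriodic f)
    (hm : AEStronglyMeasurable f volume) (h2 : MemLp f 2 (volume.restrict (unitCube d))) :
    LocallyIntegrable f := by
  rw [locallyIntegrable_iff]
  intro K hK
  obtain ⟨R, hR⟩ := hK.isBounded.subset_closedBall 0
  have h := hf.memLp_two_closedBall hm h2 R
  have : IsFiniteMeasure (volume.restrict (Metric.closedBall (0 : Euc d) R)) :=
    ⟨by rw [Measure.restrict_apply_univ]; exact (isCompact_closedBall _ _).measure_lt_top⟩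
  have h3 : IntegrableOn f (Metric.closedBall 0 R) := h.integrable (by norm_num)
  exact h3.mono_set hR

variable [NormedSpace ℝ F]

theorem IsOnePeriodic.mollify {f : Euc d → F} (hf : IsOnePeriodic f)
    (φ : ContDiffBump (0 : Euc d)) : IsOnePeriodic (mollify φ f) := by
  intro i x
  rw [mollify_apply, mollify_apply]
  refine integral_congr_ae (ae_of_all _ fun t => ?_)
  dsimp only
  rw [add_sub_right_comm, hf]

/-- Mollification of periodic functions converges in `L²` over a period: only the values of `f` near
the cube matter, so that the statement on the whole space applies to a truncation of `f`. -/
theorem IsOnePeriodic.exists_forall_mollify_sub_le [CompleteSpace F] {f : Euc d → F}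
    (hf : IsOnePeriodic f) (hm : AEStronglyMeasurable f volume)
    (h2 : MemLp f 2 (volume.restrict (unitCube d))) {η : ℝ≥0∞} (hη : 0 < η) :
    ∃ δ₀ > 0, ∀ φ : ContDiffBump (0 : Euc d), φ.rOut ≤ δ₀ →
      eLpNorm (fun x => _root_.mollify φ f x - f x) 2 (volume.restrict (unitCube d)) ≤ η := by
  obtain ⟨R, hR⟩ := (isBounded_unitCube (d := d)).subset_closedBall 0
  have hmem : MemLp ((Metric.closedBall 0 (R + 1)).indicator f) 2 volume :=
    (memLp_indicator_iff_restrict Metric.isClosed_closedBall.measurableSet).2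
      (hf.memLp_two_closedBall hm h2 (R + 1))
  obtain ⟨δ, hδ, h⟩ := _root_.exists_forall_mollify_sub_le hmem hη
  refine ⟨min δ 1, by positivity, fun φ hφ => ?_⟩
  refine le_trans ?_ (h φ (hφ.trans (min_le_left _ _)))
  refine le_trans (le_of_eq (eLpNorm_congr_ae ?_)) (eLpNorm_restrict_le _ _ _ (unitCube d))
  filter_upwards [ae_restrict_mem measurableSet_unitCube] with x hx
  have hxR := hR hx
  rw [Metric.mem_closedBall, dist_zero_right] at hxR
  congr 1
  · rw [mollify_apply, mollify_apply]
    refine integral_congr_ae (ae_of_all _ fun t => ?_)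
    dsimp only
    by_cases ht : ‖t‖ < φ.rOut
    · rw [indicator_of_mem]
      rw [Metric.mem_closedBall, dist_zero_right]
      have := norm_sub_le x t
      have := hφ.trans (min_le_right _ _)
      linarith
    · have h0 : t ∉ Function.support (φ.normed (volume : Measure (Euc d))) := by
        rw [φ.support_normed_eq]
        simpa using ht
      rw [Function.notMem_support.1 h0, zero_smul, zero_smul]
  · rw [indicator_of_mem]
    rw [Metric.mem_closedBall, dist_zero_right]
    linarith

end PeriodicMollification

/-! ### The cell problem -/

section OrthogonalComponent

variable {E : Type*} [NormedAddCommGroup E] [InnerProductSpace ℝ E] [CompleteSpace E]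

/-- The component of a vector orthogonal to a subspace (which need not be closed). -/
noncomputable def orthogonalComponent (K : Submodule ℝ E) : E →ₗ[ℝ] E :=
  (Kᗮ.starProjection).toLinearMap

theorem orthogonalComponent_sub_mem (K : Submodule ℝ E) (v : E) :
    orthogonalComponent K v - v ∈ K.topologicalClosure := by
  rw [← Submodule.orthogonal_orthogonal_eq_closure, ← neg_sub]
  exact neg_mem (Submodule.sub_starProjection_mem_orthogonal _)

theorem inner_orthogonalComponent_eq_zero (K : Submodule ℝ E) (v : E) {h : E}
    (hh : h ∈ K.topologicalClosure) : inner ℝ (orthogonalComponent K v) h = 0 := by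
  rw [← Submodule.orthogonal_orthogonal_eq_closure] at hh
  exact Submodule.inner_right_of_mem_orthogonal
    (K := Kᗮ) (Submodule.starProjection_apply_mem _ _) hh

end OrthogonalComponent

section Cell

variable {d : ℕ} {a : Euc d → ℝ}

/-- The space of the fields `√a ∇ψ` on the unit cube, for smooth periodic `ψ`, in which the
energy `∫ a |∇ψ|²` is the squared norm. -/
def gradientFields (a : Euc d → ℝ) :
    Submodule ℝ (Lp (Euc d) 2 (volume.restrict (unitCube d))) where
  carrier := {h | ∃ ψ : Euc d → ℝ, ContDiff ℝ ∞ ψ ∧ IsOnePeriodic ψ ∧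
    h =ᵐ[volume.restrict (unitCube d)] fun x => √(a x) • gradient ψ x}
  add_mem' := by
    rintro h h' ⟨ψ, hψ, hp, he⟩ ⟨ψ', hψ', hp', he'⟩
    refine ⟨fun x => ψ x + ψ' x, hψ.add hψ', fun i x => by simp only [hp i x, hp' i x], ?_⟩
    filter_upwards [Lp.coeFn_add h h', he, he'] with x hx h1 h2
    rw [hx, Pi.add_apply, h1, h2, ← smul_add]
    congr 1
    simp only [gradient]
    rw [fderiv_fun_add (hψ.differentiable (by simp) x) (hψ'.differentiable (by simp) x), map_add]
  zero_mem' := by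
    refine ⟨fun _ => 0, contDiff_const, fun _ _ => rfl, ?_⟩
    filter_upwards [Lp.coeFn_zero (Euc d) 2 (volume.restrict (unitCube d))] with x hx
    rw [hx]
    simp [gradient]
  smul_mem' := by
    rintro c h ⟨ψ, hψ, hp, he⟩
    refine ⟨fun x => c • ψ x, hψ.const_smul c, fun i x => by simp only [hp i x], ?_⟩
    filter_upwards [Lp.coeFn_smul c h, he] with x hx h1
    rw [hx, Pi.smul_apply, h1, smul_comm]
    congr 1
    simp only [gradient]
    rw [fderiv_fun_const_smul (hψ.differentiable (by simp) x)]
    simp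

theorem inner_toLp_eq_integral {μ : Measure (Euc d)} {f g : Euc d → Euc d} (hf : MemLp f 2 μ)
    (hg : MemLp g 2 μ) : inner ℝ (hf.toLp f) (hg.toLp g) = ∫ x, inner ℝ (f x) (g x) ∂μ := by
  rw [L2.inner_def]
  refine integral_congr_ae ?_
  filter_upwards [hf.coeFn_toLp, hg.coeFn_toLp] with x h1 h2
  rw [h1, h2]

theorem inner_toLp_right_eq_integral {μ : Measure (Euc d)} {g : Euc d → Euc d} (f : Lp (Euc d) 2 μ)
    (hg : MemLp g 2 μ) : inner ℝ f (hg.toLp g) = ∫ x, inner ℝ (f x) (g x) ∂μ := by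
  rw [L2.inner_def]
  refine integral_congr_ae ?_
  filter_upwards [hg.coeFn_toLp] with x h2
  rw [h2]

theorem memLp_sqrt_smul (hac : Continuous a) {β : ℝ} (hβ : ∀ x, a x ≤ β) {μ : Measure (Euc d)}
    {f : Euc d → Euc d} (hf : MemLp f 2 μ) : MemLp (fun x => √(a x) • f x) 2 μ := by
  refine hf.of_le_mul (c := √β) ((by fun_prop : Continuous fun x => √(a x)).aestronglyMeasurable.smul
    hf.1) (ae_of_all _ fun x => ?_)
  rw [norm_smul, Real.norm_of_nonneg (Real.sqrt_nonneg _)]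
  gcongr
  exact hβ x

theorem memLp_inv_sqrt_smul (hac : Continuous a) {α : ℝ} (hα : 0 < α) (hαa : ∀ x, α ≤ a x)
    {μ : Measure (Euc d)} {f : Euc d → Euc d} (hf : MemLp f 2 μ) :
    MemLp (fun x => (√(a x))⁻¹ • f x) 2 μ := by
  have hpos : ∀ x, 0 < √(a x) := fun x => Real.sqrt_pos.2 (hα.trans_le (hαa x))
  refine hf.of_le_mul (c := (√α)⁻¹) (Continuous.aestronglyMeasurable
    (Continuous.inv₀ (by fun_prop) fun x => (hpos x).ne') |>.smul hf.1) (ae_of_all _ fun x => ?_)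
  rw [norm_smul, norm_inv, Real.norm_of_nonneg (Real.sqrt_nonneg _)]
  gcongr
  exact hαa x

theorem memLp_weightedConst (hac : Continuous a) (z : Euc d) :
    MemLp (fun x => √(a x) • z) 2 (volume.restrict (unitCube d)) :=
  Continuous.memLp_restrict_of_isBounded (by fun_prop) isBounded_unitCube 2

/-- The constant field `z`, weighted by `√a`. -/
noncomputable def weightedConst (hac : Continuous a) :
    Euc d →ₗ[ℝ] Lp (Euc d) 2 (volume.restrict (unitCube d)) where
  toFun z := (memLp_weightedConst hac z).toLp _
  map_add' z w := by
    rw [← MemLp.toLp_add]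
    exact MemLp.toLp_congr _ _ (ae_of_all _ fun x => smul_add _ _ _)
  map_smul' c z := by
    rw [RingHom.id_apply, ← MemLp.toLp_const_smul]
    exact MemLp.toLp_congr _ _ (ae_of_all _ fun x => smul_comm _ _ _)

theorem coeFn_weightedConst (hac : Continuous a) (z : Euc d) :
    weightedConst hac z =ᵐ[volume.restrict (unitCube d)] fun x => √(a x) • z :=
  (memLp_weightedConst hac z).coeFn_toLp

/-- The optimal field `√a (z + ∇φ)` of the cell problem in direction `z`: the component of `√a z`
orthogonal to the weighted gradients. -/
noncomputable def optimalField (hac : Continuous a) :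
    Euc d →ₗ[ℝ] Lp (Euc d) 2 (volume.restrict (unitCube d)) :=
  orthogonalComponent (gradientFields a) ∘ₗ weightedConst hac

theorem optimalField_sub_mem (hac : Continuous a) (z : Euc d) :
    optimalField hac z - weightedConst hac z ∈ (gradientFields a).topologicalClosure :=
  orthogonalComponent_sub_mem _ _

/-- The Euler–Lagrange equation of the cell problem. -/
theorem inner_optimalField_eq_zero (hac : Continuous a) (z : Euc d)
    {h : Lp (Euc d) 2 (volume.restrict (unitCube d))}
    (hh : h ∈ (gradientFields a).topologicalClosure) :
    inner ℝ (optimalField hac z) h = 0 :=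
  inner_orthogonalComponent_eq_zero _ _ hh

theorem inner_optimalField_weightedConst (hac : Continuous a) (z w : Euc d) :
    inner ℝ (optimalField hac z) (weightedConst hac w) =
      inner ℝ (optimalField hac z) (optimalField hac w) := by
  have h := inner_optimalField_eq_zero hac z (optimalField_sub_mem hac w)
  rw [inner_sub_right] at h
  linarith

/-- The homogenized matrix: the Gram matrix of the optimal fields in the coordinate directions. -/
noncomputable def homMatrix (hac : Continuous a) : Matrix (Fin d) (Fin d) ℝ :=
  Matrix.of fun i k => inner ℝ (optimalField hac (EuclideanSpace.single i 1))
    (optimalField hac (EuclideanSpace.single k 1))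

theorem sum_smul_single (z : Euc d) : z = ∑ i, z i • EuclideanSpace.single i (1 : ℝ) := by
  ext k
  simp [Finset.sum_apply, Pi.single_apply]

/-- The optimal fields depend linearly on the direction, so that their Gram matrix determines all their
inner products. -/
theorem inner_homMatrix (hac : Continuous a) (z w : Euc d) :
    inner ℝ ((homMatrix hac).toEuclideanLin z) w =
      inner ℝ (optimalField hac z) (optimalField hac w) := by
  conv_rhs => rw [sum_smul_single z, sum_smul_single w]
  simp only [map_sum, map_smul, sum_inner, inner_sum, inner_smul_left, inner_smul_right]
  rw [PiLp.inner_apply]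
  simp only [Matrix.toLpLin_apply, Matrix.mulVec, dotProduct, RCLike.inner_apply, conj_trivial]
  refine Finset.sum_congr rfl fun i _ => ?_
  congr 1
  refine Finset.sum_congr rfl fun k _ => ?_
  rw [mul_comm, real_inner_comm]
  rfl

theorem homMatrix_isSymm (hac : Continuous a) : (homMatrix hac).IsSymm := by
  ext i k
  simp only [Matrix.transpose_apply, homMatrix, Matrix.of_apply]
  exact real_inner_comm _ _

theorem quadForm_homMatrix (hac : Continuous a) (z : Euc d) :
    quadForm (homMatrix hac) z = ‖optimalField hac z‖ ^ 2 := by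
  rw [quadForm, inner_homMatrix, real_inner_self_eq_norm_sq]

theorem continuous_gradient {ψ : Euc d → ℝ} (hψ : ContDiff ℝ 1 ψ) : Continuous (gradient ψ) :=
  (LinearIsometryEquiv.continuous _).comp (hψ.continuous_fderiv one_ne_zero)

theorem IsOnePeriodic.gradient {ψ : Euc d → ℝ} (hψ : IsOnePeriodic ψ) :
    IsOnePeriodic (gradient ψ) := fun i x => by
  simp only [_root_.gradient, hψ.fderiv i x]

/-- Smooth correctors: the optimal fields are limits of `√a (e_i + ∇ψ)` with smooth periodic `ψ`. -/
theorem exists_smooth_correctors (hac : Continuous a) (ha0 : ∀ x, 0 ≤ a x) :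
    ∃ ψ : ℕ → Fin d → Euc d → ℝ, (∀ n i, ContDiff ℝ ∞ (ψ n i)) ∧ (∀ n i, IsOnePeriodic (ψ n i)) ∧
      ∀ i k, Tendsto (fun n => ∫ x in unitCube d, a x *
        inner ℝ (EuclideanSpace.single i 1 + gradient (ψ n i) x)
          (EuclideanSpace.single k 1 + gradient (ψ n k) x)) atTop (𝓝 (homMatrix hac i k)) := by
  have h1 : ∀ i : Fin d, ∃ h : ℕ → Lp (Euc d) 2 (volume.restrict (unitCube d)),
      (∀ n, h n ∈ gradientFields a) ∧ Tendsto h atTop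
        (𝓝 (optimalField hac (EuclideanSpace.single i 1)
          - weightedConst hac (EuclideanSpace.single i 1))) := fun i =>
    mem_closure_iff_seq_limit.1 (optimalField_sub_mem hac (EuclideanSpace.single i 1))
  choose h hmem hlim using h1
  choose ψ hψ hper hae using hmem
  refine ⟨fun n i => ψ i n, fun n i => hψ i n, fun n i => hper i n, fun i k => ?_⟩
  have h2 : ∀ i, Tendsto (fun n => h i n + weightedConst hac (EuclideanSpace.single i 1)) atTop
      (𝓝 (optimalField hac (EuclideanSpace.single i 1))) := fun i => by
    simpa using (hlim i).add_const (weightedConst hac (EuclideanSpace.single i 1))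
  refine ((h2 i).inner (𝕜 := ℝ) (h2 k)).congr fun n => ?_
  rw [L2.inner_def]
  refine integral_congr_ae ?_
  filter_upwards [Lp.coeFn_add (h i n) (weightedConst hac (EuclideanSpace.single i 1)),
    Lp.coeFn_add (h k n) (weightedConst hac (EuclideanSpace.single k 1)), hae i n, hae k n,
    coeFn_weightedConst hac (EuclideanSpace.single i 1),
    coeFn_weightedConst hac (EuclideanSpace.single k 1)] with x e1 e2 e3 e4 e5 e6
  rw [e1, e2, Pi.add_apply, Pi.add_apply, e3, e4, e5, e6, ← smul_add, ← smul_add,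
    inner_smul_left, inner_smul_right, ← mul_assoc, conj_trivial, Real.mul_self_sqrt (ha0 x),
    add_comm, add_comm (gradient (ψ k n) x)]

end Cell

/-! ### Attainment of the cell minimum and smooth divergence-free fluxes -/

section CellMinimum

variable {d : ℕ} {a : Euc d → ℝ}

/-- The weak gradient of a periodic function is periodic up to a null set. -/
theorem IsWeakGradient.ae_eq_comp_cubeFract {φ : Euc d → ℝ} {G : Euc d → Euc d}
    (hφ : IsOnePeriodic φ) (h : IsWeakGradient univ φ G) :
    G =ᵐ[volume] fun x => G (cubeFract x) := by
  have h1 : ∀ g : (Submodule.span ℤ (Set.range (stdBasis d))).toAddSubgroup,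
      ∀ᵐ x, G (g.1 + x) = G x := by
    intro g
    have h2 := h.comp_const_add g.1
    have h3 : (fun x => φ (g.1 + x)) = φ := funext fun x => hφ.add_lattice g.2 x
    rw [h3] at h2
    have h4 := h2.ae_eq isOpen_univ h
    rwa [Measure.restrict_univ] at h4
  filter_upwards [ae_all_iff.2 h1] with x hx
  have h5 := hx ⟨-(ZSpan.floor (stdBasis d) x : Euc d), neg_mem (ZSpan.floor (stdBasis d) x).2⟩
  rw [← h5, cubeFract, ZSpan.fract_apply]
  congr 1
  simp only
  abel

theorem edist_toLp_eq {μ : Measure (Euc d)} {f g : Euc d → Euc d} (hf : MemLp f 2 μ)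
    (hg : MemLp g 2 μ) : edist (hf.toLp f) (hg.toLp g) = eLpNorm (fun x => f x - g x) 2 μ := by
  rw [Lp.edist_toLp_toLp]
  rfl

theorem eLpNorm_sqrt_smul_le {β : ℝ} (hβ : ∀ x, a x ≤ β) {μ : Measure (Euc d)}
    (f : Euc d → Euc d) :
    eLpNorm (fun x => √(a x) • f x) 2 μ ≤ ENNReal.ofReal (√β) * eLpNorm f 2 μ := by
  refine eLpNorm_le_mul_eLpNorm_of_ae_le_mul (ae_of_all _ fun x => ?_) 2
  rw [norm_smul, Real.norm_of_nonneg (Real.sqrt_nonneg _)]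
  gcongr
  exact hβ x

theorem eLpNorm_inv_sqrt_smul_le {α : ℝ} (hα : 0 < α) (hαa : ∀ x, α ≤ a x) {μ : Measure (Euc d)}
    (f : Euc d → Euc d) :
    eLpNorm (fun x => (√(a x))⁻¹ • f x) 2 μ ≤ ENNReal.ofReal (√α)⁻¹ * eLpNorm f 2 μ := by
  refine eLpNorm_le_mul_eLpNorm_of_ae_le_mul (ae_of_all _ fun x => ?_) 2
  rw [norm_smul, norm_inv, Real.norm_of_nonneg (Real.sqrt_nonneg _)]
  gcongr
  exact hαa x

/-- Weighted weak gradients of periodic functions are limits of weighted smooth gradients, by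
mollification. -/
theorem toLp_weakGradient_mem (hac : Continuous a) {β : ℝ} (hβ : ∀ x, a x ≤ β)
    {φ : Euc d → ℝ} {G : Euc d → Euc d} (hφ : IsOnePeriodic φ) (h : IsWeakGradient univ φ G)
    (hG : MemLp G 2 (volume.restrict (unitCube d))) :
    (memLp_sqrt_smul hac hβ hG).toLp _ ∈ (gradientFields a).topologicalClosure := by
  have hGae := h.ae_eq_comp_cubeFract hφ
  have hφl : LocallyIntegrable φ := locallyIntegrableOn_univ.1 h.locallyIntegrable_fun
  have hGm : AEStronglyMeasurable G volume :=
    (locallyIntegrableOn_univ.1 h.locallyIntegrable_grad).aestronglyMeasurable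
  set G' : Euc d → Euc d := fun x => G (cubeFract x) with hG'
  have hG'per : IsOnePeriodic G' := isOnePeriodic_comp_cubeFract G
  have hG'L : MemLp G' 2 (volume.restrict (unitCube d)) :=
    hG.ae_eq (ae_restrict_of_ae hGae)
  refine EMetric.mem_closure_iff.2 fun η hη => ?_
  obtain ⟨κ, hκ0, hκ⟩ : ∃ κ : ℝ≥0∞, 0 < κ ∧ ENNReal.ofReal (√β) * κ < η := by
    have ht : Tendsto (fun κ : ℝ≥0∞ => ENNReal.ofReal (√β) * κ) (𝓝 0) (𝓝 0) := by
      simpa using ENNReal.Tendsto.const_mul (a := ENNReal.ofReal (√β))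
        (tendsto_id (x := 𝓝 (0 : ℝ≥0∞)))
        (Or.inr ENNReal.ofReal_ne_top)
    obtain ⟨r, hr, hr2⟩ := ENNReal.nhds_zero_basis.eventually_iff.1 (ht.eventually_lt_const hη)
    obtain ⟨κ, hκ⟩ := exists_between hr
    exact ⟨κ, hκ.1, hr2 hκ.2⟩
  obtain ⟨δ, hδ, hmol⟩ := hG'per.exists_forall_mollify_sub_le (hGm.congr hGae) hG'L hκ0
  set b := bumpOfRadius d hδ with hb
  have hgrad : gradient (mollify b φ) = mollify b G := h.gradient_mollify b
  have hmG : mollify b G = mollify b G' := by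
    ext x : 1
    rw [mollify_apply_swap, mollify_apply_swap]
    refine integral_congr_ae ?_
    filter_upwards [hGae] with y hy
    rw [hy]
  have hsm : ContDiff ℝ ∞ (mollify b φ) := contDiff_mollify b hφl
  have hL : MemLp (gradient (mollify b φ)) 2 (volume.restrict (unitCube d)) :=
    (continuous_gradient (hsm.of_le (by simp))).memLp_restrict_of_isBounded isBounded_unitCube 2
  refine ⟨(memLp_sqrt_smul hac hβ hL).toLp _, ⟨mollify b φ, hsm, hφ.mollify b,
    MemLp.coeFn_toLp _⟩, ?_⟩
  rw [edist_toLp_eq]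
  simp_rw [← smul_sub]
  refine (eLpNorm_sqrt_smul_le hβ _).trans_lt (lt_of_le_of_lt ?_ hκ)
  gcongr
  refine le_trans (le_of_eq ?_) (hmol b le_rfl)
  rw [hgrad, hmG, ← eLpNorm_neg]
  refine eLpNorm_congr_ae ?_
  filter_upwards [ae_restrict_of_ae (s := unitCube d) hGae] with x hx
  simp only [Pi.neg_apply, neg_sub, hx, hG']

/-- Convergence in `L²` of periodic functions on the unit cube implies convergence of the integrals
against compactly supported continuous functions on the whole space. -/
theorem tendsto_integral_mul_of_periodic {ι : Type*} {l : Filter ι} {f : ι → Euc d → ℝ}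
    {f₀ : Euc d → ℝ} (hf : ∀ n, IsOnePeriodic (f n)) (hf₀ : IsOnePeriodic f₀)
    (hm : ∀ n, AEStronglyMeasurable (f n) volume) (hm₀ : AEStronglyMeasurable f₀ volume)
    (hL : ∀ n, MemLp (f n) 2 (volume.restrict (unitCube d)))
    (hL₀ : MemLp f₀ 2 (volume.restrict (unitCube d)))
    (hlim : Tendsto (fun n => eLpNorm (fun x => f n x - f₀ x) 2 (volume.restrict (unitCube d))) l
      (𝓝 0)) {θ : Euc d → ℝ} (hθ : Continuous θ) (hθc : HasCompactSupport θ) :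
    Tendsto (fun n => ∫ x, f n x * θ x) l (𝓝 (∫ x, f₀ x * θ x)) := by
  obtain ⟨C, hC⟩ := hθc.exists_bound_of_continuous hθ
  obtain ⟨R, hR⟩ := hθc.isBounded.subset_closedBall 0
  obtain ⟨N, hN⟩ := exists_setLIntegral_le_unitCube (d := d) R
  have hint : ∀ {f : Euc d → ℝ}, IsOnePeriodic f → AEStronglyMeasurable f volume →
      MemLp f 2 (volume.restrict (unitCube d)) → Integrable fun x => f x * θ x := by
    intro f h1 h2 h3
    have := (h1.locallyIntegrable h2 h3).integrable_smul_right_of_hasCompactSupport hθ hθc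
    simpa using this
  rw [tendsto_iff_edist_tendsto_0]
  have hupper : Tendsto (fun n => ENNReal.ofReal C * (N * eLpNorm (fun x => f n x - f₀ x) 2
      (volume.restrict (unitCube d)))) l (𝓝 0) := by
    have h1 := ENNReal.Tendsto.const_mul (a := (N : ℝ≥0∞)) hlim (Or.inr (ENNReal.natCast_ne_top N))
    have h2 := ENNReal.Tendsto.const_mul (a := ENNReal.ofReal C) h1 (Or.inr ENNReal.ofReal_ne_top)
    simpa using h2
  refine tendsto_of_tendsto_of_tendsto_of_le_of_le tendsto_const_nhds hupper (fun n => bot_le)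
    fun n => ?_
  dsimp only
  rw [edist_eq_enorm_sub, ← integral_sub (hint (hf n) (hm n) (hL n)) (hint hf₀ hm₀ hL₀)]
  calc ‖∫ x, (f n x * θ x - f₀ x * θ x)‖ₑ
      ≤ ∫⁻ x, ‖f n x * θ x - f₀ x * θ x‖ₑ := enorm_integral_le_lintegral_enorm _
    _ = ∫⁻ x in Metric.closedBall 0 R, ‖f n x * θ x - f₀ x * θ x‖ₑ := by
        refine (setLIntegral_eq_of_support_subset fun x hx => hR ?_).symm
        by_contra hx'
        exact hx (by simp [image_eq_zero_of_notMem_tsupport hx'])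
    _ ≤ ∫⁻ x in Metric.closedBall 0 R, ENNReal.ofReal C * ‖f n x - f₀ x‖ₑ := by
        refine lintegral_mono fun x => ?_
        rw [← sub_mul, enorm_mul, mul_comm]
        gcongr
        rw [← ofReal_norm]
        exact ENNReal.ofReal_le_ofReal (hC x)
    _ = ENNReal.ofReal C * ∫⁻ x in Metric.closedBall 0 R, ‖f n x - f₀ x‖ₑ :=
        lintegral_const_mul' _ _ ENNReal.ofReal_ne_top
    _ ≤ ENNReal.ofReal C * (N * eLpNorm (fun x => f n x - f₀ x) 2
      (volume.restrict (unitCube d))) := by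
        gcongr
        refine (hN _ fun i x => by simp only [hf n i x, hf₀ i x]).trans ?_
        gcongr
        rw [← eLpNorm_one_eq_lintegral_enorm]
        exact eLpNorm_le_eLpNorm_of_exponent_le (by norm_num) ((hL n).1.sub hL₀.1)

end CellMinimum

section CellMinimum

variable {d : ℕ} {a : Euc d → ℝ}

theorem norm_sq_toLp_eq_integral {F : Type*} [NormedAddCommGroup F] [InnerProductSpace ℝ F]
    {μ : Measure (Euc d)} (f : Lp F 2 μ) : ‖f‖ ^ 2 = ∫ x, ‖f x‖ ^ 2 ∂μ := by
  rw [← real_inner_self_eq_norm_sq, L2.inner_def]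
  simp_rw [real_inner_self_eq_norm_sq]

theorem norm_gradient (ψ : Euc d → ℝ) (x : Euc d) : ‖gradient ψ x‖ = ‖fderiv ℝ ψ x‖ := by
  simp [gradient]

theorem gradient_sub {ψ ψ' : Euc d → ℝ} {x : Euc d} (h : DifferentiableAt ℝ ψ x)
    (h' : DifferentiableAt ℝ ψ' x) :
    gradient (fun x => ψ x - ψ' x) x = gradient ψ x - gradient ψ' x := by
  simp only [gradient]
  rw [fderiv_fun_sub h h', map_sub]

theorem memLp_sub_const {ψ : Euc d → ℝ} (hψ : Continuous ψ) (m : ℝ) :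
    MemLp (fun x => ψ x - m) 2 (volume.restrict (unitCube d)) :=
  (hψ.sub continuous_const).memLp_restrict_of_isBounded isBounded_unitCube 2

/-- The Poincaré inequality for the difference of two potentials, in terms of weighted
gradients. -/
theorem norm_toLp_sub_sq_le (hac : Continuous a) {α : ℝ} (hα : 0 < α) (hαa : ∀ x, α ≤ a x)
    {ψ ψ' : Euc d → ℝ} (hψ : ContDiff ℝ ∞ ψ) (hψ' : ContDiff ℝ ∞ ψ') (hper : IsOnePeriodic ψ)
    (hper' : IsOnePeriodic ψ') {H H' : Lp (Euc d) 2 (volume.restrict (unitCube d))}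
    (hae : H =ᵐ[volume.restrict (unitCube d)] fun x => √(a x) • gradient ψ x)
    (hae' : H' =ᵐ[volume.restrict (unitCube d)] fun x => √(a x) • gradient ψ' x) :
    ‖(memLp_sub_const hψ.continuous (∫ y in unitCube d, ψ y)).toLp _ -
      (memLp_sub_const hψ'.continuous (∫ y in unitCube d, ψ' y)).toLp _‖ ^ 2 ≤
      (d / α) * ‖H - H'‖ ^ 2 := by
  have hapos : ∀ x, 0 < a x := fun x => hα.trans_le (hαa x)
  have hdiff : ContDiff ℝ ∞ fun x => ψ x - ψ' x := hψ.sub hψ'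
  have hp := poincare_unitCube (ψ := fun x => ψ x - ψ' x)
    (fun i x => by simp only [hper i x, hper' i x]) (hdiff.of_le (by simp))
  rw [integral_sub (hψ.continuous.integrableOn_of_isBounded isBounded_unitCube)
    (hψ'.continuous.integrableOn_of_isBounded isBounded_unitCube)] at hp
  set m := ∫ y in unitCube d, ψ y with hm
  set m' := ∫ y in unitCube d, ψ' y with hm'
  set Φ := (memLp_sub_const hψ.continuous m).toLp _ with hΦ
  set Φ' := (memLp_sub_const hψ'.continuous m').toLp _ with hΦ'
  have e1 : ‖Φ - Φ'‖ ^ 2 = ∫ x in unitCube d, (ψ x - ψ' x - (m - m')) ^ 2 := by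
    rw [norm_sq_toLp_eq_integral]
    refine integral_congr_ae ?_
    filter_upwards [Lp.coeFn_sub Φ Φ', (memLp_sub_const hψ.continuous m).coeFn_toLp,
      (memLp_sub_const hψ'.continuous m').coeFn_toLp] with x h1 h2 h3
    rw [h1, Pi.sub_apply, h2, h3, Real.norm_eq_abs, sq_abs]
    ring
  have e2 : ‖H - H'‖ ^ 2 =
      ∫ x in unitCube d, a x * ‖fderiv ℝ (fun x => ψ x - ψ' x) x‖ ^ 2 := by
    rw [norm_sq_toLp_eq_integral]
    refine integral_congr_ae ?_
    filter_upwards [Lp.coeFn_sub H H', hae, hae'] with x h1 h2 h3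
    rw [h1, Pi.sub_apply, h2, h3, ← smul_sub, ← gradient_sub
      (hψ.differentiable (by simp) x) (hψ'.differentiable (by simp) x), norm_smul,
      norm_gradient, mul_pow, Real.norm_eq_abs, sq_abs, Real.sq_sqrt (hapos x).le]
  rw [e1, e2]
  have hdc : Continuous fun x => ‖fderiv ℝ (fun x => ψ x - ψ' x) x‖ ^ 2 :=
    ((hdiff.continuous_fderiv (by simp)).norm.pow 2)
  refine hp.trans ?_
  rw [div_mul_eq_mul_div, mul_div_assoc]
  gcongr
  rw [le_div_iff₀ hα, mul_comm, ← integral_const_mul]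
  refine integral_mono ((hdc.const_mul _).integrableOn_of_isBounded isBounded_unitCube)
    ((hac.mul hdc).integrableOn_of_isBounded isBounded_unitCube) fun x => ?_
  dsimp only
  gcongr
  exact hαa x

theorem HasCompactSupport.fderiv_apply_const {θ : Euc d → ℝ} (hθc : HasCompactSupport θ)
    (v : Euc d) : HasCompactSupport fun x => fderiv ℝ θ x v :=
  (hθc.fderiv ℝ).mono' (fun x hx => subset_tsupport _ (by
    intro h0
    apply hx
    simp [h0]))

theorem integral_mul_fderiv_eq_neg {ψ θ : Euc d → ℝ} (hψ : ContDiff ℝ 1 ψ) (hθ : ContDiff ℝ 1 θ)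
    (hθc : HasCompactSupport θ) (v : Euc d) :
    ∫ x, ψ x * fderiv ℝ θ x v = -∫ x, fderiv ℝ ψ x v * θ x := by
  have hfc : Continuous fun x => fderiv ℝ ψ x v :=
    (hψ.continuous_fderiv (by simp)).clm_apply continuous_const
  have hθd : Continuous fun x => fderiv ℝ θ x v :=
    (hθ.continuous_fderiv (by simp)).clm_apply continuous_const
  exact integral_mul_fderiv_eq_neg_fderiv_mul_of_integrable
    ((hfc.mul hθ.continuous).integrable_of_hasCompactSupport hθc.mul_left)
    ((hψ.continuous.mul hθd).integrable_of_hasCompactSupport (hθc.fderiv_apply_const v).mul_left)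
    ((hψ.continuous.mul hθ.continuous).integrable_of_hasCompactSupport hθc.mul_left)
    (fun x _ => hψ.differentiable (by simp) x) (fun x _ => hθ.differentiable (by simp) x)

/-- Weak gradients of periodic functions are stable under `L²` limits over a period. -/
theorem isWeakGradient_of_tendsto {ψ : ℕ → Euc d → ℝ} (hψ : ∀ n, ContDiff ℝ ∞ (ψ n))
    (hper : ∀ n, IsOnePeriodic (ψ n)) {φ : Euc d → ℝ} {G : Euc d → Euc d}
    (hφp : IsOnePeriodic φ) (hGp : IsOnePeriodic G) (hφm : AEStronglyMeasurable φ volume)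
    (hGm : AEStronglyMeasurable G volume) (hφL : MemLp φ 2 (volume.restrict (unitCube d)))
    (hGL : MemLp G 2 (volume.restrict (unitCube d)))
    (hlim1 : Tendsto (fun n => eLpNorm (fun x => ψ n x - φ x) 2
      (volume.restrict (unitCube d))) atTop (𝓝 0))
    (hlim2 : Tendsto (fun n => eLpNorm (fun x => gradient (ψ n) x - G x) 2
      (volume.restrict (unitCube d))) atTop (𝓝 0)) : IsWeakGradient univ φ G := by
  refine ⟨locallyIntegrableOn_univ.2 (hφp.locallyIntegrable hφm hφL),
    locallyIntegrableOn_univ.2 (hGp.locallyIntegrable hGm hGL), fun θ hθ hθc _ i => ?_⟩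
  rw [Measure.restrict_univ]
  have hgc : ∀ n, Continuous (gradient (ψ n)) := fun n =>
    continuous_gradient ((hψ n).of_le (by simp))
  have t1 := tendsto_integral_mul_of_periodic hper hφp
    (fun n => (hψ n).continuous.aestronglyMeasurable) hφm
    (fun n => (hψ n).continuous.memLp_restrict_of_isBounded isBounded_unitCube 2) hφL hlim1
    (θ := fun x => fderiv ℝ θ x (EuclideanSpace.single i 1))
    ((hθ.continuous_fderiv (by simp)).clm_apply continuous_const) (hθc.fderiv_apply_const _)
  have hcoord : ∀ {f : Euc d → Euc d}, MemLp f 2 (volume.restrict (unitCube d)) →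
      MemLp (fun x => f x i) 2 (volume.restrict (unitCube d)) := fun hf =>
    hf.of_le ((EuclideanSpace.proj (𝕜 := ℝ) i).continuous.comp_aestronglyMeasurable hf.1)
      (ae_of_all _ fun x => PiLp.norm_apply_le _ i)
  have t2 := tendsto_integral_mul_of_periodic (f := fun n x => gradient (ψ n) x i)
    (f₀ := fun x => G x i) (l := atTop)
    (fun n k x => by simp only [(hper n).gradient k x]) (fun k x => by simp only [hGp k x])
    (fun n => ((EuclideanSpace.proj (𝕜 := ℝ) i).continuous.comp (hgc n)).aestronglyMeasurable)
    ((EuclideanSpace.proj (𝕜 := ℝ) i).continuous.comp_aestronglyMeasurable hGm)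
    (fun n => hcoord ((hgc n).memLp_restrict_of_isBounded isBounded_unitCube 2)) (hcoord hGL)
    (tendsto_of_tendsto_of_tendsto_of_le_of_le tendsto_const_nhds hlim2 (fun n => bot_le)
      fun n => eLpNorm_mono fun x => PiLp.norm_apply_le (gradient (ψ n) x - G x) i)
    hθ.continuous hθc
  refine tendsto_nhds_unique t1 (t2.neg.congr fun n => ?_)
  rw [integral_mul_fderiv_eq_neg ((hψ n).of_le (by simp)) (hθ.of_le (by simp)) hθc]
  simp only [gradient_apply]

theorem cauchySeq_of_norm_sub_sq_le {E E' : Type*} [NormedAddCommGroup E] [NormedAddCommGroup E']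
    {u : ℕ → E} {H : ℕ → E'} {C : ℝ} (hC : 0 ≤ C)
    (hu : ∀ n k, ‖u n - u k‖ ^ 2 ≤ C * ‖H n - H k‖ ^ 2) (hH : CauchySeq H) : CauchySeq u := by
  rw [Metric.cauchySeq_iff'] at hH ⊢
  intro η hη
  have hK : 0 < √C + 1 := by positivity
  obtain ⟨N, hN⟩ := hH (η / (√C + 1)) (by positivity)
  refine ⟨N, fun n hn => ?_⟩
  have h1 := hN n hn
  rw [dist_eq_norm, lt_div_iff₀ hK] at h1
  rw [dist_eq_norm]
  have h2 : ‖u n - u N‖ ≤ √C * ‖H n - H N‖ := by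
    rw [← Real.sqrt_sq (norm_nonneg (H n - H N)), ← Real.sqrt_mul hC]
    exact Real.le_sqrt_of_sq_le (hu n N)
  nlinarith [norm_nonneg (H n - H N)]

/-- The values of a function on the unit cube extend periodically to the whole space. -/
theorem exists_periodic_extension {F : Type*} [TopologicalSpace F] {f : Euc d → F}
    (hf : StronglyMeasurable f) : ∃ φ : Euc d → F, IsOnePeriodic φ ∧ StronglyMeasurable φ ∧
      φ =ᵐ[volume.restrict (unitCube d)] f := by
  refine ⟨fun x => f (cubeFract x), isOnePeriodic_comp_cubeFract f,
    hf.comp_measurable measurable_cubeFract, ?_⟩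
  filter_upwards [ae_restrict_mem measurableSet_unitCube] with x hx
  rw [cubeFract_eq_self hx]

/-- Every limit of weighted smooth gradients is a weighted weak gradient of a periodic function:
by the Poincaré inequality the potentials, normalized to mean zero, converge as well. -/
theorem exists_periodic_potential (hac : Continuous a) {α : ℝ} (hα : 0 < α)
    (hαa : ∀ x, α ≤ a x) {h : Lp (Euc d) 2 (volume.restrict (unitCube d))}
    (hh : h ∈ (gradientFields a).topologicalClosure) :
    ∃ (φ : Euc d → ℝ) (G : Euc d → Euc d), IsOnePeriodic φ ∧ IsWeakGradient univ φ G ∧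
      MemLp φ 2 (volume.restrict (unitCube d)) ∧ MemLp G 2 (volume.restrict (unitCube d)) ∧
      h =ᵐ[volume.restrict (unitCube d)] fun x => √(a x) • G x := by
  have hapos : ∀ x, 0 < a x := fun x => hα.trans_le (hαa x)
  have hsq : ∀ x, 0 < √(a x) := fun x => Real.sqrt_pos.2 (hapos x)
  obtain ⟨H, hmem, hlim⟩ := mem_closure_iff_seq_limit.1 hh
  choose ψ hψ hper hae using hmem
  -- the potentials `U n`, normalized to mean zero
  obtain ⟨m, U, hUae, hU⟩ : ∃ (m : ℕ → ℝ) (U : ℕ → Lp ℝ 2 (volume.restrict (unitCube d))),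
      (∀ n, U n =ᵐ[volume.restrict (unitCube d)] fun x => ψ n x - m n) ∧
      ∀ n k, ‖U n - U k‖ ^ 2 ≤ (d / α) * ‖H n - H k‖ ^ 2 :=
    ⟨fun n => ∫ y in unitCube d, ψ n y,
      fun n => (memLp_sub_const (hψ n).continuous (∫ y in unitCube d, ψ n y)).toLp _,
      fun n => MemLp.coeFn_toLp _,
      fun n k => norm_toLp_sub_sq_le hac hα hαa (hψ n) (hψ k) (hper n) (hper k) (hae n) (hae k)⟩
  obtain ⟨Φ, hΦ⟩ := cauchySeq_tendsto_of_complete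
    (cauchySeq_of_norm_sub_sq_le (by positivity) hU hlim.cauchySeq)
  obtain ⟨φ, hφp, hφm, hφae⟩ := exists_periodic_extension (Lp.stronglyMeasurable Φ)
  have hGm0 : StronglyMeasurable fun x => (√(a x))⁻¹ • h x := by
    have hs : StronglyMeasurable fun x => (√(a x))⁻¹ :=
      (Continuous.inv₀ (by fun_prop) fun x => (hsq x).ne').stronglyMeasurable
    exact hs.smul (Lp.stronglyMeasurable h)
  obtain ⟨G, hGp, hGm, hGae⟩ := exists_periodic_extension hGm0
  have hφL : MemLp φ 2 (volume.restrict (unitCube d)) := (Lp.memLp Φ).ae_eq hφae.symm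
  have hGL : MemLp G 2 (volume.restrict (unitCube d)) :=
    (memLp_inv_sqrt_smul hac hα hαa (Lp.memLp h)).ae_eq hGae.symm
  have hlim1 : Tendsto (fun n => eLpNorm (fun x => (ψ n x - m n) - φ x) 2
      (volume.restrict (unitCube d))) atTop (𝓝 0) := by
    have h1 := tendsto_iff_edist_tendsto_0.1 hΦ
    refine h1.congr fun n => ?_
    rw [Lp.edist_def]
    refine eLpNorm_congr_ae ?_
    filter_upwards [hUae n, hφae] with x h2 h3
    rw [Pi.sub_apply, h2, h3]
  have hlim2 : Tendsto (fun n => eLpNorm (fun x => gradient (ψ n) x - G x) 2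
      (volume.restrict (unitCube d))) atTop (𝓝 0) := by
    have h1 := tendsto_iff_edist_tendsto_0.1 hlim
    have h2 := ENNReal.Tendsto.const_mul (a := ENNReal.ofReal (√α)⁻¹) h1
      (Or.inr ENNReal.ofReal_ne_top)
    rw [mul_zero] at h2
    refine tendsto_of_tendsto_of_tendsto_of_le_of_le tendsto_const_nhds h2 (fun n => bot_le)
      fun n => ?_
    dsimp only
    rw [Lp.edist_def]
    refine le_trans (le_of_eq (eLpNorm_congr_ae ?_)) (eLpNorm_inv_sqrt_smul_le hα hαa _)
    filter_upwards [hae n, hGae] with x h2 h3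
    rw [Pi.sub_apply, h2, h3, smul_sub, smul_smul, inv_mul_cancel₀ (hsq x).ne', one_smul]
  have hgm : ∀ n x, gradient (fun x => ψ n x - m n) x = gradient (ψ n) x := fun n x => by
    simp only [gradient, fderiv_sub_const]
  refine ⟨φ, G, hφp, isWeakGradient_of_tendsto (ψ := fun n x => ψ n x - m n)
    (fun n => (hψ n).sub contDiff_const) (fun n i x => by simp only [hper n i x]) hφp hGp
    hφm.aestronglyMeasurable hGm.aestronglyMeasurable hφL hGL hlim1
    (by simpa only [hgm] using hlim2), hφL, hGL, ?_⟩
  · filter_upwards [hGae] with x hx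
    rw [hx, smul_smul, mul_inv_cancel₀ (hsq x).ne', one_smul]

/-- The Gram matrix of the optimal fields is the homogenized matrix. -/
theorem isHomogenizedMatrix_homMatrix (hac : Continuous a) {α β : ℝ} (hα : 0 < α)
    (hαa : ∀ x, α ≤ a x) (hβ : ∀ x, a x ≤ β) : IsHomogenizedMatrix a (homMatrix hac) := by
  have hapos : ∀ x, 0 < a x := fun x => hα.trans_le (hαa x)
  refine ⟨homMatrix_isSymm hac, fun z => ⟨?_, ?_⟩⟩
  · obtain ⟨φ, G, h1, h2, h3, h4, h5⟩ := exists_periodic_potential hac hα hαa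
      (optimalField_sub_mem hac z)
    refine ⟨φ, G, h1, h2, h3, h4, ?_⟩
    rw [quadForm_homMatrix, norm_sq_toLp_eq_integral]
    refine integral_congr_ae ?_
    filter_upwards [h5, Lp.coeFn_sub (optimalField hac z) (weightedConst hac z),
      coeFn_weightedConst hac z] with x e1 e2 e3
    rw [e2, Pi.sub_apply, e3, sub_eq_iff_eq_add, ← smul_add, add_comm] at e1
    rw [e1, norm_smul, mul_pow, Real.norm_eq_abs, sq_abs, Real.sq_sqrt (hapos x).le]
  · rintro c ⟨φ, G, h1, h2, h3, h4, rfl⟩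
    have hmem := toLp_weakGradient_mem hac hβ h1 h2 h4
    set g := (memLp_sqrt_smul hac hβ h4).toLp _ with hg
    have e0 : ∫ y in unitCube d, a y * ‖z + G y‖ ^ 2 = ‖weightedConst hac z + g‖ ^ 2 := by
      rw [norm_sq_toLp_eq_integral]
      refine integral_congr_ae ?_
      filter_upwards [Lp.coeFn_add (weightedConst hac z) g, coeFn_weightedConst hac z,
        (memLp_sqrt_smul hac hβ h4).coeFn_toLp] with x e1 e2 e3
      rw [e1, Pi.add_apply, e2, hg, e3, ← smul_add, norm_smul, mul_pow, Real.norm_eq_abs, sq_abs,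
        Real.sq_sqrt (hapos x).le]
    rw [e0, quadForm_homMatrix]
    set q := optimalField hac z with hq
    -- the difference of `√a (z + G)` and the optimal field is a limit of weighted gradients, hence
    -- orthogonal to the optimal field
    have hw : weightedConst hac z + g = q + (g - (q - weightedConst hac z)) := by abel
    have horth : inner ℝ q (g - (q - weightedConst hac z)) = 0 :=
      inner_optimalField_eq_zero hac z (sub_mem hmem (optimalField_sub_mem hac z))
    rw [hw, norm_add_sq_real, horth]
    nlinarith [sq_nonneg ‖g - (q - weightedConst hac z)‖]

/-- The homogenized matrix has the same lower bound as the coefficient. -/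
theorem mul_norm_sq_le_quadForm_homMatrix (hac : Continuous a) {α : ℝ} (hα : 0 < α)
    (hαa : ∀ x, α ≤ a x) (z : Euc d) : α * ‖z‖ ^ 2 ≤ quadForm (homMatrix hac) z := by
  have hapos : ∀ x, 0 < a x := fun x => hα.trans_le (hαa x)
  have hsq : ∀ x, 0 < √(a x) := fun x => Real.sqrt_pos.2 (hapos x)
  -- the field `z / √a` is orthogonal to all weighted gradients, as gradients have mean zero
  have hcm : Continuous fun x : Euc d => (√(a x))⁻¹ • z :=
    (Continuous.inv₀ (by fun_prop) fun x => (hsq x).ne').smul continuous_const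
  have hm : MemLp (fun x => (√(a x))⁻¹ • z) 2 (volume.restrict (unitCube d)) :=
    hcm.memLp_restrict_of_isBounded isBounded_unitCube 2
  set w := hm.toLp _ with hw
  have horth : ∀ h ∈ (gradientFields a).topologicalClosure, inner ℝ h w = 0 := by
    intro h hh
    have hcl : IsClosed {h : Lp (Euc d) 2 (volume.restrict (unitCube d)) | inner ℝ h w = 0} :=
      isClosed_eq (by fun_prop) continuous_const
    refine closure_minimal (fun g hg => ?_) hcl hh
    obtain ⟨ψ, hψ, hper, hae⟩ := hg
    rw [Set.mem_ofPred_eq, inner_toLp_right_eq_integral,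
      ← setIntegral_unitCube_fderiv_eq_zero hper (hψ.of_le (by simp)) z]
    refine integral_congr_ae ?_
    filter_upwards [hae] with x hx
    rw [hx, inner_smul_left, inner_smul_right, ← mul_assoc, conj_trivial,
      mul_inv_cancel₀ (hsq x).ne', one_mul, inner_gradient_left]
  have h1 : inner ℝ (optimalField hac z) w = ‖z‖ ^ 2 := by
    have h2 := horth _ (optimalField_sub_mem hac z)
    rw [inner_sub_left, sub_eq_zero] at h2
    rw [h2, inner_toLp_right_eq_integral]
    have : ∫ x in unitCube d, inner ℝ (weightedConst hac z x) ((√(a x))⁻¹ • z) =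
        ∫ x in unitCube d, ‖z‖ ^ 2 := by
      refine integral_congr_ae ?_
      filter_upwards [coeFn_weightedConst hac z] with x hx
      rw [hx, inner_smul_left, inner_smul_right, ← mul_assoc, conj_trivial,
        mul_inv_cancel₀ (hsq x).ne', one_mul, real_inner_self_eq_norm_sq]
    rw [this]
    simp
  have h3 : ‖w‖ ^ 2 ≤ α⁻¹ * ‖z‖ ^ 2 := by
    rw [norm_sq_toLp_eq_integral]
    have : ∫ x in unitCube d, ‖w x‖ ^ 2 = ∫ x in unitCube d, ‖(√(a x))⁻¹ • z‖ ^ 2 := by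
      refine integral_congr_ae ?_
      filter_upwards [hm.coeFn_toLp] with x hx
      rw [hw, hx]
    rw [this]
    calc ∫ x in unitCube d, ‖(√(a x))⁻¹ • z‖ ^ 2 ≤ ∫ x in unitCube d, α⁻¹ * ‖z‖ ^ 2 := by
          refine integral_mono ((hcm.norm.pow 2).integrableOn_of_isBounded isBounded_unitCube)
            (integrable_const _) fun x => ?_
          dsimp only
          rw [norm_smul, mul_pow, Real.norm_eq_abs, sq_abs, inv_pow, Real.sq_sqrt (hapos x).le]
          gcongr
          exact hαa x
      _ = α⁻¹ * ‖z‖ ^ 2 := by simp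
  -- Cauchy–Schwarz for the pairing of the optimal field with `z / √a`
  have h4 := abs_real_inner_le_norm (optimalField hac z) w
  rw [h1, abs_of_nonneg (by positivity)] at h4
  rw [quadForm_homMatrix]
  have h5 : (‖z‖ ^ 2) ^ 2 ≤ ‖optimalField hac z‖ ^ 2 * ‖w‖ ^ 2 := by
    rw [← mul_pow]; gcongr
  have h6 : (‖z‖ ^ 2) ^ 2 ≤ ‖optimalField hac z‖ ^ 2 * (α⁻¹ * ‖z‖ ^ 2) :=
    h5.trans (by gcongr)
  by_cases hz : ‖z‖ ^ 2 = 0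
  · rw [hz, mul_zero]; positivity
  · have hz0 : 0 < ‖z‖ ^ 2 := lt_of_le_of_ne (by positivity) (Ne.symm hz)
    have h7 : ‖z‖ ^ 2 ≤ ‖optimalField hac z‖ ^ 2 * α⁻¹ := by
      refine le_of_mul_le_mul_right ?_ hz0
      calc ‖z‖ ^ 2 * ‖z‖ ^ 2 = (‖z‖ ^ 2) ^ 2 := by ring
        _ ≤ _ := h6
        _ = _ := by ring
    rwa [← div_eq_mul_inv, le_div_iff₀ hα, mul_comm] at h7

end CellMinimum

section Fluxes

variable {d : ℕ} {a : Euc d → ℝ}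

/-- The divergence of a vector field. -/
noncomputable def divergence (P : Euc d → Euc d) (x : Euc d) : ℝ :=
  ∑ k, fderiv ℝ P x (EuclideanSpace.single k 1) k

/-- A continuous periodic function vanishing in `L²` over a period vanishes identically. Each point is
translated to the centre of the cube, since its own translates by the lattice may miss the open cube. -/
theorem eq_zero_of_setIntegral_sq_eq_zero {ψ : Euc d → ℝ} (hper : IsOnePeriodic ψ)
    (hc : Continuous ψ) (h : ∫ x in unitCube d, ψ x ^ 2 = 0) : ψ = 0 := by
  ext x₀
  set c : Euc d := WithLp.toLp 2 (fun _ => 1 / 2) with hcdef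
  have hcQ : c ∈ unitCube d := fun i => by
    rw [hcdef]
    norm_num
  have hfc : Continuous fun x => ψ (x + (x₀ - c)) := by fun_prop
  have h1 : ∫ x in unitCube d, ψ (x + (x₀ - c)) ^ 2 = 0 := by
    rw [← h, ← setIntegral_unitCube_add (f := fun x => ψ x ^ 2)
      (fun i x => by simp only [hper i x]) (x₀ - c)]
  rw [integral_eq_zero_iff_of_nonneg (fun x => sq_nonneg _)
    ((hfc.pow 2).integrableOn_of_isBounded isBounded_unitCube)] at h1
  have h2 := Measure.eqOn_open_of_ae_eq h1 isOpen_unitCube (hfc.pow 2).continuousOn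
    continuousOn_const
  have h3 := h2 hcQ
  simpa using h3

/-- A smooth periodic field orthogonal to all smooth periodic gradients is divergence free. -/
theorem divergence_eq_zero_of_forall_gradient {P : Euc d → Euc d} (hP : ContDiff ℝ ∞ P)
    (hper : IsOnePeriodic P) (h : ∀ ψ : Euc d → ℝ, ContDiff ℝ ∞ ψ → IsOnePeriodic ψ →
      ∫ x in unitCube d, inner ℝ (P x) (gradient ψ x) = 0) : divergence P = 0 := by
  set ψ := divergence P with hψ
  have hψc : ContDiff ℝ ∞ ψ := by
    refine ContDiff.sum fun k _ => ?_
    have h1 : ContDiff ℝ ∞ fun x => fderiv ℝ P x (EuclideanSpace.single k 1) :=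
      (hP.fderiv_right (m := ∞) (by simp)).clm_apply contDiff_const
    exact (EuclideanSpace.proj (𝕜 := ℝ) k).contDiff.comp h1
  have hψp : IsOnePeriodic ψ := fun i x => by
    simp only [hψ, divergence, hper.fderiv i x]
  -- the divergence is itself admissible as a test function: integrating by parts over a period
  -- gives `∫ |div P|² = -∫ ⟪P, ∇ div P⟫ = 0`
  refine eq_zero_of_setIntegral_sq_eq_zero hψp hψc.continuous ?_
  have hk : ∀ k, ContDiff ℝ ∞ fun x => P x k := fun k =>
    (EuclideanSpace.proj (𝕜 := ℝ) k).contDiff.comp hP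
  have hfd : ∀ k x, fderiv ℝ (fun x => ψ x * P x k) x (EuclideanSpace.single k 1) =
      ψ x * fderiv ℝ P x (EuclideanSpace.single k 1) k + P x k * gradient ψ x k := by
    intro k x
    rw [fderiv_fun_mul (hψc.differentiable (by simp) x) ((hk k).differentiable (by simp) x)]
    have h2 : fderiv ℝ (fun x => P x k) x = (EuclideanSpace.proj (𝕜 := ℝ) k).comp (fderiv ℝ P x) :=
      ((EuclideanSpace.proj (𝕜 := ℝ) k).hasFDerivAt.comp x
        (hP.differentiable (by simp) x).hasFDerivAt).fderiv
    rw [h2, gradient_apply]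
    simp
  have hzero : ∀ k, ∫ x in unitCube d,
      (ψ x * fderiv ℝ P x (EuclideanSpace.single k 1) k + P x k * gradient ψ x k) = 0 := by
    intro k
    simp_rw [← hfd]
    exact setIntegral_unitCube_fderiv_eq_zero (fun i x => by simp only [hψp i x, hper i x])
      ((hψc.mul (hk k)).of_le (by simp)) _
  have hgc : Continuous (gradient ψ) := continuous_gradient (hψc.of_le (by simp))
  have hc1 : ∀ k, Continuous fun x => ψ x * fderiv ℝ P x (EuclideanSpace.single k 1) k := fun k =>
    hψc.continuous.mul ((EuclideanSpace.proj (𝕜 := ℝ) k).continuous.comp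
      ((hP.continuous_fderiv (by simp)).clm_apply continuous_const))
  have hc2 : ∀ k, Continuous fun x => P x k * gradient ψ x k := fun k =>
    (hk k).continuous.mul ((EuclideanSpace.proj (𝕜 := ℝ) k).continuous.comp hgc)
  have hsum := Finset.sum_congr (rfl : (Finset.univ : Finset (Fin d)) = Finset.univ)
    fun k _ => hzero k
  have hint : ∀ k, IntegrableOn (fun x => ψ x * fderiv ℝ P x (EuclideanSpace.single k 1) k +
      P x k * gradient ψ x k) (unitCube d) := fun k =>
    ((hc1 k).add (hc2 k)).integrableOn_of_isBounded isBounded_unitCube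
  rw [← integral_finsetSum _ fun k _ => hint k] at hsum
  have e : ∀ x, ∑ k, (ψ x * fderiv ℝ P x (EuclideanSpace.single k 1) k + P x k * gradient ψ x k) =
      ψ x ^ 2 + inner ℝ (P x) (gradient ψ x) := by
    intro x
    rw [Finset.sum_add_distrib, ← Finset.mul_sum, sq, PiLp.inner_apply]
    congr 1
    refine Finset.sum_congr rfl fun k _ => ?_
    rw [RCLike.inner_apply, conj_trivial, mul_comm]
  simp_rw [e] at hsum
  have hi2 : IntegrableOn (fun x => ψ x ^ 2) (unitCube d) :=
    (hψc.continuous.pow 2).integrableOn_of_isBounded isBounded_unitCube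
  rw [integral_add hi2
    ((hP.continuous.inner hgc).integrableOn_of_isBounded isBounded_unitCube), h ψ hψc hψp] at hsum
  simpa using hsum

/-- Mollification preserves orthogonality to the smooth periodic gradients. -/
theorem setIntegral_inner_mollify_gradient_eq_zero {p : Euc d → Euc d} (hper : IsOnePeriodic p)
    (hm : AEStronglyMeasurable p volume) (hL : MemLp p 2 (volume.restrict (unitCube d)))
    (h : ∀ ψ : Euc d → ℝ, ContDiff ℝ ∞ ψ → IsOnePeriodic ψ →
      ∫ x in unitCube d, inner ℝ (p x) (gradient ψ x) = 0) (φ : ContDiffBump (0 : Euc d))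
    {ψ : Euc d → ℝ} (hψ : ContDiff ℝ ∞ ψ) (hψp : IsOnePeriodic ψ) :
    ∫ x in unitCube d, inner ℝ (mollify φ p x) (gradient ψ x) = 0 := by
  set ρ : Euc d → ℝ := φ.normed volume with hρ
  have hρc : Continuous ρ := φ.continuous_normed
  have hρi : Integrable ρ := φ.integrable_normed
  have hgc : Continuous (gradient ψ) := continuous_gradient (hψ.of_le (by simp))
  obtain ⟨C, hC⟩ := hψp.gradient.exists_norm_le hgc
  have hC0 : 0 ≤ C := (norm_nonneg _).trans (hC 0)
  have hpint : IntegrableOn p (unitCube d) := hL.integrable (by norm_num)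
  have hpt : ∀ t, IntegrableOn (fun x => p (x - t)) (unitCube d) := fun t => by
    simpa only [sub_eq_add_neg] using integrableOn_unitCube_add hper hpint (-t)
  have hloc := hper.locallyIntegrable hm hL
  have hjm : AEStronglyMeasurable
      (fun z : Euc d × Euc d => ρ z.2 * inner ℝ (p (z.1 - z.2)) (gradient ψ z.1))
      ((volume.restrict (unitCube d)).prod volume) := by
    refine ((hρc.comp continuous_snd).aestronglyMeasurable).mul (AEStronglyMeasurable.inner ?_
      (hgc.comp continuous_fst).aestronglyMeasurable)
    have h1 : AEStronglyMeasurable (fun z : Euc d × Euc d => p (z.1 - z.2))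
        (volume.prod volume) :=
      hm.comp_quasiMeasurePreserving (quasiMeasurePreserving_sub volume volume)
    refine h1.mono_measure ?_
    rw [Measure.restrict_prod_eq_prod_univ]
    exact Measure.restrict_le_self
  have hnb : ∀ x t, ‖ρ t * inner ℝ (p (x - t)) (gradient ψ x)‖ ≤ ρ t * C * ‖p (x - t)‖ := by
    intro x t
    rw [norm_mul, Real.norm_of_nonneg (φ.nonneg_normed t), mul_assoc]
    refine mul_le_mul_of_nonneg_left ?_ (φ.nonneg_normed t)
    rw [mul_comm]
    exact (norm_inner_le_norm _ _).trans (by gcongr; exact hC x)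
  have hint1 : ∀ t, IntegrableOn (fun x => ρ t * inner ℝ (p (x - t)) (gradient ψ x))
      (unitCube d) := by
    intro t
    refine Integrable.mono' ((hpt t).norm.const_mul (ρ t * C)) ?_ (ae_of_all _ fun x => hnb x t)
    exact ((hpt t).aestronglyMeasurable.inner hgc.aestronglyMeasurable).const_mul _
  have hprod : Integrable
      (fun z : Euc d × Euc d => ρ z.2 * inner ℝ (p (z.1 - z.2)) (gradient ψ z.1))
      ((volume.restrict (unitCube d)).prod volume) := by
    rw [integrable_prod_iff' hjm]
    refine ⟨ae_of_all _ hint1, ?_⟩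
    refine Integrable.mono' (hρi.mul_const (C * ∫ x in unitCube d, ‖p x‖))
      hjm.norm.prod_swap.integral_prod_right' (ae_of_all _ fun t => ?_)
    rw [Real.norm_of_nonneg (integral_nonneg fun x => norm_nonneg _)]
    calc ∫ x in unitCube d, ‖ρ t * inner ℝ (p (x - t)) (gradient ψ x)‖
        ≤ ∫ x in unitCube d, ρ t * C * ‖p (x - t)‖ :=
          integral_mono (hint1 t).norm ((hpt t).norm.const_mul _) fun x => hnb x t
      _ = ρ t * (C * ∫ x in unitCube d, ‖p x‖) := by
          rw [integral_const_mul, mul_assoc]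
          congr 2
          have := setIntegral_unitCube_add (f := fun x => ‖p x‖)
            (fun i x => by simp only [hper i x]) (-t)
          simpa only [sub_eq_add_neg] using this
  -- a translation may be moved from `p` to the test function
  have hzero : ∀ t, ∫ x in unitCube d, ρ t * inner ℝ (p (x - t)) (gradient ψ x) = 0 := by
    intro t
    rw [integral_const_mul]
    have h1 := setIntegral_unitCube_add (f := fun x => inner ℝ (p (x - t)) (gradient ψ x))
      (fun i x => by
        dsimp only
        rw [add_sub_right_comm, hper, hψp.gradient i x]) t
    have h2 : ∀ x, gradient (fun y => ψ (y + t)) x = gradient ψ (x + t) := fun x => by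
      simp only [gradient, fderiv_comp_add_right]
    have h3 := h (fun y => ψ (y + t)) (hψ.comp (by fun_prop)) (fun i x => by
      dsimp only
      rw [add_right_comm, hψp])
    simp only [add_sub_cancel_right, ← h2] at h1
    rw [← h1, h3, mul_zero]
  have hmol : ∀ x, inner ℝ (mollify φ p x) (gradient ψ x) =
      ∫ t, ρ t * inner ℝ (p (x - t)) (gradient ψ x) := by
    intro x
    rw [mollify_apply, real_inner_comm, ← integral_inner (integrable_mollify_integrand φ hloc x)]
    refine integral_congr_ae (ae_of_all _ fun t => ?_)
    dsimp only
    rw [inner_smul_right, real_inner_comm]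
  simp_rw [hmol]
  rw [integral_integral_swap hprod]
  simp_rw [hzero]
  simp

/-- Smooth periodic divergence-free fields approximating the optimal fluxes `a (e_i + ∇φ_i)` of the
cell problem. -/
theorem exists_smooth_fluxes (hac : Continuous a) {α β : ℝ} (hα : 0 < α)
    (hαa : ∀ x, α ≤ a x) (hβ : ∀ x, a x ≤ β) :
    ∃ P : ℕ → Fin d → Euc d → Euc d, (∀ n i, ContDiff ℝ ∞ (P n i)) ∧
      (∀ n i, IsOnePeriodic (P n i)) ∧ (∀ n i x, divergence (P n i) x = 0) ∧
      (∀ i k, Tendsto (fun n => ∫ x in unitCube d, P n i x k) atTop (𝓝 (homMatrix hac i k))) ∧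
      ∀ i k, Tendsto (fun n => ∫ x in unitCube d, inner ℝ (P n i x) (P n k x) / a x) atTop
        (𝓝 (homMatrix hac i k)) := by
  have hapos : ∀ x, 0 < a x := fun x => hα.trans_le (hαa x)
  have hsq : ∀ x, 0 < √(a x) := fun x => Real.sqrt_pos.2 (hapos x)
  set q : Fin d → Lp (Euc d) 2 (volume.restrict (unitCube d)) :=
    fun i => optimalField hac (EuclideanSpace.single i 1) with hq
  have hsm : ∀ i, StronglyMeasurable fun x => √(a x) • q i x := fun i => by
    have hs : StronglyMeasurable fun x => √(a x) := (by fun_prop : Continuous _).stronglyMeasurable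
    exact hs.smul (Lp.stronglyMeasurable (q i))
  -- the optimal fluxes, extended periodically
  choose p hpper hpm hpae using fun i => exists_periodic_extension (hsm i)
  have hpL : ∀ i, MemLp (p i) 2 (volume.restrict (unitCube d)) := fun i =>
    (memLp_sqrt_smul hac hβ (Lp.memLp (q i))).ae_eq (hpae i).symm
  have hporth : ∀ i (ψ : Euc d → ℝ), ContDiff ℝ ∞ ψ → IsOnePeriodic ψ →
      ∫ x in unitCube d, inner ℝ (p i x) (gradient ψ x) = 0 := by
    intro i ψ hψ hψp
    have hL : MemLp (gradient ψ) 2 (volume.restrict (unitCube d)) :=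
      (continuous_gradient (hψ.of_le (by simp))).memLp_restrict_of_isBounded isBounded_unitCube 2
    have hmem : (memLp_sqrt_smul hac hβ hL).toLp _ ∈ gradientFields a :=
      ⟨ψ, hψ, hψp, MemLp.coeFn_toLp _⟩
    have h1 := inner_optimalField_eq_zero hac (EuclideanSpace.single i 1)
      (Submodule.le_topologicalClosure _ hmem)
    rw [inner_toLp_right_eq_integral] at h1
    rw [← h1]
    refine integral_congr_ae ?_
    filter_upwards [hpae i] with x hx
    rw [hx, inner_smul_left, inner_smul_right, conj_trivial]
  -- one mollification scale for all directions
  have hδ : ∀ n : ℕ, ∃ δ > 0, ∀ i, ∀ φ : ContDiffBump (0 : Euc d), φ.rOut ≤ δ →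
      eLpNorm (fun x => mollify φ (p i) x - p i x) 2 (volume.restrict (unitCube d)) ≤
        ((n : ℝ≥0∞) + 1)⁻¹ := by
    intro n
    choose δ hδ hb using fun i => (hpper i).exists_forall_mollify_sub_le
      (hpm i).aestronglyMeasurable (hpL i) (η := ((n : ℝ≥0∞) + 1)⁻¹) (by simp)
    rcases Nat.eq_zero_or_pos d with hd | hd
    · subst hd
      exact ⟨1, one_pos, fun i => i.elim0⟩
    · have : Nonempty (Fin d) := ⟨⟨0, hd⟩⟩
      obtain ⟨i₀, hi₀⟩ := Finite.exists_min δ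
      exact ⟨δ i₀, hδ i₀, fun i φ hφ => hb i φ (hφ.trans (hi₀ i))⟩
  choose δ hδ0 hδ using hδ
  set P : ℕ → Fin d → Euc d → Euc d := fun n i => mollify (bumpOfRadius d (hδ0 n)) (p i) with hP
  have hPc : ∀ n i, ContDiff ℝ ∞ (P n i) := fun n i =>
    contDiff_mollify _ ((hpper i).locallyIntegrable (hpm i).aestronglyMeasurable (hpL i))
  have hPp : ∀ n i, IsOnePeriodic (P n i) := fun n i => (hpper i).mollify _
  have hPL : ∀ n i, MemLp (P n i) 2 (volume.restrict (unitCube d)) := fun n i =>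
    (hPc n i).continuous.memLp_restrict_of_isBounded isBounded_unitCube 2
  have hlim : ∀ i, Tendsto (fun n => (memLp_inv_sqrt_smul hac hα hαa (hPL n i)).toLp _) atTop
      (𝓝 (q i)) := by
    intro i
    rw [tendsto_iff_edist_tendsto_0]
    have h2 := ENNReal.Tendsto.const_mul (a := ENNReal.ofReal (√α)⁻¹)
      ((ENNReal.tendsto_inv_nat_nhds_zero).comp (tendsto_add_atTop_nat 1))
      (Or.inr ENNReal.ofReal_ne_top)
    rw [mul_zero] at h2
    refine tendsto_of_tendsto_of_tendsto_of_le_of_le tendsto_const_nhds h2 (fun n => bot_le)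
      fun n => ?_
    dsimp only
    rw [Lp.edist_def]
    have h3 := hδ n i (bumpOfRadius d (hδ0 n)) le_rfl
    refine le_trans (le_trans (le_of_eq (eLpNorm_congr_ae ?_)) (eLpNorm_inv_sqrt_smul_le hα hαa
      (fun x => mollify (bumpOfRadius d (hδ0 n)) (p i) x - p i x))) ?_
    · filter_upwards [(memLp_inv_sqrt_smul hac hα hαa (hPL n i)).coeFn_toLp, hpae i] with x e1 e2
      rw [Pi.sub_apply, e1, smul_sub, e2, smul_smul, inv_mul_cancel₀ (hsq x).ne', one_smul]
    · gcongr
      simpa using h3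
  refine ⟨P, hPc, hPp, fun n i x => ?_, fun i k => ?_, fun i k => ?_⟩
  · exact congrFun (divergence_eq_zero_of_forall_gradient (hPc n i) (hPp n i) fun ψ hψ hψp =>
      setIntegral_inner_mollify_gradient_eq_zero (hpper i) (hpm i).aestronglyMeasurable (hpL i)
        (hporth i) _ hψ hψp) x
  · have h1 := (hlim i).inner (𝕜 := ℝ)
      (tendsto_const_nhds (x := weightedConst hac (EuclideanSpace.single k 1)))
    rw [hq, inner_optimalField_weightedConst] at h1
    refine h1.congr fun n => ?_
    rw [L2.inner_def]
    refine integral_congr_ae ?_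
    filter_upwards [(memLp_inv_sqrt_smul hac hα hαa (hPL n i)).coeFn_toLp,
      coeFn_weightedConst hac (EuclideanSpace.single k 1)] with x e1 e2
    rw [e1, e2, inner_smul_left, inner_smul_right, ← mul_assoc, conj_trivial,
      inv_mul_cancel₀ (hsq x).ne', one_mul, EuclideanSpace.inner_single_right]
    simp
  · refine ((hlim i).inner (𝕜 := ℝ) (hlim k)).congr fun n => ?_
    rw [inner_toLp_eq_integral]
    refine integral_congr_ae (ae_of_all _ fun x => ?_)
    dsimp only
    rw [inner_smul_left, inner_smul_right, ← mul_assoc, conj_trivial, ← mul_inv,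
      Real.mul_self_sqrt (hapos x).le, div_eq_inv_mul]

end Fluxes

/-! ### The surface area of the unit sphere

The area of a small spherical cap is compared with that of a disc by the orthogonal projection and
its inverse, which have Lipschitz constants close to `1`. The volume of the solid sector under the
cap is computed by slices orthogonal to the axis, and is compared with the same disc. Rotational
invariance transfers the resulting ratio from the cap to the whole sphere.
-/

/-- The disc of radius `r` in the hyperplane orthogonal to `e`. -/
def orthogonalDisc {d : ℕ} (e : Euc d) (r : ℝ) : Set (Euc d) := {y | inner ℝ e y = 0 ∧ ‖y‖ < r}

/-- The spherical cap of the unit vectors `x` with `⟪e, x⟫ > c`. -/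
def sphericalCap {d : ℕ} (e : Euc d) (c : ℝ) : Set (Euc d) :=
  {x | ‖x‖ = 1 ∧ c < inner ℝ e x}

/-- The open convex cone with axis `e` and aperture `c`. -/
def openCone {d : ℕ} (e : Euc d) (c : ℝ) : Set (Euc d) := {y | c * ‖y‖ < inner ℝ e y}

/-- Only positivity and finiteness of the area of the disc are needed: its value cancels. -/
theorem euclideanHausdorffMeasure_orthogonalDisc_one {d : ℕ} (hd : 1 ≤ d) {e : Euc d}
    (he : ‖e‖ = 1) :
    μHE[d - 1] (orthogonalDisc e 1) ≠ 0 ∧ μHE[d - 1] (orthogonalDisc e 1) ≠ ⊤ := by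
  have he0 : e ≠ 0 := by rintro rfl; simp at he
  obtain ⟨n, rfl⟩ : ∃ n, d = n + 1 := ⟨d - 1, by omega⟩
  have : Fact (Module.finrank ℝ (Euc (n + 1)) = n + 1) := ⟨by simp⟩
  have hrank : Module.finrank ℝ (ℝ ∙ e)ᗮ = n := Submodule.finrank_orthogonal_span_singleton he0
  have himg : orthogonalDisc e 1 = (Subtype.val : (ℝ ∙ e)ᗮ → Euc (n + 1)) '' Metric.ball 0 1 := by
    ext y
    constructor
    · rintro ⟨h1, h2⟩
      exact ⟨⟨y, Submodule.mem_orthogonal_singleton_iff_inner_right.2 h1⟩, by simpa using h2, rfl⟩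
    · rintro ⟨z, hz, rfl⟩
      exact ⟨Submodule.mem_orthogonal_singleton_iff_inner_right.1 z.2, by simpa using hz⟩
  have hval : μHE[n + 1 - 1] (orthogonalDisc e 1) =
      volume (Metric.ball (0 : (ℝ ∙ e)ᗮ) 1) := by
    rw [himg, isometry_subtype_coe.euclideanHausdorffMeasure_image,
      ← InnerProductSpace.euclideanHausdorffMeasure_eq_volume, hrank]
    simp
  rw [hval]
  exact ⟨(Metric.measure_ball_pos volume _ one_pos).ne', measure_ball_lt_top.ne⟩

open scoped Pointwise in
theorem euclideanHausdorffMeasure_orthogonalDisc {d : ℕ} (e : Euc d) {r : ℝ} (hr : 0 < r) :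
    μHE[d - 1] (orthogonalDisc e r) =
      ENNReal.ofReal (r ^ (d - 1)) * μHE[d - 1] (orthogonalDisc e 1) := by
  have himg : orthogonalDisc e r = r • orthogonalDisc e 1 := by
    ext y
    rw [Set.mem_smul_set_iff_inv_smul_mem₀ hr.ne']
    simp only [orthogonalDisc, Set.mem_ofPred_eq, inner_smul_right, norm_smul, norm_inv,
      Real.norm_eq_abs, abs_of_pos hr]
    rw [inv_mul_lt_one₀ hr]
    simp [hr.ne']
  rw [himg, Measure.euclideanHausdorffMeasure_smul₀ _ hr.ne', ENNReal.smul_def, smul_eq_mul,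
    ENNReal.ofReal_pow hr.le, ← Real.enorm_eq_ofReal hr.le, enorm_eq_nnnorm]
  push_cast
  rfl

theorem exists_linearIsometryEquiv_apply_eq {d : ℕ} {e e' : Euc d} (he : ‖e‖ = ‖e'‖) :
    ∃ T : Euc d ≃ₗᵢ[ℝ] Euc d, T e = e' :=
  ⟨Submodule.reflection (ℝ ∙ (e - e'))ᗮ, Submodule.reflection_sub he⟩

theorem euclideanHausdorffMeasure_sphericalCap_congr {d : ℕ} {e e' : Euc d} (he : ‖e‖ = ‖e'‖)
    (n : ℕ) (c : ℝ) : μHE[n] (sphericalCap e c) = μHE[n] (sphericalCap e' c) := by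
  obtain ⟨T, rfl⟩ := exists_linearIsometryEquiv_apply_eq he
  have himg : sphericalCap (T e) c = T '' sphericalCap e c := by
    ext y
    constructor
    · rintro ⟨h1, h2⟩
      refine ⟨T.symm y, ⟨by simpa using h1, ?_⟩, by simp⟩
      rw [← T.inner_map_map]
      simpa using h2
    · rintro ⟨z, ⟨h1, h2⟩, rfl⟩
      exact ⟨by simpa using h1, by simpa [T.inner_map_map] using h2⟩
  rw [himg, T.isometry.euclideanHausdorffMeasure_image]

theorem volume_openCone_inter_ball_congr {d : ℕ} {e e' : Euc d} (he : ‖e‖ = ‖e'‖) (c : ℝ) :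
    volume (openCone e c ∩ Metric.ball 0 1) = volume (openCone e' c ∩ Metric.ball 0 1) := by
  obtain ⟨T, rfl⟩ := exists_linearIsometryEquiv_apply_eq he
  have himg : openCone e c ∩ Metric.ball 0 1 = T ⁻¹' (openCone (T e) c ∩ Metric.ball 0 1) := by
    ext y
    simp [openCone, T.inner_map_map]
  rw [himg, (T.measurePreserving).measure_preimage_emb T.toHomeomorph.measurableEmbedding]

/-- The orthogonal projection of the cap covers the disc below it. -/
theorem orthogonalDisc_subset_image_sphericalCap {d : ℕ} {e : Euc d} (he : ‖e‖ = 1) {c : ℝ}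
    (hc0 : 0 < c) :
    orthogonalDisc e (√(1 - c ^ 2)) ⊆ (fun x => x - inner ℝ e x • e) '' sphericalCap e c := by
  rintro y ⟨hy1, hy2⟩
  have hy3 : ‖y‖ ^ 2 < 1 - c ^ 2 := by
    rwa [← Real.lt_sqrt (norm_nonneg y)]
  have hinner : inner ℝ e (y + √(1 - ‖y‖ ^ 2) • e) = √(1 - ‖y‖ ^ 2) := by
    rw [inner_add_right, inner_smul_right, real_inner_self_eq_norm_sq, he, hy1]; ring
  refine ⟨y + √(1 - ‖y‖ ^ 2) • e, ⟨?_, ?_⟩, ?_⟩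
  · have h : ‖y + √(1 - ‖y‖ ^ 2) • e‖ ^ 2 = 1 := by
      rw [norm_add_sq_real, inner_smul_right, real_inner_comm, hy1, norm_smul, he, Real.norm_eq_abs,
        mul_one, sq_abs, Real.sq_sqrt (by nlinarith [sq_nonneg c])]
      ring
    exact (sq_eq_sq₀ (norm_nonneg _) zero_le_one).1 (by rw [h, one_pow])
  · rw [hinner, Real.lt_sqrt hc0.le]; linarith
  · simp only [hinner]; abel

theorem lipschitzWith_sub_inner_smul {d : ℕ} {e : Euc d} (he : ‖e‖ = 1) :
    LipschitzWith 1 (fun x : Euc d => x - inner ℝ e x • e) := by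
  refine LipschitzWith.of_dist_le_mul fun x y => ?_
  rw [dist_eq_norm, dist_eq_norm, NNReal.coe_one, one_mul]
  have h1 : x - inner ℝ e x • e - (y - inner ℝ e y • e) = (x - y) - inner ℝ e (x - y) • e := by
    rw [inner_sub_right, sub_smul]; abel
  rw [h1]
  refine le_of_sq_le_sq ?_ (norm_nonneg _)
  rw [norm_sub_sq_real, inner_smul_right, norm_smul, he, real_inner_comm e, Real.norm_eq_abs,
    mul_one, sq_abs]
  nlinarith [sq_nonneg (inner ℝ (x - y) e)]

/-- The cap is parametrized by the disc below it. -/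
theorem sphericalCap_subset_image_orthogonalDisc {d : ℕ} {e : Euc d} (he : ‖e‖ = 1) {c : ℝ}
    (hc0 : 0 < c) :
    sphericalCap e c ⊆ (fun y => y + √(1 - ‖y‖ ^ 2) • e) '' orthogonalDisc e (√(1 - c ^ 2)) := by
  rintro x ⟨hx1, hx2⟩
  have hn : ‖x - inner ℝ e x • e‖ ^ 2 = 1 - inner ℝ e x ^ 2 := by
    rw [norm_sub_sq_real, inner_smul_right, norm_smul, he, hx1, real_inner_comm e, Real.norm_eq_abs,
      mul_one, sq_abs]
    ring
  refine ⟨x - inner ℝ e x • e, ⟨?_, ?_⟩, ?_⟩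
  · rw [inner_sub_right, inner_smul_right, real_inner_self_eq_norm_sq, he]; ring
  · rw [Real.lt_sqrt (norm_nonneg _), hn]
    nlinarith
  · simp only [hn]
    rw [sub_sub_cancel, Real.sqrt_sq (hc0.trans hx2).le]
    abel

/-- The parametrization of a spherical cap over a disc is Lipschitz, with a constant that tends to `1`
for small caps. -/
theorem lipschitzOnWith_add_sqrt_smul {d : ℕ} {e : Euc d} (he : ‖e‖ = 1) {c : ℝ}
    (hc0 : 0 < c) :
    LipschitzOnWith (Real.toNNReal c⁻¹) (fun y : Euc d => y + √(1 - ‖y‖ ^ 2) • e)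
      (orthogonalDisc e (√(1 - c ^ 2))) := by
  refine LipschitzOnWith.of_dist_le_mul fun y hy z hz => ?_
  rw [Real.coe_toNNReal _ (inv_nonneg.2 hc0.le), dist_eq_norm, dist_eq_norm]
  have hy2 : ‖y‖ ^ 2 < 1 - c ^ 2 := by rw [← Real.lt_sqrt (norm_nonneg y)]; exact hy.2
  have hz2 : ‖z‖ ^ 2 < 1 - c ^ 2 := by rw [← Real.lt_sqrt (norm_nonneg z)]; exact hz.2
  set p := √(1 - ‖y‖ ^ 2) with hp
  set q := √(1 - ‖z‖ ^ 2) with hq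
  have hpc : c ≤ p := Real.le_sqrt_of_sq_le (by linarith)
  have hqc : c ≤ q := Real.le_sqrt_of_sq_le (by linarith)
  have hp2 : p ^ 2 = 1 - ‖y‖ ^ 2 := Real.sq_sqrt (by nlinarith)
  have hq2 : q ^ 2 = 1 - ‖z‖ ^ 2 := Real.sq_sqrt (by nlinarith)
  have heq : y + p • e - (z + q • e) = (y - z) + (p - q) • e := by rw [sub_smul]; abel
  have horth : inner ℝ (y - z) e = 0 := by
    rw [real_inner_comm, inner_sub_right, hy.1, hz.1, sub_zero]
  have hnorm : ‖y + p • e - (z + q • e)‖ ^ 2 = ‖y - z‖ ^ 2 + (p - q) ^ 2 := by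
    rw [heq, norm_add_sq_real, inner_smul_right, horth, norm_smul, he, Real.norm_eq_abs, mul_one,
      sq_abs]
    ring
  have hab : (‖y‖ - ‖z‖) ^ 2 ≤ ‖y - z‖ ^ 2 := by
    rw [sq_le_sq, abs_of_nonneg (norm_nonneg (y - z))]
    exact abs_norm_sub_norm_le y z
  have hyz : (‖y‖ + ‖z‖) ^ 2 ≤ 4 * (1 - c ^ 2) := by nlinarith [sq_nonneg (‖y‖ - ‖z‖)]
  have hprod : (p - q) ^ 2 * (p + q) ^ 2 = (‖y‖ - ‖z‖) ^ 2 * (‖y‖ + ‖z‖) ^ 2 := by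
    have : (p - q) * (p + q) = -((‖y‖ - ‖z‖) * (‖y‖ + ‖z‖)) := by linear_combination hp2 - hq2
    rw [← mul_pow, this]; ring
  have hpq : (2 * c) ^ 2 ≤ (p + q) ^ 2 := pow_le_pow_left₀ (by linarith) (by linarith) 2
  have hmain : (p - q) ^ 2 * (4 * c ^ 2) ≤ ‖y - z‖ ^ 2 * (4 * (1 - c ^ 2)) :=
    calc (p - q) ^ 2 * (4 * c ^ 2) = (p - q) ^ 2 * (2 * c) ^ 2 := by ring
      _ ≤ (p - q) ^ 2 * (p + q) ^ 2 := by gcongr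
      _ = (‖y‖ - ‖z‖) ^ 2 * (‖y‖ + ‖z‖) ^ 2 := hprod
      _ ≤ ‖y - z‖ ^ 2 * (4 * (1 - c ^ 2)) := by gcongr
  refine le_of_sq_le_sq ?_ (by positivity)
  rw [hnorm, mul_pow, inv_pow, ← div_eq_inv_mul, le_div_iff₀ (by positivity)]
  linarith

theorem euclideanHausdorffMeasure_image_le {X Y : Type*} [MetricSpace X] [MeasurableSpace X]
    [BorelSpace X] [MetricSpace Y] [MeasurableSpace Y] [BorelSpace Y] {K : ℝ≥0} {f : X → Y}
    {s : Set X} (hf : LipschitzOnWith K f s) (n : ℕ) :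
    μHE[n] (f '' s) ≤ (K : ℝ≥0∞) ^ n * μHE[n] s := by
  simp only [Measure.euclideanHausdorffMeasure_def, Measure.smul_apply, ENNReal.smul_def,
    smul_eq_mul]
  have h := hf.hausdorffMeasure_image_le (Nat.cast_nonneg n)
  rw [ENNReal.rpow_natCast] at h
  rw [mul_left_comm]
  gcongr

theorem le_euclideanHausdorffMeasure_sphericalCap {d : ℕ} {e : Euc d} (he : ‖e‖ = 1) {c : ℝ}
    (hc0 : 0 < c) (hc1 : c < 1) :
    ENNReal.ofReal (√(1 - c ^ 2) ^ (d - 1)) * μHE[d - 1] (orthogonalDisc e 1) ≤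
      μHE[d - 1] (sphericalCap e c) := by
  rw [← euclideanHausdorffMeasure_orthogonalDisc e (Real.sqrt_pos.2 (by nlinarith))]
  refine (measure_mono (orthogonalDisc_subset_image_sphericalCap he hc0)).trans ?_
  simpa using euclideanHausdorffMeasure_image_le
    ((lipschitzWith_sub_inner_smul he).lipschitzOnWith (s := sphericalCap e c)) (d - 1)

theorem euclideanHausdorffMeasure_sphericalCap_le {d : ℕ} {e : Euc d} (he : ‖e‖ = 1) {c : ℝ}
    (hc0 : 0 < c) (hc1 : c < 1) :
    μHE[d - 1] (sphericalCap e c) ≤ ENNReal.ofReal ((c ^ (d - 1))⁻¹) *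
      (ENNReal.ofReal (√(1 - c ^ 2) ^ (d - 1)) * μHE[d - 1] (orthogonalDisc e 1)) := by
  rw [← euclideanHausdorffMeasure_orthogonalDisc e (Real.sqrt_pos.2 (by nlinarith))]
  refine (measure_mono (sphericalCap_subset_image_orthogonalDisc he hc0)).trans ?_
  refine (euclideanHausdorffMeasure_image_le (lipschitzOnWith_add_sqrt_smul he hc0) (d - 1)).trans
    (le_of_eq ?_)
  rw [← inv_pow, ENNReal.ofReal_pow (inv_nonneg.2 hc0.le)]
  rfl

/-- A slice of a bounded piece of the cone, orthogonal to the axis, is a disc. -/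
theorem openCone_inter_slice {d : ℕ} {e : Euc d} (he : ‖e‖ = 1) {c : ℝ} (hc0 : 0 < c)
    (hc1 : c < 1) {x : ℝ} (hx : 0 < x) :
    openCone e c ∩ AffineSubspace.mk' (x • e +ᵥ (0 : Euc d)) (ℝ ∙ e)ᗮ =
      (fun y => x • e + y) '' orthogonalDisc e (√(1 - c ^ 2) / c * x) := by
  have hρ : √(1 - c ^ 2) ^ 2 = 1 - c ^ 2 := Real.sq_sqrt (by nlinarith)
  have key : ∀ y : Euc d, inner ℝ e y = 0 →
      (c * ‖x • e + y‖ < inner ℝ e (x • e + y) ↔ ‖y‖ < √(1 - c ^ 2) / c * x) := by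
    intro y hy
    have h1 : inner ℝ e (x • e + y) = x := by
      rw [inner_add_right, inner_smul_right, real_inner_self_eq_norm_sq, he, hy]; ring
    have h2 : ‖x • e + y‖ ^ 2 = x ^ 2 + ‖y‖ ^ 2 := by
      rw [norm_add_sq_real, inner_smul_left, hy, norm_smul, he, Real.norm_eq_abs, mul_one, sq_abs]
      simp
    rw [h1, ← sq_lt_sq₀ (by positivity) hx.le, mul_pow, h2, ← sq_lt_sq₀ (norm_nonneg y)
      (by positivity), mul_pow, div_pow, hρ, div_mul_eq_mul_div, lt_div_iff₀ (by positivity)]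
    constructor <;> intro h <;> nlinarith
  ext y
  simp only [openCone, Set.mem_inter_iff, Set.mem_ofPred_eq, Set.mem_image, SetLike.mem_coe,
    AffineSubspace.mem_mk', vadd_eq_add, add_zero, vsub_eq_sub,
    Submodule.mem_orthogonal_singleton_iff_inner_right, orthogonalDisc]
  constructor
  · rintro ⟨h1, h2⟩
    refine ⟨y - x • e, ⟨h2, (key _ h2).1 ?_⟩, by abel⟩
    rwa [add_sub_cancel]
  · rintro ⟨z, ⟨h1, h2⟩, rfl⟩
    exact ⟨(key z h1).2 h2, by simpa using h1⟩

theorem isOpen_openCone {d : ℕ} (e : Euc d) (c : ℝ) : IsOpen (openCone e c) :=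
  isOpen_lt (by fun_prop) (by fun_prop)

/-- The volume of a straight cone, by integration over the slices orthogonal to its axis. -/
theorem volume_openCone_inter_halfSpace {d : ℕ} (hd : 1 ≤ d) {e : Euc d} (he : ‖e‖ = 1) {c : ℝ}
    (hc0 : 0 < c) (hc1 : c < 1) {L : ℝ} (hL : 0 < L) :
    volume (openCone e c ∩ {y | inner ℝ e y < L}) =
      ENNReal.ofReal ((√(1 - c ^ 2) / c) ^ (d - 1) * (L ^ d / d)) *
        μHE[d - 1] (orthogonalDisc e 1) := by
  have he0 : e ≠ 0 := by rintro rfl; simp at he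
  have hρ : 0 < √(1 - c ^ 2) := Real.sqrt_pos.2 (by nlinarith)
  have hmeas : MeasurableSet (openCone e c ∩ {y | inner ℝ e y < L}) :=
    ((isOpen_openCone e c).inter (isOpen_lt (by fun_prop) (by fun_prop))).measurableSet
  have h := EuclideanGeometry.euclideanHausdorffMeasure_eq_lintegral (0 : Euc d) he0 hmeas
  rw [finrank_euclideanSpace_fin, EuclideanSpace.euclideanHausdorffMeasure_eq_volume,
    ← ofReal_norm, he, ENNReal.ofReal_one, one_mul] at h
  rw [h]
  have hslice : ∀ x : ℝ, μHE[d - 1] ((openCone e c ∩ {y | inner ℝ e y < L}) ∩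
      AffineSubspace.mk' (x • e +ᵥ (0 : Euc d)) (ℝ ∙ e)ᗮ) =
      (Ioo 0 L).indicator (fun x => ENNReal.ofReal ((√(1 - c ^ 2) / c) ^ (d - 1) * x ^ (d - 1)) *
        μHE[d - 1] (orthogonalDisc e 1)) x := by
    intro x
    have hin : ∀ y ∈ (AffineSubspace.mk' (x • e +ᵥ (0 : Euc d)) (ℝ ∙ e)ᗮ : Set (Euc d)),
        inner ℝ e y = x := by
      intro y hy
      simp only [SetLike.mem_coe, AffineSubspace.mem_mk', vadd_eq_add, add_zero, vsub_eq_sub,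
        Submodule.mem_orthogonal_singleton_iff_inner_right, inner_sub_right, inner_smul_right,
        real_inner_self_eq_norm_sq, he] at hy
      linarith
    by_cases hx : x ∈ Ioo 0 L
    · rw [Set.indicator_of_mem hx]
      have h1 : (openCone e c ∩ {y | inner ℝ e y < L}) ∩
          (AffineSubspace.mk' (x • e +ᵥ (0 : Euc d)) (ℝ ∙ e)ᗮ : Set (Euc d)) =
          openCone e c ∩ AffineSubspace.mk' (x • e +ᵥ (0 : Euc d)) (ℝ ∙ e)ᗮ := by
        ext y
        constructor
        · rintro ⟨⟨h1, _⟩, h2⟩; exact ⟨h1, h2⟩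
        · rintro ⟨h1, h2⟩; exact ⟨⟨h1, (hin y h2).trans_lt hx.2⟩, h2⟩
      rw [h1, openCone_inter_slice he hc0 hc1 hx.1,
        (isometry_add_left (x • e)).euclideanHausdorffMeasure_image,
        euclideanHausdorffMeasure_orthogonalDisc e (mul_pos (div_pos hρ hc0) hx.1), mul_pow]
    · rw [Set.indicator_of_notMem hx]
      convert measure_empty (μ := (μHE[d - 1] : Measure (Euc d)))
      ext y
      simp only [Set.mem_inter_iff, Set.mem_empty_iff_false, iff_false]
      rintro ⟨⟨h1, h2⟩, h3⟩
      have h4 := hin y h3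
      have h1' : c * ‖y‖ < inner ℝ e y := h1
      have h2' : inner ℝ e y < L := h2
      exact hx ⟨by rw [← h4]; exact lt_of_le_of_lt (by positivity) h1', h4 ▸ h2'⟩
  simp_rw [hslice]
  rw [lintegral_indicator measurableSet_Ioo, lintegral_mul_const' _ _
    (euclideanHausdorffMeasure_orthogonalDisc_one hd he).2]
  congr 1
  rw [← ofReal_integral_eq_lintegral_ofReal]
  · rw [integral_const_mul, ← integral_Ioc_eq_integral_Ioo, ← intervalIntegral.integral_of_le hL.le,
      integral_pow]
    congr 2
    obtain ⟨n, rfl⟩ : ∃ n, d = n + 1 := ⟨d - 1, by omega⟩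
    simp
  · exact ((by fun_prop : Continuous fun x : ℝ => (√(1 - c ^ 2) / c) ^ (d - 1) * x ^ (d - 1))
      |>.integrableOn_Icc (a := 0) (b := L)).mono_set Ioo_subset_Icc_self
  · refine (ae_restrict_mem measurableSet_Ioo).mono fun x hx => ?_
    have := hx.1
    positivity

theorem euclideanHausdorffMeasure_sphere_lt_top {d : ℕ} (hd : 1 ≤ d) :
    μHE[d - 1] (Metric.sphere (0 : Euc d) 1) < ⊤ := by
  refine (isCompact_sphere _ _).measure_lt_top_of_nhdsWithin fun e he => ?_
  have he' : ‖e‖ = 1 := by simpa using he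
  have hopen : IsOpen {x : Euc d | 1 / 2 < inner ℝ e x} := isOpen_lt (by fun_prop) (by fun_prop)
  refine ⟨sphericalCap e (1 / 2), ?_, ?_⟩
  · refine mem_nhdsWithin.2 ⟨_, hopen, ?_, fun x hx => ⟨by simpa using hx.2, hx.1⟩⟩
    rw [Set.mem_ofPred_eq, real_inner_self_eq_norm_sq, he']
    norm_num
  · refine (euclideanHausdorffMeasure_sphericalCap_le he' (by norm_num) (by norm_num)).trans_lt ?_
    exact ENNReal.mul_lt_top ENNReal.ofReal_lt_top (ENNReal.mul_lt_top ENNReal.ofReal_lt_top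
      (euclideanHausdorffMeasure_orthogonalDisc_one hd he').2.lt_top)

/-- Double counting of the pairs of a point `x` of the sphere and a point `y` of the ball which
enclose a small angle. -/
theorem sphere_mul_openCone_eq {d : ℕ} (hd : 1 ≤ d) {e : Euc d} (he : ‖e‖ = 1) (c : ℝ) :
    volume (openCone e c ∩ Metric.ball 0 1) * μHE[d - 1] (Metric.sphere (0 : Euc d) 1) =
      μHE[d - 1] (sphericalCap e c) * volume (Metric.ball (0 : Euc d) 1) := by
  have : Nonempty (Fin d) := ⟨⟨0, hd⟩⟩
  set μ : Measure (Euc d) := (μHE[d - 1]).restrict (Metric.sphere 0 1) with hμ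
  have hfin : IsFiniteMeasure μ :=
    ⟨by rw [hμ, Measure.restrict_apply_univ]; exact euclideanHausdorffMeasure_sphere_lt_top hd⟩
  set ν : Measure (Euc d) := volume.restrict (Metric.ball 0 1) with hν
  -- the pairs at angle less than `arccos c`
  let T : Set (Euc d × Euc d) := {p | c * ‖p.2‖ < inner ℝ p.1 p.2}
  have hT : MeasurableSet T :=
    (isOpen_lt (by fun_prop) (by fun_prop)).measurableSet
  have h1 : (μ.prod ν) T =
      volume (openCone e c ∩ Metric.ball 0 1) * μHE[d - 1] (Metric.sphere (0 : Euc d) 1) := by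
    rw [Measure.prod_apply hT, ← setLIntegral_const]
    refine setLIntegral_congr_fun Metric.isClosed_sphere.measurableSet fun x hx => ?_
    have hx' : ‖x‖ = 1 := by simpa using hx
    have : Prod.mk x ⁻¹' T = openCone x c := rfl
    rw [this, hν, Measure.restrict_apply (isOpen_openCone x c).measurableSet]
    exact volume_openCone_inter_ball_congr (hx'.trans he.symm) c
  have h2 : (μ.prod ν) T = μHE[d - 1] (sphericalCap e c) * volume (Metric.ball (0 : Euc d) 1) := by
    rw [Measure.prod_apply_symm hT, ← setLIntegral_const]
    refine setLIntegral_congr_fun_ae Metric.isOpen_ball.measurableSet ?_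
    have hne : ∀ᵐ y : Euc d, y ≠ 0 := by
      simp [ae_iff]
    filter_upwards [hne] with y hy _
    have hpos : 0 < ‖y‖ := norm_pos_iff.2 hy
    rw [hμ, Measure.restrict_apply (hT.preimage (by fun_prop)),
      euclideanHausdorffMeasure_sphericalCap_congr (e := e) (e' := ‖y‖⁻¹ • y)
        (by rw [he, norm_smul, norm_inv, norm_norm, inv_mul_cancel₀ hpos.ne'])]
    congr 1
    ext x
    simp only [T, sphericalCap, Set.mem_inter_iff, Set.mem_preimage, Set.mem_ofPred_eq,
      mem_sphere_zero_iff_norm, inner_smul_left, real_inner_comm y x]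
    rw [and_comm]
    refine and_congr Iff.rfl ?_
    simp only [conj_trivial]
    rw [inv_mul_eq_div, lt_div_iff₀ hpos, real_inner_comm]
  rw [← h1, h2]

/-- The sphere and the ball are compared through a cap of aperture `c` and the cone over it, which is
enclosed between two straight cones. The bounds become sharp as `c → 1`. -/
theorem sphereArea_bounds {d : ℕ} (hd : 1 ≤ d) {c : ℝ} (hc0 : 0 < c) (hc1 : c < 1) :
    c ^ d * sphereArea d ≤ d * volume.real (Metric.ball (0 : Euc d) 1) ∧
      c ^ (d - 1) * (d * volume.real (Metric.ball (0 : Euc d) 1)) ≤ sphereArea d := by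
  let e : Euc d := EuclideanSpace.single ⟨0, hd⟩ 1
  have he : ‖e‖ = 1 := by simp [e]
  have hρ : 0 < √(1 - c ^ 2) := Real.sqrt_pos.2 (by nlinarith)
  have hd0 : (0 : ℝ) < d := by exact_mod_cast hd
  obtain ⟨hW0, hWtop⟩ := euclideanHausdorffMeasure_orthogonalDisc_one hd he
  set w : ℝ := (μHE[d - 1] (orthogonalDisc e 1)).toReal with hw
  have hwpos : 0 < w := ENNReal.toReal_pos hW0 hWtop
  have hwW : μHE[d - 1] (orthogonalDisc e 1) = ENNReal.ofReal w :=
    (ENNReal.ofReal_toReal hWtop).symm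
  set v2 := volume.real (openCone e c ∩ Metric.ball 0 1) with hv2
  set v1 := (μHE[d - 1] (sphericalCap e c)).toReal with hv1
  set b := volume.real (Metric.ball (0 : Euc d) 1) with hb
  have hv2fin : volume (openCone e c ∩ Metric.ball 0 1) ≠ ⊤ :=
    ((measure_mono Set.inter_subset_right).trans_lt measure_ball_lt_top).ne
  have hv1le := euclideanHausdorffMeasure_sphericalCap_le he hc0 hc1
  have hlev1 := le_euclideanHausdorffMeasure_sphericalCap he hc0 hc1
  rw [hwW] at hv1le hlev1
  have hv1fin : μHE[d - 1] (sphericalCap e c) ≠ ⊤ :=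
    (hv1le.trans_lt (by finiteness)).ne
  have b1 : √(1 - c ^ 2) ^ (d - 1) * w ≤ v1 := by
    rw [hv1, ← ENNReal.ofReal_le_iff_le_toReal hv1fin, ENNReal.ofReal_mul (by positivity)]
    exact hlev1
  have b2 : v1 ≤ (c ^ (d - 1))⁻¹ * (√(1 - c ^ 2) ^ (d - 1) * w) := by
    refine ENNReal.toReal_le_of_le_ofReal (by positivity) ?_
    rwa [ENNReal.ofReal_mul (by positivity), ENNReal.ofReal_mul (by positivity)]
  have hmono1 : openCone e c ∩ {y | inner ℝ e y < c} ⊆ openCone e c ∩ Metric.ball 0 1 := by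
    rintro y ⟨h1, h2⟩
    refine ⟨h1, ?_⟩
    have h3 : c * ‖y‖ < c * 1 := by rw [mul_one]; exact lt_trans h1 h2
    simpa using lt_of_mul_lt_mul_left h3 hc0.le
  have hmono2 : openCone e c ∩ Metric.ball 0 1 ⊆ openCone e c ∩ {y | inner ℝ e y < 1} := by
    rintro y ⟨h1, h2⟩
    refine ⟨h1, (real_inner_le_norm e y).trans_lt ?_⟩
    simpa [he] using h2
  have b3 : (√(1 - c ^ 2) / c) ^ (d - 1) * (c ^ d / d) * w ≤ v2 := by
    rw [hv2, measureReal_def, ← ENNReal.ofReal_le_iff_le_toReal hv2fin,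
      ENNReal.ofReal_mul (by positivity), ← hwW,
      ← volume_openCone_inter_halfSpace hd he hc0 hc1 hc0]
    exact measure_mono hmono1
  have b4 : v2 ≤ (√(1 - c ^ 2) / c) ^ (d - 1) * (1 ^ d / d) * w := by
    refine ENNReal.toReal_le_of_le_ofReal (by positivity) ?_
    rw [ENNReal.ofReal_mul (by positivity), ← hwW,
      ← volume_openCone_inter_halfSpace hd he hc0 hc1 one_pos]
    exact measure_mono hmono2
  have heq : v2 * sphereArea d = v1 * b := by
    have h := congrArg ENNReal.toReal (sphere_mul_openCone_eq hd he c)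
    rwa [ENNReal.toReal_mul, ENNReal.toReal_mul] at h
  have hσ : 0 ≤ sphereArea d := ENNReal.toReal_nonneg
  have hb0 : 0 ≤ b := measureReal_nonneg
  set t := (√(1 - c ^ 2) / c) ^ (d - 1) / d * w with ht
  have htpos : 0 < t := by positivity
  have hcn : c ^ (d - 1) ≠ 0 := by positivity
  have hRw : √(1 - c ^ 2) ^ (d - 1) * w = c ^ (d - 1) * (d * t) := by
    rw [ht, div_pow]; field_simp
  rw [hRw] at b1 b2
  rw [inv_mul_cancel_left₀ hcn] at b2
  have b3' : t * c ^ d ≤ v2 := by rw [ht]; convert b3 using 1; ring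
  have b4' : v2 ≤ t := by rw [ht]; convert b4 using 1; rw [one_pow]; ring
  constructor
  · refine le_of_mul_le_mul_left ?_ htpos
    calc t * (c ^ d * sphereArea d) = t * c ^ d * sphereArea d := by ring
      _ ≤ v2 * sphereArea d := by gcongr
      _ = v1 * b := heq
      _ ≤ d * t * b := by gcongr
      _ = t * (d * b) := by ring
  · refine le_of_mul_le_mul_left ?_ htpos
    calc t * (c ^ (d - 1) * (d * b)) = c ^ (d - 1) * (d * t) * b := by ring
      _ ≤ v1 * b := by gcongr
      _ = v2 * sphereArea d := heq.symm
      _ ≤ t * sphereArea d := by gcongr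

/-- The surface area of the unit sphere, a Hausdorff measure, is `d` times the volume of the ball. -/
theorem sphereArea_eq {d : ℕ} (hd : 1 ≤ d) :
    sphereArea d = d * volume.real (Metric.ball (0 : Euc d) 1) := by
  have hlim : ∀ n : ℕ, Tendsto (fun c : ℝ => c ^ n) (𝓝[<] 1) (𝓝 1) := fun n =>
    ((continuous_pow n).tendsto' 1 1 (one_pow n)).mono_left nhdsWithin_le_nhds
  have hev : ∀ᶠ c : ℝ in 𝓝[<] 1, 0 < c ∧ c < 1 :=
    Filter.eventually_of_mem (Ioo_mem_nhdsLT one_pos) fun c hc => hc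
  refine le_antisymm ?_ ?_
  · have h := (hlim d).mul_const (sphereArea d)
    rw [one_mul] at h
    refine le_of_tendsto h ?_
    filter_upwards [hev] with c hc using (sphereArea_bounds hd hc.1 hc.2).1
  · have h := (hlim (d - 1)).mul_const (d * volume.real (Metric.ball (0 : Euc d) 1))
    rw [one_mul] at h
    refine le_of_tendsto h ?_
    filter_upwards [hev] with c hc using (sphereArea_bounds hd hc.1 hc.2).2

/-! ### Second moments of radial kernels -/

theorem integral_comp_linearIsometryEquiv_radial {d : ℕ} (K : ℝ → ℝ) (h : Euc d → ℝ)
    (T : Euc d ≃ₗᵢ[ℝ] Euc d) : ∫ ξ, K ‖ξ‖ * h (T ξ) = ∫ ξ, K ‖ξ‖ * h ξ := by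
  have := (T.measurePreserving).integral_comp T.toHomeomorph.measurableEmbedding
    (fun ξ => K ‖ξ‖ * h ξ)
  simpa using this

theorem integrable_radial_mul_inner_mul_inner {d : ℕ} {K : ℝ → ℝ}
    (hint : Integrable (fun ξ : Euc d => K ‖ξ‖ * ‖ξ‖ ^ 2)) (hK : Measurable K) (v w : Euc d) :
    Integrable (fun ξ : Euc d => K ‖ξ‖ * (inner ℝ v ξ * inner ℝ w ξ)) := by
  refine (hint.norm.const_mul (‖v‖ * ‖w‖)).mono'
    (((hK.comp measurable_norm).aestronglyMeasurable).mul (by fun_prop)) ?_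
  refine Eventually.of_forall fun ξ => ?_
  rw [norm_mul, norm_mul, norm_mul, norm_pow, norm_norm]
  calc ‖K ‖ξ‖‖ * (‖(inner ℝ v ξ : ℝ)‖ * ‖(inner ℝ w ξ : ℝ)‖)
      ≤ ‖K ‖ξ‖‖ * ((‖v‖ * ‖ξ‖) * (‖w‖ * ‖ξ‖)) := by
        gcongr <;> exact norm_inner_le_norm _ _
    _ = ‖v‖ * ‖w‖ * (‖K ‖ξ‖‖ * ‖ξ‖ ^ 2) := by ring

/-- The second moments of a radial kernel are isotropic. -/
theorem integral_radial_mul_inner_sq {d : ℕ} (hd : 1 ≤ d) {K : ℝ → ℝ} (hK : Measurable K)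
    (hint : Integrable (fun ξ : Euc d => K ‖ξ‖ * ‖ξ‖ ^ 2)) (v : Euc d) :
    ∫ ξ, K ‖ξ‖ * inner ℝ v ξ ^ 2 = (∫ ξ : Euc d, K ‖ξ‖ * ‖ξ‖ ^ 2) / d * ‖v‖ ^ 2 := by
  have hcoord : ∀ i : Fin d, ∫ ξ, K ‖ξ‖ * inner ℝ v ξ ^ 2 =
      ‖v‖ ^ 2 * ∫ ξ : Euc d, K ‖ξ‖ * ξ i ^ 2 := by
    intro i
    -- rotate the `i`-th axis to the direction of `v`
    obtain ⟨T, hT⟩ := exists_linearIsometryEquiv_apply_eq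
      (e := ‖v‖ • EuclideanSpace.single i (1 : ℝ)) (e' := v) (by simp [norm_smul])
    rw [← integral_comp_linearIsometryEquiv_radial K _ T, ← integral_const_mul]
    congr 1 with ξ
    have hv : inner ℝ v (T ξ) = ‖v‖ * ξ i := by
      conv_lhs => rw [← hT]
      rw [T.inner_map_map, inner_smul_left, EuclideanSpace.inner_single_left]
      simp
    rw [hv]
    ring
  have hsum : ∑ i : Fin d, ∫ ξ : Euc d, K ‖ξ‖ * ξ i ^ 2 = ∫ ξ : Euc d, K ‖ξ‖ * ‖ξ‖ ^ 2 := by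
    rw [← integral_finsetSum]
    · congr 1 with ξ
      rw [EuclideanSpace.norm_sq_eq, Finset.mul_sum]
      simp
    · intro i _
      have := integrable_radial_mul_inner_mul_inner hint hK (EuclideanSpace.single i 1)
        (EuclideanSpace.single i 1)
      simpa [EuclideanSpace.inner_single_left, sq] using this
  have hd0 : (d : ℝ) ≠ 0 := by exact_mod_cast (by omega : d ≠ 0)
  have h : (d : ℝ) * ∫ ξ, K ‖ξ‖ * inner ℝ v ξ ^ 2 =
      ‖v‖ ^ 2 * ∫ ξ : Euc d, K ‖ξ‖ * ‖ξ‖ ^ 2 := by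
    rw [← hsum, Finset.mul_sum, ← Finset.sum_congr rfl (fun i _ => hcoord i)]
    simp
  field_simp
  linarith

theorem integral_radial_mul_inner_mul_inner {d : ℕ} (hd : 1 ≤ d) {K : ℝ → ℝ} (hK : Measurable K)
    (hint : Integrable (fun ξ : Euc d => K ‖ξ‖ * ‖ξ‖ ^ 2)) (v w : Euc d) :
    ∫ ξ, K ‖ξ‖ * (inner ℝ v ξ * inner ℝ w ξ) =
      (∫ ξ : Euc d, K ‖ξ‖ * ‖ξ‖ ^ 2) / d * inner ℝ v w := by
  have h1 := integral_radial_mul_inner_sq hd hK hint (v + w)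
  have h2 := integral_radial_mul_inner_sq hd hK hint (v - w)
  have hi : ∀ z : Euc d, Integrable (fun ξ : Euc d => K ‖ξ‖ * inner ℝ z ξ ^ 2) := fun z => by
    simpa [sq] using integrable_radial_mul_inner_mul_inner hint hK z z
  have h3 : ∫ ξ, K ‖ξ‖ * (inner ℝ v ξ * inner ℝ w ξ) = ((∫ ξ, K ‖ξ‖ * inner ℝ (v + w) ξ ^ 2) -
      ∫ ξ, K ‖ξ‖ * inner ℝ (v - w) ξ ^ 2) / 4 := by
    rw [← integral_sub (hi _) (hi _), ← integral_div]
    congr 1 with ξ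
    rw [inner_add_left, inner_sub_left]; ring
  rw [h3, h1, h2, norm_add_sq_real, norm_sub_sq_real]
  ring

/-- The second moments of a radial kernel, paired with a linear map, give its trace. -/
theorem integral_radial_mul_inner_apply {d : ℕ} (hd : 1 ≤ d) {K : ℝ → ℝ} (hK : Measurable K)
    (hint : Integrable (fun ξ : Euc d => K ‖ξ‖ * ‖ξ‖ ^ 2)) (M : Euc d →L[ℝ] Euc d) :
    ∫ ξ, K ‖ξ‖ * inner ℝ (M ξ) ξ =
      (∫ ξ : Euc d, K ‖ξ‖ * ‖ξ‖ ^ 2) / d * ∑ k, M (EuclideanSpace.single k 1) k := by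
  have h : ∀ ξ : Euc d, K ‖ξ‖ * inner ℝ (M ξ) ξ = ∑ k, K ‖ξ‖ *
      (inner ℝ (EuclideanSpace.single k (1 : ℝ)) ξ *
        inner ℝ (M (EuclideanSpace.single k 1)) ξ) := by
    intro ξ
    rw [← Finset.mul_sum]
    congr 1
    have hM : M ξ = ∑ k, ξ k • M (EuclideanSpace.single k 1) := by
      conv_lhs => rw [sum_smul_single ξ, map_sum]
      exact Finset.sum_congr rfl fun k _ => map_smul _ _ _
    rw [hM, sum_inner]
    refine Finset.sum_congr rfl fun k _ => ?_
    rw [inner_smul_left, EuclideanSpace.inner_single_left]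
    simp
  simp_rw [h]
  rw [integral_finsetSum _ fun k _ => integrable_radial_mul_inner_mul_inner hint hK _ _,
    Finset.mul_sum]
  refine Finset.sum_congr rfl fun k _ => ?_
  rw [integral_radial_mul_inner_mul_inner hd hK hint, EuclideanSpace.inner_single_left]
  simp

/-- The first moments of a radial kernel vanish by symmetry. -/
theorem integral_radial_mul_inner {d : ℕ} (K : ℝ → ℝ) (v : Euc d) :
    ∫ ξ, K ‖ξ‖ * inner ℝ v ξ = 0 := by
  have h := integral_comp_linearIsometryEquiv_radial K (fun ξ => inner ℝ v ξ)
    (LinearIsometryEquiv.neg ℝ)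
  simp only [LinearIsometryEquiv.coe_neg, inner_neg_right, mul_neg, integral_neg] at h
  linarith

/-- The kernel `(1 - s) t ^ (-(d + 2 s))` of the Gagliardo energy, as a function of the distance
`t`, cut off to `ρ < t < R`. -/
noncomputable def truncatedKernel (d : ℕ) (s ρ R : ℝ) : ℝ → ℝ :=
  (Ioo ρ R).indicator fun t => (1 - s) / t ^ ((d : ℝ) + 2 * s)

theorem measurable_truncatedKernel (d : ℕ) (s ρ R : ℝ) : Measurable (truncatedKernel d s ρ R) :=
  Measurable.indicator (by fun_prop) measurableSet_Ioo

theorem truncatedKernel_nonneg (d : ℕ) {s ρ R : ℝ} (hs : s < 1) (hρ : 0 ≤ ρ) (t : ℝ) :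
    0 ≤ truncatedKernel d s ρ R t :=
  indicator_nonneg (fun t ht => div_nonneg (by linarith)
    (Real.rpow_nonneg (hρ.trans ht.1.le) _)) t

/-- The integrand of the `p`-th moment of the kernel in polar coordinates. -/
theorem pow_smul_truncatedKernel_mul_pow {d : ℕ} (hd : 1 ≤ d) {s ρ R : ℝ} (p : ℕ) {y : ℝ}
    (hy : 0 < y) : y ^ (d - 1) • (truncatedKernel d s ρ R y * y ^ p) =
      (Ioo ρ R).indicator (fun y => (1 - s) * y ^ ((p : ℝ) - 1 - 2 * s)) y := by
  by_cases h : y ∈ Ioo ρ R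
  · rw [truncatedKernel, indicator_of_mem h, indicator_of_mem h, smul_eq_mul]
    have h1 : (p : ℝ) - 1 - 2 * s = ((d - 1 : ℕ) : ℝ) + p - (d + 2 * s) := by
      push_cast [hd]; ring
    rw [h1, Real.rpow_sub hy, Real.rpow_add hy ((d - 1 : ℕ) : ℝ), Real.rpow_natCast,
      Real.rpow_natCast]
    ring
  · rw [truncatedKernel, indicator_of_notMem h, indicator_of_notMem h]
    simp

theorem integrable_truncatedKernel_mul_norm_pow {d : ℕ} (hd : 1 ≤ d) {s ρ R : ℝ} (hs : s < 1)
    {p : ℕ} (hp : 2 ≤ p) :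
    Integrable (fun ξ : Euc d => truncatedKernel d s ρ R ‖ξ‖ * ‖ξ‖ ^ p) := by
  have : Nonempty (Fin d) := ⟨⟨0, hd⟩⟩
  have hp' : (2 : ℝ) ≤ p := by exact_mod_cast hp
  refine (integrable_fun_norm_addHaar (volume : Measure (Euc d))
    (f := fun y => truncatedKernel d s ρ R y * y ^ p)).2 ?_
  rw [finrank_euclideanSpace_fin]
  refine IntegrableOn.congr_fun ?_ (fun y hy => (pow_smul_truncatedKernel_mul_pow hd p hy).symm)
    measurableSet_Ioi
  refine Integrable.integrableOn ?_
  rw [integrable_indicator_iff measurableSet_Ioo]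
  refine IntegrableOn.mono_set ?_ Ioo_subset_Ioc_self
  exact ((intervalIntegral.intervalIntegrable_rpow' (by linarith)).const_mul _).1

theorem integral_truncatedKernel_mul_norm_pow {d : ℕ} (hd : 1 ≤ d) {s ρ R : ℝ} (hs : s < 1)
    (hρ : 0 ≤ ρ) (hR : ρ ≤ R) {p : ℕ} (hp : 2 ≤ p) :
    ∫ ξ : Euc d, truncatedKernel d s ρ R ‖ξ‖ * ‖ξ‖ ^ p =
      sphereArea d * ((1 - s) / (p - 2 * s) * (R ^ (p - 2 * s) - ρ ^ (p - 2 * s))) := by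
  have : Nonempty (Fin d) := ⟨⟨0, hd⟩⟩
  have hp' : (2 : ℝ) ≤ p := by exact_mod_cast hp
  have h := integral_fun_norm_addHaar (volume : Measure (Euc d))
    (fun y => truncatedKernel d s ρ R y * y ^ p)
  rw [h, finrank_euclideanSpace_fin, sphereArea_eq hd,
    setIntegral_congr_fun measurableSet_Ioi fun y hy => pow_smul_truncatedKernel_mul_pow hd p hy,
    setIntegral_indicator measurableSet_Ioo,
    (Set.inter_eq_right.2 fun y hy => lt_of_le_of_lt hρ hy.1 : Ioi 0 ∩ Ioo ρ R = Ioo ρ R),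
    ← integral_Ioc_eq_integral_Ioo, ← intervalIntegral.integral_of_le hR,
    intervalIntegral.integral_const_mul, integral_rpow (Or.inl (by linarith))]
  have e : (p : ℝ) - 1 - 2 * s + 1 = p - 2 * s := by ring
  rw [e]
  simp only [nsmul_eq_mul, smul_eq_mul]
  ring

/-- The cut-off at distance `ρ > 0` is needed here: for `s ≥ 1/2` the first moment of the full kernel
is infinite. -/
theorem integrable_truncatedKernel_mul_norm {d : ℕ} (hd : 1 ≤ d) {s ρ R : ℝ} (hs : s < 1)
    (hρ : 0 < ρ) :
    Integrable (fun ξ : Euc d => truncatedKernel d s ρ R ‖ξ‖ * ‖ξ‖) := by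
  refine ((integrable_truncatedKernel_mul_norm_pow (ρ := ρ) (R := R) hd hs
    le_rfl).const_mul ρ⁻¹).mono' (((measurable_truncatedKernel d s ρ R).comp measurable_norm).mul
      measurable_norm).aestronglyMeasurable ?_
  refine Eventually.of_forall fun ξ => ?_
  have hK := truncatedKernel_nonneg d hs hρ.le (R := R) ‖ξ‖
  rw [Real.norm_of_nonneg (by positivity)]
  by_cases h : ‖ξ‖ ∈ Ioo ρ R
  · have h1 : ‖ξ‖ ≤ ρ⁻¹ * ‖ξ‖ ^ 2 := by
      rw [inv_mul_eq_div, le_div_iff₀ hρ, sq]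
      exact mul_le_mul_of_nonneg_left h.1.le (norm_nonneg _)
    calc _ ≤ truncatedKernel d s ρ R ‖ξ‖ * (ρ⁻¹ * ‖ξ‖ ^ 2) := by gcongr
      _ = _ := by ring
  · simp [truncatedKernel, indicator_of_notMem h]

/-! ### A dual lower bound for nonlocal energies -/

theorem ofReal_integral_le_lintegral_ofReal {X : Type*} [MeasurableSpace X] {μ : Measure X}
    {f : X → ℝ} (hf : Integrable f μ) :
    ENNReal.ofReal (∫ x, f x ∂μ) ≤ ∫⁻ x, ENNReal.ofReal (f x) ∂μ := by
  calc ENNReal.ofReal (∫ x, f x ∂μ) ≤ ENNReal.ofReal (∫ x, max (f x) 0 ∂μ) :=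
        ENNReal.ofReal_le_ofReal (integral_mono hf hf.pos_part fun x => le_max_left _ _)
    _ = ∫⁻ x, ENNReal.ofReal (max (f x) 0) ∂μ :=
        ofReal_integral_eq_lintegral_ofReal hf.pos_part
          (Eventually.of_forall fun x => le_max_right _ _)
    _ = _ := by simp

theorem Continuous.exists_norm_le_of_hasCompactSupport {X F : Type*} [TopologicalSpace X]
    [NormedAddCommGroup F] {f : X → F} (hf : Continuous f) (hc : HasCompactSupport f) :
    ∃ C, 0 ≤ C ∧ ∀ x, ‖f x‖ ≤ C := by
  obtain ⟨C, hC⟩ := hc.exists_bound_of_continuous hf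
  exact ⟨max C 0, le_max_right _ _, fun x => (hC x).trans (le_max_left _ _)⟩

section Dual

variable {d : ℕ} {K : ℝ → ℝ} {r : ℝ}

theorem integrable_radial_mul_norm_pow (hK : Measurable K) (hK0 : ∀ t, 0 ≤ K t)
    (hKr : ∀ t, r ≤ t → K t = 0) (hK1 : Integrable fun ξ : Euc d => K ‖ξ‖ * ‖ξ‖) (p : ℕ) :
    Integrable fun ξ : Euc d => K ‖ξ‖ * ‖ξ‖ ^ (p + 1) := by
  refine (hK1.mul_const (|r| ^ p)).mono'
    ((hK.comp measurable_norm).mul (measurable_norm.pow_const _)).aestronglyMeasurable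
    (Eventually.of_forall fun ξ => ?_)
  have h0 := hK0 ‖ξ‖
  rw [Real.norm_of_nonneg (by positivity), pow_succ]
  rcases le_or_gt r ‖ξ‖ with h | h
  · simp [hKr _ h]
  · have : ‖ξ‖ ^ p ≤ |r| ^ p := by
      gcongr
      exact h.le.trans (le_abs_self r)
    calc K ‖ξ‖ * (‖ξ‖ ^ p * ‖ξ‖) = K ‖ξ‖ * ‖ξ‖ * ‖ξ‖ ^ p := by ring
      _ ≤ K ‖ξ‖ * ‖ξ‖ * |r| ^ p := by gcongr

variable {P : Euc d → Euc d}

theorem integrable_radial_mul_inner (hK : Measurable K)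
    (hK1 : Integrable fun ξ : Euc d => K ‖ξ‖ * ‖ξ‖) {Q : Euc d → Euc d} (hQ : Continuous Q) {C : ℝ}
    (hC : ∀ ξ, ‖Q ξ‖ ≤ C) :
    Integrable fun ξ : Euc d => K ‖ξ‖ * inner ℝ (Q ξ) ξ := by
  refine (hK1.norm.mul_const C).mono' ((hK.comp measurable_norm).aestronglyMeasurable.mul
    (by fun_prop)) (Eventually.of_forall fun ξ => ?_)
  rw [norm_mul, norm_mul, norm_norm]
  calc ‖K ‖ξ‖‖ * ‖(inner ℝ (Q ξ) ξ : ℝ)‖ ≤ ‖K ‖ξ‖‖ * (‖Q ξ‖ * ‖ξ‖) := by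
        gcongr; exact norm_inner_le_norm _ _
    _ ≤ ‖K ‖ξ‖‖ * (C * ‖ξ‖) := by gcongr; exact hC ξ
    _ = _ := by ring

theorem hasCompactSupport_divergence (hPc : HasCompactSupport P) :
    HasCompactSupport (divergence P) := by
  have h : HasCompactSupport (fderiv ℝ P) := hPc.fderiv (𝕜 := ℝ)
  refine h.mono fun x hx => ?_
  contrapose! hx
  have : fderiv ℝ P x = 0 := by simpa using hx
  simp [divergence, this]

theorem continuous_divergence (hP : ContDiff ℝ 1 P) : Continuous (divergence P) := by
  have h := hP.continuous_fderiv one_ne_zero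
  unfold divergence
  fun_prop

/-- Averaging the increments of a vector field against a radial kernel produces its divergence,
up to third moments of the kernel. -/
theorem abs_integral_radial_mul_inner_sub_le (hd : 1 ≤ d) (hK : Measurable K) (hK0 : ∀ t, 0 ≤ K t)
    (hKr : ∀ t, r ≤ t → K t = 0) (hK1 : Integrable fun ξ : Euc d => K ‖ξ‖ * ‖ξ‖)
    (hP : ContDiff ℝ 1 P) (hPc : HasCompactSupport P) {L : ℝ}
    (hL : ∀ x ξ, ‖P (x + ξ) - P x - fderiv ℝ P x ξ‖ ≤ L * ‖ξ‖ ^ 2) (x : Euc d) :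
    |(∫ ξ, K ‖ξ‖ * inner ℝ (P (x + ξ)) ξ) -
      (∫ ξ : Euc d, K ‖ξ‖ * ‖ξ‖ ^ 2) / d * divergence P x| ≤
        L * ∫ ξ : Euc d, K ‖ξ‖ * ‖ξ‖ ^ 3 := by
  obtain ⟨C, hC0, hC⟩ := hP.continuous.exists_norm_le_of_hasCompactSupport hPc
  have hK2 := integrable_radial_mul_norm_pow hK hK0 hKr hK1 1
  have hK3 := integrable_radial_mul_norm_pow hK hK0 hKr hK1 2
  have hcont := hP.continuous
  have i1 : Integrable fun ξ : Euc d => K ‖ξ‖ * inner ℝ (P (x + ξ)) ξ :=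
    integrable_radial_mul_inner hK hK1 (by fun_prop) fun ξ => hC _
  have i2 : Integrable fun ξ : Euc d => K ‖ξ‖ * inner ℝ (P x) ξ :=
    integrable_radial_mul_inner hK hK1 continuous_const fun ξ => hC _
  have i3 : Integrable fun ξ : Euc d => K ‖ξ‖ * inner ℝ (fderiv ℝ P x ξ) ξ := by
    refine (hK2.norm.mul_const ‖fderiv ℝ P x‖).mono'
      ((hK.comp measurable_norm).aestronglyMeasurable.mul (by fun_prop)) (Eventually.of_forall fun ξ => ?_)
    rw [norm_mul, norm_mul, norm_pow, norm_norm]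
    calc ‖K ‖ξ‖‖ * ‖(inner ℝ (fderiv ℝ P x ξ) ξ : ℝ)‖
        ≤ ‖K ‖ξ‖‖ * ((‖fderiv ℝ P x‖ * ‖ξ‖) * ‖ξ‖) := by
          gcongr
          refine (norm_inner_le_norm _ _).trans ?_
          gcongr
          exact (fderiv ℝ P x).le_opNorm ξ
      _ = _ := by ring
  have h2 := integral_radial_mul_inner K (P x)
  have h3 := integral_radial_mul_inner_apply hd hK hK2 (fderiv ℝ P x)
  have heq : (∫ ξ, K ‖ξ‖ * inner ℝ (P (x + ξ)) ξ) -
      (∫ ξ : Euc d, K ‖ξ‖ * ‖ξ‖ ^ 2) / d * divergence P x =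
      ∫ ξ, K ‖ξ‖ * inner ℝ (P (x + ξ) - P x - fderiv ℝ P x ξ) ξ := by
    have h4 : ∀ ξ, K ‖ξ‖ * inner ℝ (P (x + ξ) - P x - fderiv ℝ P x ξ) ξ =
        K ‖ξ‖ * inner ℝ (P (x + ξ)) ξ - K ‖ξ‖ * inner ℝ (P x) ξ -
          K ‖ξ‖ * inner ℝ (fderiv ℝ P x ξ) ξ := fun ξ => by
      rw [inner_sub_left, inner_sub_left]; ring
    simp_rw [h4]
    have i12 : Integrable fun ξ : Euc d =>
      K ‖ξ‖ * inner ℝ (P (x + ξ)) ξ - K ‖ξ‖ * inner ℝ (P x) ξ := i1.sub i2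
    rw [integral_sub i12 i3, integral_sub i1 i2, h2, h3, divergence]
    ring
  rw [heq, ← integral_const_mul, ← Real.norm_eq_abs]
  refine norm_integral_le_of_norm_le (hK3.const_mul L) (Eventually.of_forall fun ξ => ?_)
  rw [norm_mul, Real.norm_of_nonneg (hK0 _)]
  have h0 := hK0 ‖ξ‖
  calc K ‖ξ‖ * ‖(inner ℝ (P (x + ξ) - P x - fderiv ℝ P x ξ) ξ : ℝ)‖
      ≤ K ‖ξ‖ * ((L * ‖ξ‖ ^ 2) * ‖ξ‖) := by
        gcongr
        refine (norm_inner_le_norm _ _).trans ?_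
        gcongr
        exact hL x ξ
    _ = _ := by ring

/-- Duality bound for nonlocal quadratic energies with a radial kernel of short range: testing with
the vector field `P` bounds the energy of `u` from below by the local functional
`-2 ∫ u div P - ∫ |P|² / b`, up to an error governed by the third moment of the kernel. -/
theorem dual_le_nonlocalEnergy (hd : 1 ≤ d) {Ω : Set (Euc d)} (hK : Measurable K)
    (hK0 : ∀ t, 0 ≤ K t) (hKr : ∀ t, r ≤ t → K t = 0)
    (hK1 : Integrable fun ξ : Euc d => K ‖ξ‖ * ‖ξ‖) (hΩ : MeasurableSet Ω) {u b : Euc d → ℝ}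
    (hu : Integrable u) (hbm : Continuous b) {α : ℝ} (hα : 0 < α) (hb : ∀ x, α ≤ b x)
    (hP : ContDiff ℝ 1 P) (hPc : HasCompactSupport P)
    (hPΩ : ∀ x, P x ≠ 0 → Metric.ball x r ⊆ Ω) {L : ℝ}
    (hL : ∀ x ξ, ‖P (x + ξ) - P x - fderiv ℝ P x ξ‖ ≤ L * ‖ξ‖ ^ 2) :
    ENNReal.ofReal ((∫ ξ : Euc d, K ‖ξ‖ * ‖ξ‖ ^ 2) / d *
        (-2 * (∫ x, u x * divergence P x) - ∫ x, ‖P x‖ ^ 2 / b x) -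
        2 * (L * ∫ ξ : Euc d, K ‖ξ‖ * ‖ξ‖ ^ 3) * ∫ x, |u x|) ≤
      ∫⁻ x in Ω, ∫⁻ y in Ω, ENNReal.ofReal (K ‖x - y‖ * (b x * (u x - u y) ^ 2)) := by
  obtain ⟨C, hC0, hC⟩ := hP.continuous.exists_norm_le_of_hasCompactSupport hPc
  have hcont := hP.continuous
  have hK2 := integrable_radial_mul_norm_pow hK hK0 hKr hK1 1
  have hKm : AEStronglyMeasurable (fun p : Euc d × Euc d => K ‖p.2‖) (volume.prod volume) :=
    (hK.comp (measurable_norm.comp measurable_snd)).aestronglyMeasurable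
  -- `2 (Ga - Gb) - Gq` is the dual integrand `2 t q - q² / b` with `t = u x - u (x - ξ)` and
  -- `q = ⟪P x, ξ⟫`; `Gc` is `Gb` after the change of variables `x ↦ x + ξ`
  let Ga : Euc d × Euc d → ℝ := fun p => u p.1 * (K ‖p.2‖ * inner ℝ (P p.1) p.2)
  let Gb : Euc d × Euc d → ℝ := fun p => u (p.1 - p.2) * (K ‖p.2‖ * inner ℝ (P p.1) p.2)
  let Gc : Euc d × Euc d → ℝ := fun p => u p.1 * (K ‖p.2‖ * inner ℝ (P (p.1 + p.2)) p.2)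
  let Gq : Euc d × Euc d → ℝ := fun p => (b p.1)⁻¹ * (K ‖p.2‖ * inner ℝ (P p.1) p.2 ^ 2)
  have hbound : ∀ z ξ : Euc d, ‖K ‖ξ‖ * inner ℝ (P z) ξ‖ ≤ C * (K ‖ξ‖ * ‖ξ‖) := by
    intro z ξ
    have h0 := hK0 ‖ξ‖
    rw [norm_mul, Real.norm_of_nonneg h0]
    calc K ‖ξ‖ * ‖(inner ℝ (P z) ξ : ℝ)‖ ≤ K ‖ξ‖ * (C * ‖ξ‖) := by
          gcongr
          refine (norm_inner_le_norm _ _).trans ?_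
          gcongr
          exact hC z
      _ = _ := by ring
  have hdom : Integrable (fun p : Euc d × Euc d => u p.1 * (C * (K ‖p.2‖ * ‖p.2‖)))
    (volume.prod volume) := hu.mul_prod (hK1.const_mul C)
  have hdom' : Integrable (fun p : Euc d × Euc d => u (p.1 - p.2) * (C * (K ‖p.2‖ * ‖p.2‖)))
    (volume.prod volume) := by
    have := (hK1.const_mul C).convolution_integrand (ContinuousLinearMap.mul ℝ ℝ) hu
    refine this.congr (Eventually.of_forall fun p => ?_)
    simp [mul_comm]
  have iGa : Integrable Ga (volume.prod volume) := by
    refine hdom.mono (hu.aestronglyMeasurable.comp_fst.mul (hKm.mul (by fun_prop)))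
      (Eventually.of_forall fun p => ?_)
    exact (norm_mul _ _).le.trans ((mul_le_mul_of_nonneg_left ((hbound _ _).trans
      (Real.le_norm_self _)) (norm_nonneg _)).trans (norm_mul _ _).ge)
  have iGc : Integrable Gc (volume.prod volume) := by
    refine hdom.mono (hu.aestronglyMeasurable.comp_fst.mul (hKm.mul (by fun_prop)))
      (Eventually.of_forall fun p => ?_)
    exact (norm_mul _ _).le.trans ((mul_le_mul_of_nonneg_left ((hbound _ _).trans
      (Real.le_norm_self _)) (norm_nonneg _)).trans (norm_mul _ _).ge)
  have hushift : AEStronglyMeasurable (fun p : Euc d × Euc d => u (p.1 - p.2))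
      (volume.prod volume) := by
    exact hu.aestronglyMeasurable.comp_quasiMeasurePreserving
      (quasiMeasurePreserving_sub_of_right_invariant volume volume)
  have iGb : Integrable Gb (volume.prod volume) := by
    refine hdom'.mono (hushift.mul (hKm.mul (by fun_prop)))
      (Eventually.of_forall fun p => ?_)
    exact (norm_mul _ _).le.trans ((mul_le_mul_of_nonneg_left ((hbound _ _).trans
      (Real.le_norm_self _)) (norm_nonneg _)).trans (norm_mul _ _).ge)
  have hb0 : ∀ x, 0 < b x := fun x => hα.trans_le (hb x)
  have hP2 : Integrable (fun x => ‖P x‖ ^ 2 / b x) := by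
    refine Continuous.integrable_of_hasCompactSupport
      (by fun_prop (disch := exact fun x => (hb0 x).ne')) (hPc.mono fun x hx => ?_)
    contrapose! hx
    have : P x = 0 := by simpa using hx
    simp [this]
  have iGq : Integrable Gq (volume.prod volume) := by
    have hbi : Continuous fun x => (b x)⁻¹ := hbm.inv₀ fun x => (hb0 x).ne'
    refine (hP2.mul_prod hK2).mono
      ((hbi.comp continuous_fst).aestronglyMeasurable.mul (hKm.mul (by fun_prop)))
      (Eventually.of_forall fun p => ?_)
    have h0 := hK0 ‖p.2‖
    have h1 := hb0 p.1
    rw [Real.norm_of_nonneg (by positivity), Real.norm_of_nonneg (by positivity)]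
    have h2 : inner ℝ (P p.1) p.2 ^ 2 ≤ ‖P p.1‖ ^ 2 * ‖p.2‖ ^ 2 := by
      rw [← mul_pow, ← sq_abs]
      gcongr
      exact abs_real_inner_le_norm _ _
    calc (b p.1)⁻¹ * (K ‖p.2‖ * inner ℝ (P p.1) p.2 ^ 2)
        ≤ (b p.1)⁻¹ * (K ‖p.2‖ * (‖P p.1‖ ^ 2 * ‖p.2‖ ^ 2)) := by gcongr
      _ = _ := by simp only [div_eq_mul_inv]; norm_num; ring
  -- the integrals of the three terms
  have vGa : ∫ p, Ga p ∂(volume.prod volume) = 0 := by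
    rw [integral_prod _ iGa]
    simp only [Ga, integral_const_mul, integral_radial_mul_inner, mul_zero, integral_zero]
  have vGb : ∫ p, Gb p ∂(volume.prod volume) =
      ∫ x, u x * ∫ ξ, K ‖ξ‖ * inner ℝ (P (x + ξ)) ξ := by
    rw [integral_prod_symm _ iGb]
    have h1 : ∀ ξ : Euc d, ∫ x, Gb (x, ξ) = ∫ x, Gc (x, ξ) := by
      intro ξ
      rw [← integral_add_right_eq_self (fun x => Gb (x, ξ)) ξ]
      simp [Gb, Gc]
    simp_rw [h1]
    rw [← integral_prod_symm _ iGc, integral_prod _ iGc]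
    simp only [Gc, integral_const_mul]
  have vGq : ∫ p, Gq p ∂(volume.prod volume) =
      (∫ ξ : Euc d, K ‖ξ‖ * ‖ξ‖ ^ 2) / d * ∫ x, ‖P x‖ ^ 2 / b x := by
    rw [integral_prod _ iGq, ← integral_const_mul]
    congr 1 with x
    simp only [Gq, integral_const_mul]
    rw [integral_radial_mul_inner_sq hd hK hK2]
    ring
  have hdiv : Integrable fun x => u x * divergence P x := by
    obtain ⟨D, -, hD⟩ := (continuous_divergence hP).exists_norm_le_of_hasCompactSupport
      (hasCompactSupport_divergence hPc)
    exact hu.mul_bdd (c := D) (continuous_divergence hP).aestronglyMeasurable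
      (Eventually.of_forall hD)
  have iH : Integrable fun x => u x * ∫ ξ, K ‖ξ‖ * inner ℝ (P (x + ξ)) ξ := by
    have := iGc.integral_prod_left
    simpa only [Gc, integral_const_mul] using this
  have hle : ∫ x, u x * ∫ ξ, K ‖ξ‖ * inner ℝ (P (x + ξ)) ξ ≤
      (∫ ξ : Euc d, K ‖ξ‖ * ‖ξ‖ ^ 2) / d * (∫ x, u x * divergence P x) +
        (L * ∫ ξ : Euc d, K ‖ξ‖ * ‖ξ‖ ^ 3) * ∫ x, |u x| := by
    rw [← integral_const_mul, ← integral_const_mul,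
      ← integral_add (hdiv.const_mul _) (hu.abs.const_mul _)]
    refine integral_mono iH ((hdiv.const_mul _).add (hu.abs.const_mul _)) fun x => ?_
    have h1 := abs_integral_radial_mul_inner_sub_le hd hK hK0 hKr hK1 hP hPc hL x
    set I := ∫ ξ, K ‖ξ‖ * inner ℝ (P (x + ξ)) ξ
    set D := (∫ ξ : Euc d, K ‖ξ‖ * ‖ξ‖ ^ 2) / d
    set M := L * ∫ ξ : Euc d, K ‖ξ‖ * ‖ξ‖ ^ 3
    calc u x * I = D * (u x * divergence P x) + u x * (I - D * divergence P x) := by ring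
      _ ≤ D * (u x * divergence P x) + |u x| * |I - D * divergence P x| := by
          rw [← abs_mul]
          gcongr
          exact le_abs_self _
      _ ≤ D * (u x * divergence P x) + M * |u x| := by
          rw [mul_comm M]
          gcongr
  have iG : Integrable (fun p => 2 * (Ga p - Gb p) - Gq p) (volume.prod volume) :=
    ((iGa.sub iGb).const_mul 2).sub iGq
  have hval : (∫ ξ : Euc d, K ‖ξ‖ * ‖ξ‖ ^ 2) / d *
        (-2 * (∫ x, u x * divergence P x) - ∫ x, ‖P x‖ ^ 2 / b x) -
        2 * (L * ∫ ξ : Euc d, K ‖ξ‖ * ‖ξ‖ ^ 3) * ∫ x, |u x| ≤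
      ∫ p, (2 * (Ga p - Gb p) - Gq p) ∂(volume.prod volume) := by
    have iGab : Integrable (fun p => 2 * (Ga p - Gb p)) (volume.prod volume) :=
      (iGa.sub iGb).const_mul 2
    rw [integral_sub iGab iGq, integral_const_mul, integral_sub iGa iGb, vGa, vGb, vGq]
    linarith
  refine (ENNReal.ofReal_le_ofReal hval).trans
    ((ofReal_integral_le_lintegral_ofReal iG).trans ?_)
  rw [lintegral_prod _ iG.aestronglyMeasurable.aemeasurable.ennreal_ofReal,
    ← lintegral_indicator hΩ]
  refine lintegral_mono fun x => ?_
  -- by the short range of the kernel, only pairs of points of `Ω` contribute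
  have hpoint : ∀ ξ, 0 < 2 * (Ga (x, ξ) - Gb (x, ξ)) - Gq (x, ξ) →
      x ∈ Ω ∧ x - ξ ∈ Ω := by
    intro ξ hpos
    have hPx : P x ≠ 0 := by
      intro h0
      simp [Ga, Gb, Gq, h0] at hpos
    have hξ : ‖ξ‖ < r := by
      by_contra! h
      simp [Ga, Gb, Gq, hKr _ h] at hpos
    refine ⟨hPΩ x hPx (Metric.mem_ball_self ((norm_nonneg ξ).trans_lt hξ)), hPΩ x hPx ?_⟩
    simpa [dist_eq_norm] using hξ
  by_cases hx : x ∈ Ω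
  · rw [indicator_of_mem hx, ← lintegral_indicator hΩ,
      ← lintegral_sub_left_eq_self (Ω.indicator _) x]
    refine lintegral_mono fun ξ => ?_
    rcases le_or_gt (2 * (Ga (x, ξ) - Gb (x, ξ)) - Gq (x, ξ)) 0 with h | h
    · rw [ENNReal.ofReal_of_nonpos h]
      exact bot_le
    · rw [indicator_of_mem (hpoint ξ h).2]
      refine ENNReal.ofReal_le_ofReal ?_
      have h1 := hb0 x
      have h2 := hK0 ‖ξ‖
      rw [sub_sub_cancel]
      simp only [Ga, Gb, Gq]
      set t := u x - u (x - ξ) with ht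
      set q : ℝ := inner ℝ (P x) ξ
      have h3 : 2 * t * q - (b x)⁻¹ * q ^ 2 ≤ b x * t ^ 2 := by
        have : b x * t ^ 2 - (2 * t * q - (b x)⁻¹ * q ^ 2) = (b x)⁻¹ * (b x * t - q) ^ 2 := by
          field_simp; ring
        have h4 : 0 ≤ (b x)⁻¹ * (b x * t - q) ^ 2 := by positivity
        linarith
      calc _ = K ‖ξ‖ * (2 * t * q - (b x)⁻¹ * q ^ 2) := by rw [ht]; ring
        _ ≤ _ := by gcongr
  · rw [indicator_of_notMem hx]
    refine le_of_eq ?_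
    rw [lintegral_congr (g := fun _ => 0), lintegral_zero]
    intro ξ
    refine ENNReal.ofReal_of_nonpos ?_
    by_contra! h
    exact hx (hpoint ξ h).1

end Dual

theorem truncated_le_gagliardoEnergy {d : ℕ} {Ω : Set (Euc d)} {a u : Euc d → ℝ}
    (ha : ∀ x, 0 ≤ a x) {ε s ρ r : ℝ} (hs : s < 1) :
    ∫⁻ x in Ω, ∫⁻ y in Ω, ENNReal.ofReal
        (truncatedKernel d s ρ r ‖x - y‖ * (a (ε⁻¹ • x) * (u x - u y) ^ 2)) ≤
      gagliardoEnergy Ω a ε s u := by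
  rw [gagliardoEnergy, ← lintegral_const_mul' _ _ ENNReal.ofReal_ne_top]
  refine lintegral_mono fun x => ?_
  simp only
  rw [← lintegral_const_mul' _ _ ENNReal.ofReal_ne_top]
  refine lintegral_mono fun y => ?_
  simp only
  rw [← ENNReal.ofReal_mul (by linarith)]
  refine ENNReal.ofReal_le_ofReal ?_
  have h0 := ha (ε⁻¹ • x)
  have hs' : 0 ≤ 1 - s := by linarith
  by_cases h : ‖x - y‖ ∈ Ioo ρ r
  · rw [truncatedKernel, indicator_of_mem h, sq_abs]
    exact le_of_eq (by ring)
  · rw [truncatedKernel, indicator_of_notMem h, zero_mul]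
    have := Real.rpow_nonneg (norm_nonneg (x - y)) ((d : ℝ) + 2 * s)
    positivity

/-- The dual lower bound for the oscillating Gagliardo energy. -/
theorem dual_le_gagliardoEnergy {d : ℕ} (hd : 1 ≤ d) {Ω : Set (Euc d)} (hΩ : MeasurableSet Ω)
    {a : Euc d → ℝ} (hac : Continuous a) {α : ℝ} (hα : 0 < α) (hαa : ∀ x, α ≤ a x)
    {ε s r : ℝ} (hs : s < 1) (hr : 0 < r) {u : Euc d → ℝ} (hu : Integrable u)
    {P : Euc d → Euc d} (hP : ContDiff ℝ 1 P) (hPc : HasCompactSupport P)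
    (hPΩ : ∀ x, P x ≠ 0 → Metric.ball x r ⊆ Ω) {L : ℝ}
    (hL : ∀ x ξ, ‖P (x + ξ) - P x - fderiv ℝ P x ξ‖ ≤ L * ‖ξ‖ ^ 2) :
    ENNReal.ofReal (sphereArea d / (2 * d) * r ^ (2 - 2 * s) *
        (-2 * (∫ x, u x * divergence P x) - ∫ x, ‖P x‖ ^ 2 / a (ε⁻¹ • x)) -
        2 * (L * (sphereArea d * ((1 - s) / (3 - 2 * s) * r ^ (3 - 2 * s)))) * ∫ x, |u x|) ≤
      gagliardoEnergy Ω a ε s u := by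
  -- the first moment is finite only after a cut-off at distance `ρ`, which is removed at the end
  set D := -2 * (∫ x, u x * divergence P x) - ∫ x, ‖P x‖ ^ 2 / a (ε⁻¹ • x) with hD
  have hρ : ∀ ρ ∈ Ioo 0 r, ENNReal.ofReal
      (sphereArea d / (2 * d) * (r ^ (2 - 2 * s) - ρ ^ (2 - 2 * s)) * D -
        2 * (L * (sphereArea d * ((1 - s) / (3 - 2 * s) * (r ^ (3 - 2 * s) - ρ ^ (3 - 2 * s))))) *
          ∫ x, |u x|) ≤ gagliardoEnergy Ω a ε s u := by
    intro ρ hρ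
    have h := dual_le_nonlocalEnergy hd (measurable_truncatedKernel d s ρ r)
      (truncatedKernel_nonneg d hs hρ.1.le) (r := r)
      (fun t ht => indicator_of_notMem (fun h => absurd h.2 (not_lt.2 ht)) _)
      (integrable_truncatedKernel_mul_norm hd hs hρ.1) hΩ hu
      (hac.comp (continuous_const_smul ε⁻¹)) hα (fun x => hαa _) hP hPc hPΩ hL
    refine le_trans (le_of_eq ?_) (h.trans
      (truncated_le_gagliardoEnergy (fun x => (hα.trans_le (hαa x)).le) hs))
    rw [integral_truncatedKernel_mul_norm_pow hd hs hρ.1.le hρ.2.le le_rfl,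
      integral_truncatedKernel_mul_norm_pow hd hs hρ.1.le hρ.2.le (by norm_num)]
    simp only [Function.comp_apply, ← hD]
    have h2 : (1 - s) / (((2 : ℕ) : ℝ) - 2 * s) = 1 / 2 := by
      push_cast
      have : 1 - s ≠ 0 := by linarith
      rw [div_eq_div_iff (by linarith) (by norm_num)]
      ring
    rw [h2]
    push_cast
    congr 1
    ring
  have hp : ∀ p : ℝ, 0 < p → Tendsto (fun ρ : ℝ => ρ ^ p) (𝓝[>] 0) (𝓝 0) := fun p hp =>
    ((Real.continuous_rpow_const hp.le).tendsto' 0 0 (Real.zero_rpow hp.ne')).mono_left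
      nhdsWithin_le_nhds
  have hlim : Tendsto (fun ρ : ℝ => ENNReal.ofReal
      (sphereArea d / (2 * d) * (r ^ (2 - 2 * s) - ρ ^ (2 - 2 * s)) * D -
        2 * (L * (sphereArea d * ((1 - s) / (3 - 2 * s) * (r ^ (3 - 2 * s) - ρ ^ (3 - 2 * s))))) *
          ∫ x, |u x|)) (𝓝[>] 0) (𝓝 (ENNReal.ofReal
      (sphereArea d / (2 * d) * (r ^ (2 - 2 * s) - 0) * D -
        2 * (L * (sphereArea d * ((1 - s) / (3 - 2 * s) * (r ^ (3 - 2 * s) - 0)))) *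
          ∫ x, |u x|))) := by
    refine (ENNReal.continuous_ofReal.tendsto _).comp (Tendsto.sub ?_ ?_)
    · exact (((hp (2 - 2 * s) (by linarith)).const_sub _).const_mul _).mul_const _
    · exact (((((hp (3 - 2 * s) (by linarith)).const_sub _).const_mul _).const_mul _).const_mul _
        |>.const_mul 2).mul_const _
  rw [sub_zero, sub_zero] at hlim
  exact le_of_tendsto hlim (eventually_of_mem (Ioo_mem_nhdsGT hr) hρ)

/-! ### Two-scale functions -/

section TwoScale

variable {d : ℕ} {F : Type*} [NormedAddCommGroup F] [NormedSpace ℝ F]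

/-- A function of a slow variable `z.1` and a fast variable `z.2` which has compact support in the
slow variable and is periodic in the fast one. -/
structure IsTwoScale (Ψ : Euc d × Euc d → F) : Prop where
  exists_isCompact : ∃ S : Set (Euc d), IsCompact S ∧ ∀ x ∉ S, ∀ y, Ψ (x, y) = 0
  periodic : ∀ (i : Fin d) (z : Euc d × Euc d), Ψ (z + (0, EuclideanSpace.single i 1)) = Ψ z

theorem IsTwoScale.fderiv {Ψ : Euc d × Euc d → F} (h : IsTwoScale Ψ) :
    IsTwoScale (fderiv ℝ Ψ) := by
  obtain ⟨S, hS, h0⟩ := h.exists_isCompact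
  refine ⟨⟨S, hS, fun x hx y => ?_⟩, fun i z => ?_⟩
  · have hmem : {z : Euc d × Euc d | z.1 ∈ Sᶜ} ∈ 𝓝 (x, y) :=
      (hS.isClosed.isOpen_compl.preimage continuous_fst).mem_nhds hx
    have : Ψ =ᶠ[𝓝 (x, y)] fun _ => 0 := eventually_of_mem hmem fun z hz => h0 z.1 hz z.2
    rw [this.fderiv_eq, fderiv_fun_const]
    rfl
  · rw [← fderiv_comp_add_right]
    congr 1
    ext z
    exact h.periodic i z

theorem IsTwoScale.exists_norm_le {G : Type*} [NormedAddCommGroup G] {Ψ : Euc d × Euc d → G}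
    (h : IsTwoScale Ψ) (hc : Continuous Ψ) : ∃ C, 0 ≤ C ∧ ∀ z, ‖Ψ z‖ ≤ C := by
  obtain ⟨S, hS, h0⟩ := h.exists_isCompact
  obtain ⟨R, hR⟩ := (ZSpan.fundamentalDomain_isBounded (stdBasis d)).subset_closedBall 0
  obtain ⟨C, hC⟩ := (hS.prod (isCompact_closedBall (0 : Euc d) R)).exists_bound_of_continuousOn
    hc.continuousOn
  refine ⟨max C 0, le_max_right _ _, fun z => ?_⟩
  obtain ⟨x, y⟩ := z
  by_cases hx : x ∈ S
  · have hper : IsOnePeriodic fun y => Ψ (x, y) := fun i y => by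
      simpa using h.periodic i (x, y)
    rw [← hper.apply_cubeFract]
    exact (hC _ ⟨hx, hR (ZSpan.fract_mem_fundamentalDomain _ _)⟩).trans (le_max_left _ _)
  · rw [h0 x hx y, norm_zero]
    exact le_max_right _ _

/-- Taylor's inequality of second order, with a global bound of the second derivative. -/
theorem norm_sub_sub_fderiv_le_of_lipschitz {E : Type*} [NormedAddCommGroup E] [NormedSpace ℝ E]
    {f : E → F} (hf : ContDiff ℝ 2 f) {C : ℝ} (hC : ∀ z, ‖fderiv ℝ (fderiv ℝ f) z‖ ≤ C)
    (x ξ : E) : ‖f (x + ξ) - f x - fderiv ℝ f x ξ‖ ≤ C * ‖ξ‖ ^ 2 := by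
  have hd1 : Differentiable ℝ f := hf.differentiable two_ne_zero
  have hd2 : Differentiable ℝ (fderiv ℝ f) :=
    (hf.fderiv_right (m := 1) (by norm_num)).differentiable one_ne_zero
  have h := (convex_segment (𝕜 := ℝ) x (x + ξ)).norm_image_sub_le_of_norm_hasFDerivWithin_le'
    (f := f) (f' := fderiv ℝ f) (φ := fderiv ℝ f x) (C := C * ‖ξ‖)
    (fun z _ => (hd1 z).hasFDerivAt.hasFDerivWithinAt) (fun z hz => ?_)
    (left_mem_segment ℝ _ _) (right_mem_segment ℝ _ _)
  · simpa [sq, mul_assoc] using h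
  · have h1 := convex_univ.norm_image_sub_le_of_norm_fderiv_le (𝕜 := ℝ) (f := fderiv ℝ f)
      (fun w _ => hd2 w) (fun w _ => hC w) (mem_univ x) (mem_univ z)
    refine h1.trans ?_
    have hC0 : 0 ≤ C := le_trans (norm_nonneg (fderiv ℝ (fderiv ℝ f) x)) (hC x)
    gcongr
    have := norm_sub_le_of_mem_segment hz
    simpa using this

/-- The second order Taylor remainder of the oscillating function `x ↦ Ψ (x, x / ε)` is at most
of order `ε⁻²`. -/
theorem IsTwoScale.exists_taylor_le {Ψ : Euc d × Euc d → F} (h : IsTwoScale Ψ)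
    (hc : ContDiff ℝ ∞ Ψ) : ∃ C, 0 ≤ C ∧ ∀ ε ∈ Ioo (0 : ℝ) 1, ∀ x ξ : Euc d,
      ‖Ψ (x + ξ, ε⁻¹ • (x + ξ)) - Ψ (x, ε⁻¹ • x) -
        _root_.fderiv ℝ (fun x => Ψ (x, ε⁻¹ • x)) x ξ‖ ≤ C / ε ^ 2 * ‖ξ‖ ^ 2 := by
  have hc2 : ContDiff ℝ 2 Ψ := contDiff_infty.1 hc 2
  obtain ⟨C, hC0, hC⟩ := h.fderiv.fderiv.exists_norm_le
    ((hc2.fderiv_right (m := 1) (by norm_num)).continuous_fderiv one_ne_zero)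
  refine ⟨C, hC0, fun ε hε x ξ => ?_⟩
  let ι : Euc d →L[ℝ] Euc d × Euc d :=
    (ContinuousLinearMap.id ℝ _).prod (ε⁻¹ • ContinuousLinearMap.id ℝ _)
  have hι : ∀ x, ι x = (x, ε⁻¹ • x) := fun x => rfl
  have h1 := norm_sub_sub_fderiv_le_of_lipschitz hc2 hC (ι x) (ι ξ)
  have h2 : _root_.fderiv ℝ (fun x => Ψ (x, ε⁻¹ • x)) x = (_root_.fderiv ℝ Ψ (ι x)).comp ι :=
    ((hc2.differentiable two_ne_zero (ι x)).hasFDerivAt.comp x ι.hasFDerivAt).fderiv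
  rw [← map_add] at h1
  rw [h2]
  refine h1.trans ?_
  have h3 : ‖ι ξ‖ ≤ ε⁻¹ * ‖ξ‖ := by
    rw [hι, Prod.norm_def, norm_smul, Real.norm_of_nonneg (inv_nonneg.2 hε.1.le)]
    refine max_le ?_ le_rfl
    exact le_mul_of_one_le_left (norm_nonneg _) ((one_le_inv₀ hε.1).2 hε.2.le)
  calc C * ‖ι ξ‖ ^ 2 ≤ C * (ε⁻¹ * ‖ξ‖) ^ 2 := by gcongr
    _ = _ := by rw [mul_pow, inv_pow]; ring

end TwoScale

/-! ### The liminf inequality, tested with oscillating fields -/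

section Oscillating

variable {d : ℕ}

/-- The field `∑ i, Z_i(x) P_i(x / ε)` built from slow coefficients `Z` and periodic profiles
`P_i`. -/
noncomputable def oscillatingField (Z : Euc d → Euc d) (P : Fin d → Euc d → Euc d) (ε : ℝ)
    (x : Euc d) : Euc d := ∑ i, Z x i • P i (ε⁻¹ • x)

variable {Z : Euc d → Euc d} {P : Fin d → Euc d → Euc d}

theorem isTwoScale_sum_smul {F : Type*} [NormedAddCommGroup F] [NormedSpace ℝ F]
    {P : Fin d → Euc d → F} (hZc : HasCompactSupport Z) (hPper : ∀ i, IsOnePeriodic (P i)) :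
    IsTwoScale (fun z : Euc d × Euc d => ∑ i, Z z.1 i • P i z.2) := by
  refine ⟨⟨tsupport Z, hZc, fun x hx y => ?_⟩, fun k z => ?_⟩
  · have : Z x = 0 := image_eq_zero_of_notMem_tsupport hx
    simp [this]
  · simp [hPper _ k z.2]

theorem contDiff_apply_euc {E : Type*} [NormedAddCommGroup E] [NormedSpace ℝ E] {n : WithTop ℕ∞}
    {f : E → Euc d} (hf : ContDiff ℝ n f) (i : Fin d) : ContDiff ℝ n fun x => f x i :=
  (EuclideanSpace.proj (𝕜 := ℝ) i).contDiff.comp hf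

theorem contDiff_oscillatingField (hZ : ContDiff ℝ ∞ Z) (hP : ∀ i, ContDiff ℝ ∞ (P i)) (ε : ℝ) :
    ContDiff ℝ ∞ (oscillatingField Z P ε) := by
  unfold oscillatingField
  refine ContDiff.sum fun i _ => (contDiff_apply_euc hZ i).smul ((hP i).comp ?_)
  exact contDiff_const_smul _

theorem hasCompactSupport_oscillatingField (hZc : HasCompactSupport Z) (ε : ℝ) :
    HasCompactSupport (oscillatingField Z P ε) := by
  refine hZc.mono fun x hx => ?_
  contrapose! hx
  have : Z x = 0 := by simpa using hx
  simp [oscillatingField, this]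

/-- Since the profiles are divergence free, no term of order `1 / ε` appears. -/
theorem divergence_oscillatingField (hZ : ContDiff ℝ ∞ Z) (hP : ∀ i, ContDiff ℝ ∞ (P i))
    (hdiv : ∀ i x, divergence (P i) x = 0) (ε : ℝ) (x : Euc d) :
    divergence (oscillatingField Z P ε) x =
      ∑ i, ∑ k, fderiv ℝ Z x (EuclideanSpace.single k 1) i * P i (ε⁻¹ • x) k := by
  have hZd : DifferentiableAt ℝ Z x := hZ.differentiable (by simp) x
  have hPd : ∀ i, DifferentiableAt ℝ (P i) (ε⁻¹ • x) := fun i =>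
    (hP i).differentiable (by simp) _
  have hZi : ∀ i, HasFDerivAt (fun x => Z x i)
      ((EuclideanSpace.proj (𝕜 := ℝ) i).comp (fderiv ℝ Z x)) x := fun i =>
    (EuclideanSpace.proj (𝕜 := ℝ) i).hasFDerivAt.comp x hZd.hasFDerivAt
  have hPi : ∀ i, HasFDerivAt (fun x => P i (ε⁻¹ • x))
      ((fderiv ℝ (P i) (ε⁻¹ • x)).comp (ε⁻¹ • ContinuousLinearMap.id ℝ (Euc d))) x := fun i =>
    (hPd i).hasFDerivAt.comp x ((hasFDerivAt_id x).const_smul ε⁻¹)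
  have hsum : HasFDerivAt (oscillatingField Z P ε) _ x :=
    HasFDerivAt.fun_sum (u := Finset.univ) fun i _ => (hZi i).smul (hPi i)
  simp only [divergence, hsum.fderiv]
  have h0 : ∀ i,
      ∑ k, Z x i * (ε⁻¹ * fderiv ℝ (P i) (ε⁻¹ • x) (EuclideanSpace.single k 1) k) = 0 := by
    intro i
    rw [← Finset.mul_sum, ← Finset.mul_sum]
    have := hdiv i (ε⁻¹ • x)
    rw [divergence] at this
    rw [this]; simp
  rw [Finset.sum_comm]
  calc _ = ∑ k, ∑ i, (Z x i * (ε⁻¹ * fderiv ℝ (P i) (ε⁻¹ • x) (EuclideanSpace.single k 1) k) +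
        fderiv ℝ Z x (EuclideanSpace.single k 1) i * P i (ε⁻¹ • x) k) := by
        refine Finset.sum_congr rfl fun k _ => ?_
        simp [Finset.sum_apply]
    _ = _ := by
        simp_rw [Finset.sum_add_distrib]
        rw [Finset.sum_comm (f := fun k i => Z x i * _), Finset.sum_congr rfl fun i _ => h0 i]
        simp

theorem norm_sq_oscillatingField (ε : ℝ) (x : Euc d) :
    ‖oscillatingField Z P ε x‖ ^ 2 =
      ∑ i, ∑ k, Z x i * Z x k * inner ℝ (P i (ε⁻¹ • x)) (P k (ε⁻¹ • x)) := by
  rw [← real_inner_self_eq_norm_sq, oscillatingField, sum_inner]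
  refine Finset.sum_congr rfl fun i _ => ?_
  rw [inner_sum]
  refine Finset.sum_congr rfl fun k _ => ?_
  rw [inner_smul_left, inner_smul_right]
  simp; ring

end Oscillating

theorem gagliardoEnergy_congr {d : ℕ} {Ω : Set (Euc d)} {a u v : Euc d → ℝ} {ε s : ℝ}
    (h : u =ᵐ[volume.restrict Ω] v) : gagliardoEnergy Ω a ε s u = gagliardoEnergy Ω a ε s v := by
  rw [gagliardoEnergy, gagliardoEnergy]
  congr 1
  refine lintegral_congr_ae (h.mono fun x hx => ?_)
  refine lintegral_congr_ae (h.mono fun y hy => ?_)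
  simp only [hx, hy]

/-- Lower bound for the lower limit of the energies obtained by testing with the oscillating
fields `∑ i, Z_i(x) P_i(x / ε)`. -/
theorem ofReal_le_liminf_gagliardoEnergy {d : ℕ} (hd : 1 ≤ d) {Ω : Set (Euc d)} (hΩ : IsOpen Ω)
    {a : Euc d → ℝ} (hac : Continuous a) (hap : IsOnePeriodic a) {α : ℝ} (hα : 0 < α)
    (hαa : ∀ x, α ≤ a x) {ε s : ℕ → ℝ} (hε : ∀ j, ε j ∈ Ioo (0 : ℝ) 1)
    (hε0 : Tendsto ε atTop (𝓝 0)) (hs : ∀ j, s j ∈ Ioo (0 : ℝ) 1)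
    (hs1 : Tendsto s atTop (𝓝 1)) (hsε : Tendsto (fun j => (1 - s j) / ε j ^ 2) atTop (𝓝 0))
    {u : Euc d → ℝ} {v : ℕ → Euc d → ℝ} (hu : Integrable u) (hv : ∀ j, Integrable (v j))
    (hvu : Tendsto (fun j => ∫ x, |v j x - u x|) atTop (𝓝 0))
    {Z : Euc d → Euc d} (hZ : ContDiff ℝ ∞ Z) (hZc : HasCompactSupport Z) (hZΩ : tsupport Z ⊆ Ω)
    {P : Fin d → Euc d → Euc d} (hP : ∀ i, ContDiff ℝ ∞ (P i))
    (hPper : ∀ i, IsOnePeriodic (P i)) (hdiv : ∀ i x, divergence (P i) x = 0) :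
    ENNReal.ofReal (sphereArea d / (2 * d) *
      (-2 * (∑ i, ∑ k, (∫ x, u x * fderiv ℝ Z x (EuclideanSpace.single k 1) i) *
          ∫ y in unitCube d, P i y k) -
        ∑ i, ∑ k, (∫ x, Z x i * Z x k) * ∫ y in unitCube d, inner ℝ (P i y) (P k y) / a y)) ≤
      liminf (fun j => gagliardoEnergy Ω a (ε j) (s j) (v j)) atTop := by
  have ha0 : ∀ x, a x ≠ 0 := fun x => (hα.trans_le (hαa x)).ne'
  obtain ⟨r, hr, hrΩ⟩ : ∃ r, 0 < r ∧ ∀ x, Z x ≠ 0 → Metric.ball x r ⊆ Ω := by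
    obtain ⟨r, hr, h⟩ := hZc.isCompact.exists_thickening_subset_open hΩ hZΩ
    refine ⟨r, hr, fun x hx => Subset.trans ?_ h⟩
    exact Metric.ball_subset_thickening (subset_tsupport _ hx) r
  obtain ⟨C, hC0, hC⟩ := (isTwoScale_sum_smul hZc hPper).exists_taylor_le
    (Ψ := fun z : Euc d × Euc d => ∑ i, Z z.1 i • P i z.2) (by
      exact ContDiff.sum fun i _ => (contDiff_apply_euc (hZ.comp contDiff_fst) i).smul
        ((hP i).comp contDiff_snd))
  let Pε : ℕ → Euc d → Euc d := fun j => oscillatingField Z P (ε j)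
  have hlow : ∀ j, ENNReal.ofReal (sphereArea d / (2 * d) * r ^ (2 - 2 * s j) *
        (-2 * (∫ x, v j x * divergence (Pε j) x) - ∫ x, ‖Pε j x‖ ^ 2 / a ((ε j)⁻¹ • x)) -
        2 * (C / ε j ^ 2 * (sphereArea d * ((1 - s j) / (3 - 2 * s j) * r ^ (3 - 2 * s j)))) *
          ∫ x, |v j x|) ≤ gagliardoEnergy Ω a (ε j) (s j) (v j) := fun j => by
    refine dual_le_gagliardoEnergy hd hΩ.measurableSet hac hα hαa (hs j).2 hr (hv j)
      ((contDiff_oscillatingField hZ hP _).of_le (by simp))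
      (hasCompactSupport_oscillatingField hZc _) (fun x hx => hrΩ x ?_) (hC (ε j) (hε j))
    rintro h0
    exact hx (by simp [oscillatingField, h0])
  have hZ1 : ContDiff ℝ 1 Z := hZ.of_le (by simp)
  have hDZ : ∀ i k, Continuous fun x => fderiv ℝ Z x (EuclideanSpace.single k 1) i := fun i k => by
    have := hZ1.continuous_fderiv one_ne_zero
    fun_prop
  have hDZb : ∀ i k, ∃ B, ∀ x, ‖fderiv ℝ Z x (EuclideanSpace.single k 1) i‖ ≤ B := fun i k => by
    obtain ⟨B, -, hB⟩ := (hDZ i k).exists_norm_le_of_hasCompactSupport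
      ((hZc.fderiv_apply (𝕜 := ℝ) (EuclideanSpace.single k 1)).mono fun x hx => by
        contrapose! hx
        have : fderiv ℝ Z x (EuclideanSpace.single k 1) = 0 := by simpa using hx
        simp [this])
    exact ⟨B, hB⟩
  choose B hB using hDZb
  have hPb : ∀ i, ∃ B, ∀ x, ‖P i x‖ ≤ B := fun i => (hPper i).exists_norm_le (hP i).continuous
  choose B' hB' using hPb
  have hdivval : ∀ j x, divergence (Pε j) x =
      ∑ i, ∑ k, fderiv ℝ Z x (EuclideanSpace.single k 1) i * P i ((ε j)⁻¹ • x) k :=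
    fun j x => divergence_oscillatingField hZ hP hdiv (ε j) x
  have hdivb : ∀ j x, ‖divergence (Pε j) x‖ ≤ ∑ i, ∑ k : Fin d, B i k * B' i := fun j x => by
    rw [hdivval]
    refine (norm_sum_le _ _).trans (Finset.sum_le_sum fun i _ => (norm_sum_le _ _).trans
      (Finset.sum_le_sum fun k _ => ?_))
    rw [norm_mul]
    exact mul_le_mul (hB i k x) ((PiLp.norm_apply_le _ _).trans (hB' i _)) (norm_nonneg _)
      ((norm_nonneg _).trans (hB i k x))
  have hdivm : ∀ j, AEStronglyMeasurable (divergence (Pε j)) volume := fun j =>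
    (continuous_divergence ((contDiff_oscillatingField hZ hP (ε j)).of_le
      (by simp))).aestronglyMeasurable
  have hint : ∀ j, ∀ w : Euc d → ℝ, Integrable w →
      Integrable fun x => w x * divergence (Pε j) x := fun j w hw =>
    hw.mul_bdd (c := ∑ i, ∑ k : Fin d, B i k * B' i) (hdivm j) (Eventually.of_forall (hdivb j))
  -- the fields oscillate, but their divergences are bounded uniformly in `ε`, so that they pair
  -- continuously with the convergence of `v j` in `L¹`
  have lim_div_u : Tendsto (fun j => ∫ x, u x * divergence (Pε j) x) atTop
      (𝓝 (∑ i, ∑ k, (∫ x, u x * fderiv ℝ Z x (EuclideanSpace.single k 1) i) *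
          ∫ y in unitCube d, P i y k)) := by
    have hi : ∀ i k, Integrable fun x => u x * fderiv ℝ Z x (EuclideanSpace.single k 1) i :=
      fun i k => hu.mul_bdd (c := B i k) (hDZ i k).aestronglyMeasurable
        (Eventually.of_forall (hB i k))
    have hPc : ∀ i, Continuous (P i) := fun i => (hP i).continuous
    have hval : ∀ j, ∫ x, u x * divergence (Pε j) x = ∑ i, ∑ k,
        ∫ x, (u x * fderiv ℝ Z x (EuclideanSpace.single k 1) i) * P i ((ε j)⁻¹ • x) k := by
      intro j
      have hii : ∀ i k, Integrable fun x => (u x * fderiv ℝ Z x (EuclideanSpace.single k 1) i) *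
          P i ((ε j)⁻¹ • x) k := fun i k => by
        have := hPc i
        exact (hi i k).mul_bdd (c := B' i) (by fun_prop)
          (Eventually.of_forall fun x => (PiLp.norm_apply_le _ _).trans (hB' i _))
      rw [← Finset.sum_congr rfl fun i _ => integral_finsetSum _ fun k _ => hii i k,
        ← integral_finsetSum _ fun i _ => integrable_finsetSum _ fun k _ => hii i k]
      congr 1 with x
      rw [hdivval, Finset.mul_sum]
      refine Finset.sum_congr rfl fun i _ => ?_
      rw [Finset.mul_sum]
      exact Finset.sum_congr rfl fun k _ => by ring
    simp_rw [hval]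
    refine tendsto_finsetSum _ fun i _ => tendsto_finsetSum _ fun k _ => ?_
    exact tendsto_integral_mul_oscillating (h := fun y => P i y k) (hi i k)
      (fun m y => by simp only [hPper i m y]) (by have := hPc i; fun_prop)
      (fun j => (hε j).1.ne') hε0
  have lim_div_v : Tendsto (fun j => ∫ x, v j x * divergence (Pε j) x) atTop
      (𝓝 (∑ i, ∑ k, (∫ x, u x * fderiv ℝ Z x (EuclideanSpace.single k 1) i) *
          ∫ y in unitCube d, P i y k)) := by
    have hdiff : Tendsto (fun j => (∫ x, v j x * divergence (Pε j) x) -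
        ∫ x, u x * divergence (Pε j) x) atTop (𝓝 0) := by
      refine squeeze_zero_norm (fun j => ?_) (by
        simpa using hvu.mul_const (∑ i, ∑ k : Fin d, B i k * B' i))
      rw [← integral_sub (hint j _ (hv j)) (hint j _ hu), ← integral_mul_const]
      refine norm_integral_le_of_norm_le (((hv j).sub hu).abs.mul_const _)
        (Eventually.of_forall fun x => ?_)
      rw [← sub_mul, norm_mul]
      exact mul_le_mul_of_nonneg_left (hdivb j x) (norm_nonneg _)
    simpa using hdiff.add lim_div_u
  have lim_sq : Tendsto (fun j => ∫ x, ‖Pε j x‖ ^ 2 / a ((ε j)⁻¹ • x)) atTop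
      (𝓝 (∑ i, ∑ k, (∫ x, Z x i * Z x k) *
        ∫ y in unitCube d, inner ℝ (P i y) (P k y) / a y)) := by
    have hZcont := hZ.continuous
    have hi : ∀ i k, Integrable fun x => Z x i * Z x k := fun i k => by
      refine Continuous.integrable_of_hasCompactSupport (by fun_prop) (hZc.mono fun x hx => ?_)
      contrapose! hx
      have : Z x = 0 := by simpa using hx
      simp [this]
    have hPc : ∀ i, Continuous (P i) := fun i => (hP i).continuous
    have hcont : ∀ i k, Continuous fun y => inner ℝ (P i y) (P k y) / a y := fun i k => by
      have := hPc i
      have := hPc k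
      fun_prop (disch := assumption)
    have hper : ∀ i k, IsOnePeriodic fun y => inner ℝ (P i y) (P k y) / a y := fun i k m y => by
      simp only [hPper i m y, hPper k m y, hap m y]
    have hval : ∀ j, ∫ x, ‖Pε j x‖ ^ 2 / a ((ε j)⁻¹ • x) = ∑ i, ∑ k,
        ∫ x, (Z x i * Z x k) *
          (inner ℝ (P i ((ε j)⁻¹ • x)) (P k ((ε j)⁻¹ • x)) / a ((ε j)⁻¹ • x)) := by
      intro j
      have hii : ∀ i k, Integrable fun x => (Z x i * Z x k) *
          (inner ℝ (P i ((ε j)⁻¹ • x)) (P k ((ε j)⁻¹ • x)) / a ((ε j)⁻¹ • x)) := fun i k => by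
        obtain ⟨B₁, hB₁⟩ := (hper i k).exists_norm_le (hcont i k)
        exact (hi i k).mul_bdd (c := B₁)
          ((hcont i k).comp (continuous_const_smul (ε j)⁻¹)).aestronglyMeasurable
          (Eventually.of_forall fun x => hB₁ _)
      rw [← Finset.sum_congr rfl fun i _ => integral_finsetSum _ fun k _ => hii i k,
        ← integral_finsetSum _ fun i _ => integrable_finsetSum _ fun k _ => hii i k]
      congr 1 with x
      simp only [Pε]
      rw [norm_sq_oscillatingField, Finset.sum_div]
      refine Finset.sum_congr rfl fun i _ => ?_
      rw [Finset.sum_div]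
      exact Finset.sum_congr rfl fun k _ => by ring
    simp_rw [hval]
    refine tendsto_finsetSum _ fun i _ => tendsto_finsetSum _ fun k _ => ?_
    exact tendsto_integral_mul_oscillating (hi i k) (hper i k) (hcont i k)
      (fun j => (hε j).1.ne') hε0
  have lim_abs : Tendsto (fun j => ∫ x, |v j x|) atTop (𝓝 (∫ x, |u x|)) := by
    rw [tendsto_iff_norm_sub_tendsto_zero]
    refine squeeze_zero (fun j => norm_nonneg _) (fun j => ?_) hvu
    rw [← integral_sub (hv j).abs hu.abs]
    exact norm_integral_le_of_norm_le ((hv j).sub hu).abs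
      (Eventually.of_forall fun x => abs_abs_sub_abs_le _ _)
  have lim_rpow : ∀ c : ℝ, Tendsto (fun j => r ^ (c - 2 * s j)) atTop (𝓝 (r ^ (c - 2))) := fun c => by
    have h := (hs1.const_mul 2).const_sub c
    rw [mul_one] at h
    exact tendsto_const_nhds.rpow h (Or.inl hr.ne')
  -- the Taylor remainder has size `(1 - s) / ε²`
  have lim_remainder : Tendsto (fun j => 2 * (C / ε j ^ 2 * (sphereArea d * ((1 - s j) / (3 - 2 * s j) *
      r ^ (3 - 2 * s j)))) * ∫ x, |v j x|) atTop (𝓝 0) := by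
    have h3 : Tendsto (fun j => (3 - 2 * s j)⁻¹) atTop (𝓝 ((3 - 2 * 1)⁻¹)) :=
      ((hs1.const_mul 2).const_sub 3).inv₀ (by norm_num)
    have h := (((hsε.mul h3).mul (lim_rpow 3)).mul lim_abs).const_mul (2 * C * sphereArea d)
    simp only [zero_mul, mul_zero] at h
    refine h.congr fun j => ?_
    simp only [div_eq_mul_inv]
    ring
  have hB := ((((lim_rpow 2).const_mul (sphereArea d / (2 * d))).mul
    ((lim_div_v.const_mul (-2)).sub lim_sq)).sub lim_remainder)
  rw [sub_self, Real.rpow_zero, mul_one, sub_zero] at hB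
  have hB2 := (ENNReal.continuous_ofReal.tendsto _).comp hB
  rw [← hB2.liminf_eq]
  exact liminf_le_liminf (Eventually.of_forall hlow)

/-! ### From the dual bound to Sobolev regularity -/

/-- The Lax–Milgram theorem for an operator. -/
theorem ContinuousLinearMap.surjective_of_coercive {H : Type*} [NormedAddCommGroup H]
    [InnerProductSpace ℝ H] [CompleteSpace H] (B : H →L[ℝ] H) {α : ℝ} (hα : 0 < α)
    (hB : ∀ x, α * ‖x‖ ^ 2 ≤ inner ℝ (B x) x) : Function.Surjective B := by
  let b : H →L[ℝ] H →L[ℝ] ℝ :=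
    (isBoundedBilinearMap_inner (𝕜 := ℝ) (E := H)).toContinuousLinearMap.comp B
  have hb : IsCoercive b := ⟨α, hα, fun x => by
    have := hB x
    rw [sq, ← mul_assoc] at this
    exact this⟩
  have h : ∀ v, hb.continuousLinearEquivOfBilin v = B v := fun v =>
    ext_inner_right ℝ fun w => hb.continuousLinearEquivOfBilin_apply v w
  intro y
  obtain ⟨v, hv⟩ := hb.continuousLinearEquivOfBilin.surjective y
  exact ⟨v, (h v).symm.trans hv⟩

/-- If the concave quadratic functional `-2 ℓ(x) - ⟪B T x, T x⟫` is bounded above by `m`, then `ℓ`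
is represented by some `g` whose energy `⟪B g, g⟫` is at most `m`. -/
theorem exists_representation_of_forall_le {D H : Type*} [AddCommGroup D] [Module ℝ D]
    [NormedAddCommGroup H] [InnerProductSpace ℝ H] [CompleteSpace H] {T : D →ₗ[ℝ] H}
    (hT : DenseRange T) {B : H →L[ℝ] H} {α : ℝ} (hα : 0 < α)
    (hB : ∀ x, α * ‖x‖ ^ 2 ≤ inner ℝ (B x) x) {ℓ : D →ₗ[ℝ] ℝ} {m : ℝ}
    (h : ∀ x, -2 * ℓ x - inner ℝ (B (T x)) (T x) ≤ m) :
    ∃ g : H, (∀ x, ℓ x = -inner ℝ (B g) (T x)) ∧ inner ℝ (B g) g ≤ m := by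
  have hm : 0 ≤ m := by simpa using h 0
  -- scaling `x` turns the upper bound into a bound of `ℓ` by the energy norm
  have hsq : ∀ x, ℓ x ^ 2 ≤ m * inner ℝ (B (T x)) (T x) := by
    intro x
    have hd := discrim_le_zero (a := inner ℝ (B (T x)) (T x)) (b := 2 * ℓ x) (c := m) fun t => by
      have := h (t • x)
      simp only [map_smul, inner_smul_left, inner_smul_right, smul_eq_mul, conj_trivial] at this
      linarith
    rw [discrim] at hd
    linarith
  have hbound : ∀ x, ‖ℓ x‖ ≤ √(m * ‖B‖) * ‖T x‖ := by
    intro x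
    rw [Real.norm_eq_abs]
    refine abs_le_of_sq_le_sq ?_ (by positivity)
    rw [mul_pow, Real.sq_sqrt (by positivity)]
    calc ℓ x ^ 2 ≤ m * inner ℝ (B (T x)) (T x) := hsq x
      _ ≤ m * (‖B (T x)‖ * ‖T x‖) := by gcongr; exact real_inner_le_norm _ _
      _ ≤ m * ((‖B‖ * ‖T x‖) * ‖T x‖) := by gcongr; exact B.le_opNorm _
      _ = _ := by ring
  let E : H →L[ℝ] ℝ := ℓ.extendOfNorm T
  have hE : ∀ x, E (T x) = ℓ x := LinearMap.extendOfNorm_eq hT ⟨_, hbound⟩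
  obtain ⟨g, hg⟩ := B.surjective_of_coercive hα hB (-(InnerProductSpace.toDual ℝ H).symm E)
  have hgE : ∀ w, inner ℝ (B g) w = -E w := fun w => by
    rw [hg, inner_neg_left, InnerProductSpace.toDual_symm_apply]
  refine ⟨g, fun x => by rw [hgE, hE, neg_neg], ?_⟩
  have hall : ∀ w, -2 * E w - inner ℝ (B w) w ≤ m :=
    fun w => hT.induction_on w (isClosed_le (by fun_prop) continuous_const) fun x => by
      rw [hE]; exact h x
  have := hall g
  have h2 := hgE g
  linarith

section TestFields

variable {d : ℕ} {Ω : Set (Euc d)}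

/-- The smooth vector fields with compact support in `Ω`. -/
def testFields (Ω : Set (Euc d)) : Submodule ℝ (Euc d → Euc d) where
  carrier := {Z | ContDiff ℝ ∞ Z ∧ HasCompactSupport Z ∧ tsupport Z ⊆ Ω}
  add_mem' := fun ⟨h1, h2, h3⟩ ⟨k1, k2, k3⟩ =>
    ⟨h1.add k1, h2.add k2, (tsupport_add _ _).trans (union_subset h3 k3)⟩
  zero_mem' := ⟨contDiff_const, HasCompactSupport.zero, by simp⟩
  smul_mem' := fun c Z ⟨h1, h2, h3⟩ =>
    ⟨h1.const_smul c, h2.smul_left,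
      (closure_mono (Function.support_const_smul_subset c Z)).trans h3⟩

theorem memLp_of_mem_testFields {Z : Euc d → Euc d} (hZ : Z ∈ testFields Ω) :
    MemLp Z 2 (volume.restrict Ω) :=
  (hZ.1.continuous.memLp_of_hasCompactSupport hZ.2.1).restrict Ω

/-- The class in `L²(Ω)` of a test field. -/
noncomputable def testFieldToLp (Ω : Set (Euc d)) :
    testFields Ω →ₗ[ℝ] Lp (Euc d) 2 (volume.restrict Ω) where
  toFun Z := (memLp_of_mem_testFields Z.2).toLp Z
  map_add' _ _ := rfl
  map_smul' _ _ := rfl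

theorem smul_mem_testFields {φ : Euc d → ℝ} (hφ : ContDiff ℝ ∞ φ) (hφc : HasCompactSupport φ)
    (hφΩ : tsupport φ ⊆ Ω) (w : Euc d) : (fun x => φ x • w) ∈ testFields Ω :=
  ⟨hφ.smul contDiff_const, hφc.smul_right, (tsupport_smul_subset_left φ _).trans hφΩ⟩

theorem locallyIntegrableOn_of_memLp {F : Type*} [NormedAddCommGroup F] {f : Euc d → F}
    (hΩ : IsOpen Ω) (hf : MemLp f 2 (volume.restrict Ω)) : LocallyIntegrableOn f Ω := by
  rw [locallyIntegrableOn_iff hΩ.isLocallyClosed]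
  intro k hk hkc
  have h : MemLp f 2 (volume.restrict k) := hf.mono_measure (Measure.restrict_mono hk le_rfl)
  have : IsFiniteMeasure (volume.restrict k : Measure (Euc d)) :=
    isFiniteMeasure_restrict.2 hkc.measure_lt_top.ne
  exact h.integrable (by norm_num)

theorem denseRange_testFieldToLp (hΩ : IsOpen Ω) : DenseRange (testFieldToLp Ω) := by
  have h : (LinearMap.range (testFieldToLp Ω)).topologicalClosure = ⊤ := by
    rw [Submodule.topologicalClosure_eq_top_iff, Submodule.eq_bot_iff]
    intro f hf
    have hfL := locallyIntegrableOn_of_memLp hΩ (Lp.memLp f)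
    have hk : ∀ k : Fin d, ∀ᵐ x, x ∈ Ω → f x k = 0 := by
      intro k
      refine hΩ.ae_eq_zero_of_integral_contDiff_smul_eq_zero ?_ fun φ hφ hφc hφΩ => ?_
      · exact locallyIntegrableOn_of_memLp hΩ
          ((EuclideanSpace.proj (𝕜 := ℝ) k).comp_memLp' (Lp.memLp f))
      · have h0 := hf _ ⟨⟨_, smul_mem_testFields hφ hφc hφΩ (EuclideanSpace.single k 1)⟩, rfl⟩
        have h1 : inner ℝ (testFieldToLp Ω
            ⟨_, smul_mem_testFields hφ hφc hφΩ (EuclideanSpace.single k 1)⟩) f =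
            ∫ x in Ω, φ x • f x k := by
          rw [L2.inner_def]
          refine integral_congr_ae ?_
          filter_upwards [(memLp_of_mem_testFields
            (smul_mem_testFields hφ hφc hφΩ (EuclideanSpace.single k 1))).coeFn_toLp] with x hx
          have : (testFieldToLp Ω ⟨_, smul_mem_testFields hφ hφc hφΩ
            (EuclideanSpace.single k 1)⟩ : Lp (Euc d) 2 (volume.restrict Ω)) x =
              φ x • EuclideanSpace.single k 1 := hx
          rw [this, inner_smul_left, EuclideanSpace.inner_single_left]
          simp
        rw [← setIntegral_eq_integral_of_forall_compl_eq_zero (s := Ω), ← h1, h0]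
        intro x hx
        rw [image_eq_zero_of_notMem_tsupport fun h => hx (hφΩ h), zero_smul]
    rw [Lp.eq_zero_iff_ae_eq_zero, Filter.EventuallyEq, ae_restrict_iff' hΩ.measurableSet]
    filter_upwards [eventually_all.2 hk] with x hx hxΩ
    ext k
    exact hx k hxΩ
  exact Submodule.dense_iff_topologicalClosure_eq_top.2 h

theorem integral_inner_toEuclideanLin {A : Matrix (Fin d) (Fin d) ℝ}
    (f : Lp (Euc d) 2 (volume.restrict Ω)) {g : Euc d → Euc d} (hg : MemLp g 2 (volume.restrict Ω)) :
    inner ℝ ((A.toEuclideanLin.toContinuousLinearMap).compLpL 2 (volume.restrict Ω) f)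
      (hg.toLp g) = ∫ x in Ω, inner ℝ (A.toEuclideanLin (f x)) (g x) := by
  rw [L2.inner_def]
  refine integral_congr_ae ?_
  filter_upwards [ContinuousLinearMap.coeFn_compLpL (A.toEuclideanLin.toContinuousLinearMap) f,
    hg.coeFn_toLp] with x hx hx'
  rw [hx, hx']
  rfl

end TestFields

theorem toEuclideanLin_apply_apply {d : ℕ} (A : Matrix (Fin d) (Fin d) ℝ) (z : Euc d) (k : Fin d) :
    A.toEuclideanLin z k = ∑ i, A k i * z i := by
  simp [Matrix.toLpLin_apply, Matrix.mulVec, dotProduct]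

theorem quadForm_eq_sum {d : ℕ} (A : Matrix (Fin d) (Fin d) ℝ) (z : Euc d) :
    quadForm A z = ∑ i, ∑ k, A i k * (z i * z k) := by
  rw [quadForm, PiLp.inner_apply]
  refine Finset.sum_congr rfl fun i _ => ?_
  rw [toEuclideanLin_apply_apply]
  simp only [RCLike.inner_apply, conj_trivial]
  rw [Finset.mul_sum]
  exact Finset.sum_congr rfl fun k _ => by ring

/-- A function for which the dual functional is bounded above on test fields lies in `W^{1,2}(Ω)`,
and the bound controls its Dirichlet energy. -/
theorem memW12_of_forall_dual_le {d : ℕ} {Ω : Set (Euc d)} (hΩ : IsOpen Ω)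
    {A : Matrix (Fin d) (Fin d) ℝ} (hA : A.IsSymm) {α : ℝ} (hα : 0 < α)
    (hαA : ∀ z, α * ‖z‖ ^ 2 ≤ quadForm A z) {u : Euc d → ℝ} (hu : MemLp u 2 (volume.restrict Ω))
    {m : ℝ} (h : ∀ Z ∈ testFields Ω, -2 * (∑ i, ∑ k, (∫ x in Ω, u x *
        fderiv ℝ Z x (EuclideanSpace.single k 1) i) * A i k) -
      ∫ x in Ω, quadForm A (Z x) ≤ m) :
    MemW12 Ω u ∧ ∫ x in Ω, quadForm A (weakGradient Ω u x) ≤ m := by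
  have hDZ : ∀ (Z : testFields Ω) i k, Integrable (fun x => u x *
      fderiv ℝ (Z : Euc d → Euc d) x (EuclideanSpace.single k 1) i) (volume.restrict Ω) := by
    intro Z i k
    have hc := (contDiff_infty.1 Z.2.1 1).continuous_fderiv one_ne_zero
    refine hu.integrable_mul (q := 2) (MemLp.restrict Ω
      (Continuous.memLp_of_hasCompactSupport (by fun_prop)
        ((Z.2.2.1.fderiv_apply (𝕜 := ℝ) (EuclideanSpace.single k 1)).mono fun x hx => ?_)))
    contrapose! hx
    have : fderiv ℝ (Z : Euc d → Euc d) x (EuclideanSpace.single k 1) = 0 := by simpa using hx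
    simp [this]
  -- `ℓ Z = ∫ u div (A Z)`
  let ℓ : testFields Ω →ₗ[ℝ] ℝ :=
    { toFun := fun Z => ∑ i, ∑ k, (∫ x in Ω, u x *
        fderiv ℝ (Z : Euc d → Euc d) x (EuclideanSpace.single k 1) i) * A i k
      map_add' := fun Z Z' => by
        simp_rw [← Finset.sum_add_distrib]
        refine Finset.sum_congr rfl fun i _ => Finset.sum_congr rfl fun k _ => ?_
        rw [← add_mul, ← integral_add (hDZ Z i k) (hDZ Z' i k)]
        congr 2 with x
        rw [Submodule.coe_add, fderiv_add (Z.2.1.differentiable (by simp) x)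
          (Z'.2.1.differentiable (by simp) x)]
        simp; ring
      map_smul' := fun c Z => by
        simp_rw [RingHom.id_apply, smul_eq_mul, Finset.mul_sum]
        refine Finset.sum_congr rfl fun i _ => Finset.sum_congr rfl fun k _ => ?_
        rw [← mul_assoc, ← integral_const_mul]
        congr 2 with x
        rw [Submodule.coe_smul, fderiv_const_smul (Z.2.1.differentiable (by simp) x)]
        simp; ring }
  let B := (A.toEuclideanLin.toContinuousLinearMap).compLpL 2 (volume.restrict Ω)
  have hBself : ∀ f : Lp (Euc d) 2 (volume.restrict Ω),
      inner ℝ (B f) f = ∫ x in Ω, quadForm A (f x) := fun f => by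
    have := integral_inner_toEuclideanLin (A := A) f (Lp.memLp f)
    rwa [Lp.toLp_coeFn] at this
  have hquad : ∀ f : Lp (Euc d) 2 (volume.restrict Ω),
      Integrable (fun x => quadForm A (f x)) (volume.restrict Ω) := fun f => by
    have h1 : MemLp (fun x => A.toEuclideanLin.toContinuousLinearMap (f x)) 2 (volume.restrict Ω) :=
      (A.toEuclideanLin.toContinuousLinearMap).comp_memLp' (Lp.memLp f)
    refine (h1.norm.integrable_mul (q := 2) (Lp.memLp f).norm).mono'
      (h1.1.inner (𝕜 := ℝ) (Lp.memLp f).1) (Eventually.of_forall fun x => ?_)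
    exact norm_inner_le_norm _ _
  have hB : ∀ f : Lp (Euc d) 2 (volume.restrict Ω), α * ‖f‖ ^ 2 ≤ inner ℝ (B f) f := fun f => by
    rw [hBself, norm_sq_toLp_eq_integral, ← integral_const_mul]
    refine integral_mono ?_ (hquad f) fun x => hαA (f x)
    exact (Lp.memLp f).integrable_norm_pow (by norm_num) |>.const_mul α
  obtain ⟨g, hg, hgm⟩ := exists_representation_of_forall_le (ℓ := ℓ) (T := testFieldToLp Ω) (B := B)
    (denseRange_testFieldToLp hΩ) hα hB (m := m) (fun Z => by
      refine le_trans (le_of_eq ?_) (h Z Z.2)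
      rw [hBself]
      congr 1
      refine integral_congr_ae ?_
      filter_upwards [(memLp_of_mem_testFields Z.2).coeFn_toLp] with x hx
      exact congrArg (quadForm A) hx)
  have hweak : IsWeakGradient Ω u g := by
    refine ⟨locallyIntegrableOn_of_memLp hΩ hu, locallyIntegrableOn_of_memLp hΩ (Lp.memLp g), ?_⟩
    intro φ hφ hφc hφΩ k
    -- choose `w` with `A w = e_k`, so that testing with `φ w` isolates the derivative in
    -- direction `k`
    have hsurj : Function.Surjective A.toEuclideanLin :=
      (A.toEuclideanLin.toContinuousLinearMap).surjective_of_coercive hα hαA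
    obtain ⟨w, hw⟩ := hsurj (EuclideanSpace.single k 1)
    have hwi : ∀ j, ∑ i, A i j * w i = (EuclideanSpace.single k (1 : ℝ)) j := fun j => by
      rw [← hw, toEuclideanLin_apply_apply]
      exact Finset.sum_congr rfl fun i _ => by rw [hA.apply]
    have hZ := smul_mem_testFields hφ hφc hφΩ w
    have hfd : ∀ x v, fderiv ℝ (fun x => φ x • w) x v = fderiv ℝ φ x v • w := fun x v => by
      rw [fderiv_smul_const (hφ.differentiable (by simp) x)]
      rfl
    have h1 : ℓ ⟨_, hZ⟩ = ∫ x in Ω, u x * fderiv ℝ φ x (EuclideanSpace.single k 1) := by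
      change ∑ i, ∑ j, (∫ x in Ω, u x * fderiv ℝ (fun x => φ x • w) x
        (EuclideanSpace.single j 1) i) * A i j = _
      have h2 : ∀ i j, (∫ x in Ω, u x * fderiv ℝ (fun x => φ x • w) x
          (EuclideanSpace.single j 1) i) * A i j =
          (∫ x in Ω, u x * fderiv ℝ φ x (EuclideanSpace.single j 1)) * (A i j * w i) := by
        intro i j
        simp_rw [hfd, PiLp.smul_apply, smul_eq_mul, ← mul_assoc, integral_mul_const]
        ring
      simp_rw [h2]
      rw [Finset.sum_comm]
      simp_rw [← Finset.mul_sum, hwi]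
      simp
    have h3 : inner ℝ (B g) (testFieldToLp Ω ⟨_, hZ⟩) = ∫ x in Ω, g x k * φ x := by
      have := integral_inner_toEuclideanLin (A := A) g (memLp_of_mem_testFields hZ)
      refine this.trans ?_
      congr 1 with x
      have h4 : inner ℝ (A.toEuclideanLin (g x)) w = g x k := by
        rw [PiLp.inner_apply]
        simp only [toEuclideanLin_apply_apply, RCLike.inner_apply, conj_trivial]
        simp_rw [Finset.mul_sum]
        rw [Finset.sum_comm]
        calc ∑ j, ∑ i, w i * (A i j * g x j) = ∑ j, (∑ i, A i j * w i) * g x j := by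
              refine Finset.sum_congr rfl fun j _ => ?_
              rw [Finset.sum_mul]
              exact Finset.sum_congr rfl fun i _ => by ring
          _ = g x k := by simp_rw [hwi]; simp
      rw [inner_smul_right, h4, mul_comm]
    rw [← h1, hg, h3]
  refine ⟨⟨hu, g, hweak, Lp.memLp g⟩, ?_⟩
  rw [hBself] at hgm
  refine le_trans (le_of_eq (integral_congr_ae ?_)) hgm
  filter_upwards [hweak.weakGradient_ae_eq hΩ] with x hx
  rw [hx]

/-! ### The liminf inequality -/

theorem sphereArea_pos {d : ℕ} (hd : 1 ≤ d) : 0 < sphereArea d := by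
  rw [sphereArea_eq hd]
  have : (0 : ℝ) < d := by exact_mod_cast hd
  exact mul_pos this (ENNReal.toReal_pos (Metric.measure_ball_pos _ _ one_pos).ne'
    measure_ball_lt_top.ne)

theorem tendsto_integral_abs_sub_of_tendsto_Lp {X : Type*} [MeasurableSpace X] {μ : Measure X}
    [IsFiniteMeasure μ] {v : ℕ → Lp ℝ 2 μ} {u : Lp ℝ 2 μ} (h : Tendsto v atTop (𝓝 u)) :
    Tendsto (fun j => ∫ x, |v j x - u x| ∂μ) atTop (𝓝 0) := by
  have h1 := (Lp.tendsto_Lp_iff_tendsto_eLpNorm' v u).1 h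
  have h2 : Tendsto (fun j => eLpNorm (⇑(v j) - ⇑u) 2 μ *
      μ univ ^ (1 / (1 : ℝ≥0∞).toReal - 1 / (2 : ℝ≥0∞).toReal)) atTop (𝓝 0) := by
    simpa using ENNReal.Tendsto.mul_const h1 (Or.inr (ENNReal.rpow_ne_top_of_nonneg (by norm_num)
      (measure_ne_top μ univ)))
  have h3 : Tendsto (fun j => eLpNorm (⇑(v j) - ⇑u) 1 μ) atTop (𝓝 0) :=
    tendsto_of_tendsto_of_tendsto_of_le_of_le tendsto_const_nhds h2 (fun _ => bot_le) fun j =>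
      eLpNorm_le_eLpNorm_mul_rpow_measure_univ (by norm_num)
        ((Lp.aestronglyMeasurable _).sub (Lp.aestronglyMeasurable _))
  have h4 := (ENNReal.tendsto_toReal ENNReal.zero_ne_top).comp h3
  refine h4.congr fun j => ?_
  rw [Function.comp_apply, eLpNorm_one_eq_lintegral_enorm, ← integral_norm_eq_lintegral_enorm
    ((Lp.aestronglyMeasurable _).sub (Lp.aestronglyMeasurable _))]
  rfl

/-- The `Γ`-liminf inequality. The dual bounds for all test fields show that the limit lies in
`W^{1,2}(Ω)` whenever the lower limit of the energies is finite. -/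
theorem homogenizedEnergy_le_liminf {d : ℕ} (hd : 1 ≤ d) {Ω : Set (Euc d)} (hΩ : IsOpen Ω)
    (hΩb : Bornology.IsBounded Ω) {a : Euc d → ℝ} (hac : Continuous a) (hap : IsOnePeriodic a)
    {α β : ℝ} (hα : 0 < α) (hαa : ∀ x, α ≤ a x) (hβ : ∀ x, a x ≤ β) {ε s : ℕ → ℝ}
    (hε : ∀ j, ε j ∈ Ioo (0 : ℝ) 1) (hε0 : Tendsto ε atTop (𝓝 0))
    (hs : ∀ j, s j ∈ Ioo (0 : ℝ) 1)
    (hs1 : Tendsto s atTop (𝓝 1)) (hsε : Tendsto (fun j => (1 - s j) / ε j ^ 2) atTop (𝓝 0))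
    {u : Lp ℝ 2 (volume.restrict Ω)} {v : ℕ → Lp ℝ 2 (volume.restrict Ω)}
    (hv : Tendsto v atTop (𝓝 u)) :
    homogenizedEnergy Ω (homMatrix hac) u ≤
      liminf (fun j => gagliardoEnergy Ω a (ε j) (s j) (v j)) atTop := by
  have hfin : IsFiniteMeasure (volume.restrict Ω) :=
    isFiniteMeasure_restrict.2 hΩb.measure_lt_top.ne
  set I := liminf (fun j => gagliardoEnergy Ω a (ε j) (s j) (v j)) atTop with hI
  rcases eq_or_ne I ⊤ with hItop | hItop
  · rw [hItop]; exact le_top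
  have hint : ∀ w : Lp ℝ 2 (volume.restrict Ω), Integrable (Ω.indicator w) := fun w => by
    rw [integrable_indicator_iff hΩ.measurableSet]
    exact (Lp.memLp w).integrable (by norm_num)
  have hvu : Tendsto (fun j => ∫ x, |Ω.indicator (v j) x - Ω.indicator u x|) atTop (𝓝 0) := by
    refine (tendsto_integral_abs_sub_of_tendsto_Lp hv).congr fun j => ?_
    rw [← integral_indicator hΩ.measurableSet]
    congr 1 with x
    by_cases hx : x ∈ Ω <;> simp [hx]
  obtain ⟨P, hP, hPper, hdiv, hP1, hP2⟩ := exists_smooth_fluxes hac hα hαa hβ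
  set c := sphereArea d / (2 * d) with hc
  have hcpos : 0 < c := by
    have : (0 : ℝ) < d := by exact_mod_cast hd
    have := sphereArea_pos hd
    positivity
  have htest : ∀ Z ∈ testFields Ω, -2 * (∑ i, ∑ k, (∫ x in Ω, u x *
        fderiv ℝ Z x (EuclideanSpace.single k 1) i) * homMatrix hac i k) -
      ∫ x in Ω, quadForm (homMatrix hac) (Z x) ≤ I.toReal / c := by
    rintro Z ⟨hZ, hZc, hZΩ⟩
    -- the bound with approximate fluxes, before they approach the optimal ones
    have hn : ∀ n, ENNReal.ofReal (c *
        (-2 * (∑ i, ∑ k, (∫ x, Ω.indicator u x * fderiv ℝ Z x (EuclideanSpace.single k 1) i) *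
          ∫ y in unitCube d, P n i y k) -
        ∑ i, ∑ k, (∫ x, Z x i * Z x k) *
          ∫ y in unitCube d, inner ℝ (P n i y) (P n k y) / a y)) ≤ I := by
      intro n
      refine (ofReal_le_liminf_gagliardoEnergy hd hΩ hac hap hα hαa hε hε0 hs hs1 hsε (hint u)
        (fun j => hint (v j)) hvu hZ hZc hZΩ (hP n) (hPper n) (hdiv n)).trans (le_of_eq ?_)
      rw [hI]
      congr 1 with j
      exact gagliardoEnergy_congr (indicator_ae_eq_restrict hΩ.measurableSet)
    have hlim : Tendsto (fun n => ENNReal.ofReal (c *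
        (-2 * (∑ i, ∑ k, (∫ x, Ω.indicator u x * fderiv ℝ Z x (EuclideanSpace.single k 1) i) *
          ∫ y in unitCube d, P n i y k) -
        ∑ i, ∑ k, (∫ x, Z x i * Z x k) *
          ∫ y in unitCube d, inner ℝ (P n i y) (P n k y) / a y))) atTop
        (𝓝 (ENNReal.ofReal (c *
        (-2 * (∑ i, ∑ k, (∫ x, Ω.indicator u x * fderiv ℝ Z x (EuclideanSpace.single k 1) i) *
          homMatrix hac i k) -
        ∑ i, ∑ k, (∫ x, Z x i * Z x k) * homMatrix hac i k)))) := by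
      refine (ENNReal.continuous_ofReal.tendsto _).comp (Tendsto.const_mul _ (Tendsto.sub
        (Tendsto.const_mul _ ?_) ?_))
      · exact tendsto_finsetSum _ fun i _ => tendsto_finsetSum _ fun k _ => (hP1 i k).const_mul _
      · exact tendsto_finsetSum _ fun i _ => tendsto_finsetSum _ fun k _ => (hP2 i k).const_mul _
    have hle := le_of_tendsto' hlim hn
    rw [ENNReal.ofReal_le_iff_le_toReal hItop] at hle
    rw [le_div_iff₀ hcpos, mul_comm]
    refine le_trans (le_of_eq ?_) hle
    congr 2
    · congr 1
      refine Finset.sum_congr rfl fun i _ => Finset.sum_congr rfl fun k _ => ?_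
      rw [← integral_indicator hΩ.measurableSet]
      congr 2 with x
      by_cases hx : x ∈ Ω <;> simp [hx]
    · have hZcont := hZ.continuous
      have hi : ∀ i k, Integrable fun x => Z x i * Z x k := fun i k => by
        refine Continuous.integrable_of_hasCompactSupport (by fun_prop) (hZc.mono fun x hx => ?_)
        contrapose! hx
        have : Z x = 0 := by simpa using hx
        simp [this]
      have hii : ∀ i k, Integrable (fun x => homMatrix hac i k * (Z x i * Z x k))
        (volume.restrict Ω) := fun i k => ((hi i k).const_mul _).integrableOn
      simp_rw [quadForm_eq_sum]
      rw [integral_finsetSum Finset.univ fun i _ => integrable_finsetSum _ fun k _ => hii i k]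
      refine Finset.sum_congr rfl fun i _ => ?_
      rw [integral_finsetSum Finset.univ fun k _ => hii i k]
      refine Finset.sum_congr rfl fun k _ => ?_
      rw [integral_const_mul, mul_comm, setIntegral_eq_integral_of_forall_compl_eq_zero]
      intro x hx
      rw [image_eq_zero_of_notMem_tsupport fun h => hx (hZΩ h)]
      simp
  obtain ⟨hmem, hle⟩ := memW12_of_forall_dual_le hΩ (homMatrix_isSymm hac) hα
    (mul_norm_sq_le_quadForm_homMatrix hac hα hαa) (Lp.memLp u) htest
  rw [homogenizedEnergy, if_pos hmem, ENNReal.ofReal_le_iff_le_toReal hItop, ← hc]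
  rwa [le_div_iff₀ hcpos, mul_comm] at hle

/-! ### Density of smooth functions in the Sobolev space of a Lipschitz domain -/

section Density

variable {d : ℕ} {Ω : Set (Euc d)}

/-- Near each point of the closure of a Lipschitz domain the domain can be pushed strictly inside
itself: a small translation by `t e` moves each of its points to the centre of a ball of radius
proportional to `t` contained in the domain. -/
theorem HasLipschitzBoundary.exists_inward_translation (hΩ : IsOpen Ω)
    (hlip : HasLipschitzBoundary Ω) {x₀ : Euc d} (hx₀ : x₀ ∈ closure Ω) :
    ∃ r > 0, ∃ e : Euc d, ∃ c > 0, ∃ t₀ > 0, ∀ t ∈ Ioo 0 t₀, ∀ x ∈ Ω ∩ Metric.ball x₀ r,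
      Metric.closedBall (x + t • e) (c * t) ⊆ Ω := by
  by_cases hmem : x₀ ∈ Ω
  · obtain ⟨r, hr, hrΩ⟩ := Metric.isOpen_iff.1 hΩ x₀ hmem
    refine ⟨r / 2, by positivity, 0, 1, one_pos, r / 2, by positivity, fun t ht x hx y hy => ?_⟩
    refine hrΩ ?_
    have h1 := hx.2
    rw [Metric.mem_ball] at h1 ⊢
    rw [Metric.mem_closedBall, smul_zero, add_zero, one_mul] at hy
    linarith [dist_triangle y x x₀, ht.2]
  · have hfr : x₀ ∈ frontier Ω := ⟨hx₀, by rwa [hΩ.interior_eq]⟩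
    obtain ⟨e, he, R, hR, K, γ, hγ, hiff⟩ := hlip x₀ hfr
    -- `c` is chosen so small that a perturbation by `c t` changes the height above the graph of the
    -- `K`-Lipschitz function `γ` by at most `t / 2`
    have hK : (0 : ℝ) < 1 + K := by positivity
    refine ⟨R / 2, by positivity, e, (1 + (K : ℝ))⁻¹ / 2, by positivity, R / 4, by positivity,
      fun t ht x hx y hy => ?_⟩
    set c : ℝ := (1 + (K : ℝ))⁻¹ / 2 with hc
    have hc1 : c * (1 + K) = 1 / 2 := by rw [hc]; field_simp
    have hc0 : 0 < c := by positivity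
    have hcle : c ≤ 1 / 2 := by
      have : c * 1 ≤ c * (1 + K) := by gcongr; linarith [K.2]
      linarith
    set z := y - (x + t • e) with hz
    have hyz : y = x + t • e + z := by rw [hz]; abel
    have hzn : ‖z‖ ≤ c * t := by rwa [Metric.mem_closedBall, dist_eq_norm] at hy
    have hte : ‖t • e‖ = t := by rw [norm_smul, he, mul_one, Real.norm_of_nonneg ht.1.le]
    have hxb := hx.2
    rw [Metric.mem_ball] at hxb
    have hxR : x ∈ Metric.ball x₀ R := by rw [Metric.mem_ball]; linarith
    have hct : c * t ≤ 1 / 2 * t := by have := ht.1; gcongr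
    have hyR : y ∈ Metric.ball x₀ R := by
      rw [Metric.mem_ball]
      have h1 : dist y x ≤ t + c * t := by
        rw [dist_eq_norm, hyz]
        have : x + t • e + z - x = t • e + z := by abel
        rw [this]
        exact (norm_add_le _ _).trans (by rw [hte]; linarith)
      linarith [dist_triangle y x x₀, ht.2, ht.1]
    rw [hiff y hyR]
    have hxg := (hiff x hxR).1 hx.1
    have hye : inner ℝ e y = inner ℝ e x + t + inner ℝ e z := by
      rw [hyz, inner_add_right, inner_add_right, inner_smul_right, real_inner_self_eq_norm_sq, he]
      ring
    have hez : |inner ℝ e z| ≤ c * t := by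
      refine (abs_real_inner_le_norm e z).trans ?_
      rw [he, one_mul]; exact hzn
    have hproj : y - inner ℝ e y • e - (x - inner ℝ e x • e) = z - inner ℝ e z • e := by
      rw [hye, hyz]; module
    have hγle : γ (y - inner ℝ e y • e) ≤ γ (x - inner ℝ e x • e) + K * (c * t) := by
      have h1 := hγ.dist_le_mul (y - inner ℝ e y • e) (x - inner ℝ e x • e)
      rw [Real.dist_eq, dist_eq_norm, hproj] at h1
      have h2 : ‖z - inner ℝ e z • e‖ ≤ ‖z‖ := by
        have := (lipschitzWith_sub_inner_smul he).dist_le_mul z 0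
        simpa using this
      have h3 : (K : ℝ) * ‖z - inner ℝ e z • e‖ ≤ K * (c * t) := by
        gcongr
        exact h2.trans hzn
      linarith [le_abs_self (γ (y - inner ℝ e y • e) - γ (x - inner ℝ e x • e))]
    have h4 : K * (c * t) + c * t = 1 / 2 * t := by rw [← hc1]; ring
    have h5 := neg_abs_le (inner ℝ e z)
    linarith [ht.1]

variable {u : Euc d → ℝ} {g : Euc d → Euc d} {χ : Euc d → ℝ}

/-- Localization: the product of a Sobolev function on `Ω` with a cut-off function `χ`, extended by
zero, is weakly differentiable in the larger open set `Ω ∪ (supp χ)ᶜ`. -/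
theorem IsWeakGradient.indicator_mul (hΩ : IsOpen Ω) (h : IsWeakGradient Ω u g)
    (hu : MemLp u 2 (volume.restrict Ω)) (hg : MemLp g 2 (volume.restrict Ω))
    (hχ : ContDiff ℝ ∞ χ) (hχc : HasCompactSupport χ) :
    IsWeakGradient (Ω ∪ (tsupport χ)ᶜ) (Ω.indicator fun x => χ x * u x)
      (Ω.indicator fun x => χ x • g x + u x • gradient χ x) ∧
    MemLp (Ω.indicator fun x => χ x * u x) 2 volume ∧
    MemLp (Ω.indicator fun x => χ x • g x + u x • gradient χ x) 2 volume := by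
  have hχ1 : ContDiff ℝ 1 χ := hχ.of_le (by simp)
  have hgχ : Continuous (gradient χ) := continuous_gradient hχ1
  obtain ⟨C, -, hC⟩ := hχ.continuous.exists_norm_le_of_hasCompactSupport hχc
  obtain ⟨C', -, hC'⟩ := hgχ.exists_norm_le_of_hasCompactSupport
    ((hχc.fderiv (𝕜 := ℝ)).mono fun x hx => by
      contrapose! hx
      have : fderiv ℝ χ x = 0 := by simpa using hx
      simp [gradient, this])
  have hχtop : MemLp χ ⊤ (volume.restrict Ω) :=
    memLp_top_of_bound hχ.continuous.aestronglyMeasurable C (Eventually.of_forall hC)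
  have hgχtop : MemLp (gradient χ) ⊤ (volume.restrict Ω) :=
    memLp_top_of_bound hgχ.aestronglyMeasurable C' (Eventually.of_forall hC')
  have m1 : MemLp (Ω.indicator fun x => χ x * u x) 2 volume := by
    rw [memLp_indicator_iff_restrict hΩ.measurableSet]
    exact hu.smul (r := 2) hχtop
  have m2 : MemLp (Ω.indicator fun x => χ x • g x + u x • gradient χ x) 2 volume := by
    rw [memLp_indicator_iff_restrict hΩ.measurableSet]
    exact (hg.smul (r := 2) hχtop).add (hgχtop.smul (r := 2) hu)
  refine ⟨⟨(m1.locallyIntegrable (by norm_num)).locallyIntegrableOn _,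
    (m2.locallyIntegrable (by norm_num)).locallyIntegrableOn _, fun φ hφ hφc hφΩ i => ?_⟩, m1, m2⟩
  -- `χ φ` is an admissible test function in `Ω`
  have hprod := h.integral_eq (fun x => χ x * φ x) (hχ.mul hφ) (hφc.mul_left)
    (fun x hx => by
      have h1 := tsupport_mul_subset_left hx
      have h2 := hφΩ (tsupport_mul_subset_right hx)
      rcases h2 with h2 | h2
      · exact h2
      · exact absurd h1 h2) i
  have hdχ : ∀ x, DifferentiableAt ℝ χ x := hχ1.differentiable one_ne_zero
  have hdφ : ∀ x, DifferentiableAt ℝ φ x := hφ.differentiable (by simp)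
  have hderiv : ∀ x, fderiv ℝ (fun x => χ x * φ x) x (EuclideanSpace.single i 1) =
      χ x * fderiv ℝ φ x (EuclideanSpace.single i 1) + φ x * gradient χ x i := by
    intro x
    rw [fderiv_fun_mul (hdχ x) (hdφ x), gradient_apply]
    simp
  have hcφ' : Continuous fun x => fderiv ℝ φ x (EuclideanSpace.single i 1) :=
    ((contDiff_infty.1 hφ 1).continuous_fderiv one_ne_zero).clm_apply continuous_const
  have hφ2 : MemLp φ 2 (volume.restrict Ω) :=
    (hφ.continuous.memLp_of_hasCompactSupport hφc).restrict _
  have hφ2' : MemLp (fun x => fderiv ℝ φ x (EuclideanSpace.single i 1)) 2 (volume.restrict Ω) :=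
    (hcφ'.memLp_of_hasCompactSupport (hφc.fderiv_apply (𝕜 := ℝ) _)).restrict _
  have m1' := (memLp_indicator_iff_restrict hΩ.measurableSet).1 m1
  have i1 : Integrable (fun x => χ x * u x * fderiv ℝ φ x (EuclideanSpace.single i 1))
    (volume.restrict Ω) := m1'.integrable_mul (q := 2) hφ2'
  have hpi : ∀ {f : Euc d → Euc d}, MemLp f 2 (volume.restrict Ω) →
      MemLp (fun x => f x i) 2 (volume.restrict Ω) := fun hf =>
    (EuclideanSpace.proj (𝕜 := ℝ) i).comp_memLp' hf
  have i2 : Integrable (fun x => (u x • gradient χ x) i * φ x) (volume.restrict Ω) :=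
    (hpi (hgχtop.smul (r := 2) hu)).integrable_mul (q := 2) hφ2
  have i3 : Integrable (fun x => (χ x • g x) i * φ x) (volume.restrict Ω) :=
    (hpi (hg.smul (r := 2) hχtop)).integrable_mul (q := 2) hφ2
  have hsub : Ω ⊆ Ω ∪ (tsupport χ)ᶜ := subset_union_left
  have hmΩ' : MeasurableSet (Ω ∪ (tsupport χ)ᶜ) :=
    hΩ.measurableSet.union (isClosed_tsupport χ).measurableSet.compl
  have hL : ∀ (F : Euc d → ℝ) (G : Euc d → ℝ),
      ∫ x in Ω ∪ (tsupport χ)ᶜ, Ω.indicator F x * G x = ∫ x in Ω, F x * G x := by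
    intro F G
    rw [← integral_indicator hmΩ', ← integral_indicator hΩ.measurableSet]
    congr 1 with x
    by_cases hx : x ∈ Ω
    · simp [hx, hsub hx]
    · by_cases hx' : x ∈ Ω ∪ (tsupport χ)ᶜ
      · rw [indicator_of_mem hx', indicator_of_notMem hx, indicator_of_notMem hx, zero_mul]
      · rw [indicator_of_notMem hx', indicator_of_notMem hx]
  rw [hL]
  have hR : ∀ x, (Ω.indicator (fun x => χ x • g x + u x • gradient χ x) x) i * φ x =
      Ω.indicator (fun x => (χ x • g x) i + (u x • gradient χ x) i) x * φ x := by
    intro x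
    by_cases hx : x ∈ Ω <;> simp [hx]
  simp_rw [hR]
  rw [hL]
  have e1 : ∫ x in Ω, χ x * u x * fderiv ℝ φ x (EuclideanSpace.single i 1) =
      (∫ x in Ω, u x * fderiv ℝ (fun x => χ x * φ x) x (EuclideanSpace.single i 1)) -
        ∫ x in Ω, (u x • gradient χ x) i * φ x := by
    rw [eq_sub_iff_add_eq, ← integral_add i1 i2]
    congr 1 with x
    rw [hderiv, PiLp.smul_apply, smul_eq_mul]
    ring
  rw [e1, hprod]
  have e2 : ∫ x in Ω, ((χ x • g x) i + (u x • gradient χ x) i) * φ x =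
      (∫ x in Ω, (χ x • g x) i * φ x) + ∫ x in Ω, (u x • gradient χ x) i * φ x := by
    rw [← integral_add i3 i2]
    congr 1 with x
    ring
  rw [e2]
  have e3 : ∫ x in Ω, g x i * (χ x * φ x) = ∫ x in Ω, (χ x • g x) i * φ x := by
    congr 1 with x
    rw [PiLp.smul_apply, smul_eq_mul]; ring
  rw [e3]
  ring

/-- Small translations combined with mollification at a small scale are close to the identity in `L²`. -/
theorem exists_forall_mollify_translate_sub_le {F : Type*} [NormedAddCommGroup F] [NormedSpace ℝ F]
    [CompleteSpace F] {f : Euc d → F} (hf : MemLp f 2 volume) {η : ℝ≥0∞} (hη : 0 < η) :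
    ∃ δ₀ > 0, ∀ (φ : ContDiffBump (0 : Euc d)) (t : Euc d), φ.rOut ≤ δ₀ → ‖t‖ ≤ δ₀ →
      eLpNorm (fun x => mollify φ f (x + t) - f x) 2 volume ≤ η := by
  have hη2 : 0 < η / 2 := ENNReal.half_pos hη.ne'
  obtain ⟨δ₁, hδ₁, h1⟩ := exists_forall_mollify_sub_le hf hη2
  obtain ⟨δ₂, hδ₂, h2⟩ := Metric.eventually_nhds_iff.1
    (ENNReal.tendsto_nhds_zero.1 (tendsto_eLpNorm_translate_sub (by norm_num) (by norm_num) hf)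
      (η / 2) hη2)
  refine ⟨min δ₁ (δ₂ / 2), by positivity, fun φ t hφ ht => ?_⟩
  have hmol : AEStronglyMeasurable (mollify φ f) volume :=
    (contDiff_mollify φ (hf.locallyIntegrable (by norm_num))).continuous.aestronglyMeasurable
  have hmp : MeasurePreserving (fun x : Euc d => x + t) volume volume :=
    measurePreserving_add_right volume t
  have hshift : eLpNorm (fun x => mollify φ f (x + t) - f (x + t)) 2 volume ≤ η / 2 := by
    refine le_trans (le_of_eq ?_) (h1 φ (hφ.trans (min_le_left _ _)))
    exact eLpNorm_comp_measurePreserving (p := 2) (g := fun x => mollify φ f x - f x)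
      (hmol.sub hf.1) hmp
  have htr : eLpNorm (fun x => f (x + t) - f x) 2 volume ≤ η / 2 := by
    refine h2 ?_
    rw [dist_zero_right]
    have := min_le_right δ₁ (δ₂ / 2)
    linarith
  have hfs : AEStronglyMeasurable (fun x => f (x + t)) volume :=
    hf.1.comp_measurePreserving hmp
  have hms : AEStronglyMeasurable (fun x => mollify φ f (x + t)) volume :=
    hmol.comp_measurePreserving hmp
  calc eLpNorm (fun x => mollify φ f (x + t) - f x) 2 volume
      = eLpNorm ((fun x => mollify φ f (x + t) - f (x + t)) +
          fun x => f (x + t) - f x) 2 volume := by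
        congr 1 with x
        simp
    _ ≤ η / 2 + η / 2 := (eLpNorm_add_le (hms.sub hfs) (hfs.sub hf.1) (by norm_num)).trans
        (add_le_add hshift htr)
    _ = η := ENNReal.add_halves η

theorem HasCompactSupport.mollify {F : Type*} [NormedAddCommGroup F] [NormedSpace ℝ F]
    {f : Euc d → F} (hf : HasCompactSupport f) (φ : ContDiffBump (0 : Euc d)) :
    HasCompactSupport (mollify φ f) :=
  φ.hasCompactSupport_normed.convolution _ hf

/-- A Sobolev function localized near a point of the closure can be approximated by smooth
functions: extend it by zero, translate it inside and mollify. -/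
theorem exists_smooth_approx_local (hΩ : IsOpen Ω) (h : IsWeakGradient Ω u g)
    (hu : MemLp u 2 (volume.restrict Ω)) (hg : MemLp g 2 (volume.restrict Ω))
    (hχ : ContDiff ℝ ∞ χ) (hχc : HasCompactSupport χ) {x₀ : Euc d} {r : ℝ}
    (hχr : tsupport χ ⊆ Metric.ball x₀ r) {e : Euc d} {c t₀ : ℝ} (hc : 0 < c) (ht₀ : 0 < t₀)
    (hpush : ∀ t ∈ Ioo 0 t₀, ∀ x ∈ Ω ∩ Metric.ball x₀ r,
      Metric.closedBall (x + t • e) (c * t) ⊆ Ω) {η : ℝ≥0∞} (hη : 0 < η) :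
    ∃ w : Euc d → ℝ, ContDiff ℝ ∞ w ∧ HasCompactSupport w ∧
      eLpNorm (fun x => w x - χ x * u x) 2 (volume.restrict Ω) ≤ η ∧
      eLpNorm (fun x => gradient w x - (χ x • g x + u x • gradient χ x)) 2
        (volume.restrict Ω) ≤ η := by
  obtain ⟨hw, m1, m2⟩ := h.indicator_mul hΩ hu hg hχ hχc
  set f := Ω.indicator fun x => χ x * u x with hf
  set G := Ω.indicator fun x => χ x • g x + u x • gradient χ x with hG
  obtain ⟨δ₁, hδ₁, h1⟩ := exists_forall_mollify_translate_sub_le m1 hη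
  obtain ⟨δ₂, hδ₂, h2⟩ := exists_forall_mollify_translate_sub_le m2 hη
  obtain ⟨δ₃, hδ₃, h3⟩ := hχc.isCompact.exists_thickening_subset_open Metric.isOpen_ball hχr
  -- a translation parameter small enough for all the requirements
  obtain ⟨t, ht0, htt, hte, htδ⟩ : ∃ t : ℝ, 0 < t ∧ t < t₀ ∧ t * ‖e‖ + c * t < δ₃ ∧
      (c * t ≤ min δ₁ δ₂ ∧ t * ‖e‖ ≤ min δ₁ δ₂) := by
    have hpos : 0 < min δ₁ δ₂ := lt_min hδ₁ hδ₂
    have lim_sum : Tendsto (fun t : ℝ => t * ‖e‖ + c * t) (𝓝[>] 0) (𝓝 0) :=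
      ((by fun_prop : Continuous fun t : ℝ => t * ‖e‖ + c * t).tendsto' 0 0 (by simp)).mono_left
        nhdsWithin_le_nhds
    have lim_scale : Tendsto (fun t : ℝ => c * t) (𝓝[>] 0) (𝓝 0) :=
      ((by fun_prop : Continuous fun t : ℝ => c * t).tendsto' 0 0 (by simp)).mono_left
        nhdsWithin_le_nhds
    have lim_norm : Tendsto (fun t : ℝ => t * ‖e‖) (𝓝[>] 0) (𝓝 0) :=
      ((by fun_prop : Continuous fun t : ℝ => t * ‖e‖).tendsto' 0 0 (by simp)).mono_left
        nhdsWithin_le_nhds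
    have hsmall : ∀ᶠ t in 𝓝[>] (0 : ℝ), t ∈ Ioo 0 t₀ := Ioo_mem_nhdsGT ht₀
    obtain ⟨t, h1, h2, h3, h4⟩ := (hsmall.and
      ((lim_sum.eventually (gt_mem_nhds hδ₃)).and ((lim_scale.eventually (gt_mem_nhds hpos)).and
        (lim_norm.eventually (gt_mem_nhds hpos))))).exists
    exact ⟨t, h1.1, h1.2, h2, h3.le, h4.le⟩
  have hct : 0 < c * t := by positivity
  let φ := bumpOfRadius d hct
  have hφ : φ.rOut = c * t := rfl
  have hnorm : ‖t • e‖ = t * ‖e‖ := by rw [norm_smul, Real.norm_of_nonneg ht0.le]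
  have hfl : LocallyIntegrable f := m1.locallyIntegrable (by norm_num)
  have hGl : LocallyIntegrable G := m2.locallyIntegrable (by norm_num)
  have hfc : HasCompactSupport f := hχc.mono fun x hx => by
    contrapose! hx
    have : χ x = 0 := by simpa using hx
    simp [hf, this]
  have hgrad : ∀ x ∈ Ω,
      gradient (fun x => mollify φ f (x + t • e)) x = mollify φ G (x + t • e) := by
    intro x hx
    -- where the mollification kernel leaves `Ω`, the cut-off function vanishes
    have hball : Metric.closedBall (x + t • e) φ.rOut ⊆ Ω ∪ (tsupport χ)ᶜ := by
      by_cases hxr : x ∈ Metric.ball x₀ r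
      · exact (hpush t ⟨ht0, htt⟩ x ⟨hx, hxr⟩).trans subset_union_left
      · refine Subset.trans (fun y hy => ?_) subset_union_right
        intro hyχ
        refine hxr (h3 (Metric.mem_thickening_iff.2 ⟨y, hyχ, ?_⟩))
        rw [Metric.mem_closedBall, hφ] at hy
        have h4 : dist x (x + t • e) = t * ‖e‖ := by rw [dist_self_add_right, hnorm]
        have h5 := dist_triangle x (x + t • e) y
        rw [dist_comm (x + t • e) y] at h5
        linarith
    have hind : ∀ {F : Type} [AddCommMonoid F] (p : Euc d → F),
        (Ω ∪ (tsupport χ)ᶜ).indicator (Ω.indicator p) = Ω.indicator p := fun p => by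
      rw [indicator_indicator, inter_eq_right.2 subset_union_left]
    have hmΩ' : MeasurableSet (Ω ∪ (tsupport χ)ᶜ) :=
      hΩ.measurableSet.union (isClosed_tsupport χ).measurableSet.compl
    ext i
    rw [gradient_apply, fderiv_comp_add_right]
    have h6 := hw.fderiv_mollify_apply hmΩ' (by rw [hf, hind]; exact hfl)
      (by rw [hG, hind]; exact hGl) φ hball i
    rw [hf, hG, hind, hind] at h6
    exact h6
  refine ⟨fun x => mollify φ f (x + t • e), (contDiff_mollify φ hfl).comp (by fun_prop),
    (hfc.mollify φ).comp_homeomorph (Homeomorph.addRight (t • e)), ?_, ?_⟩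
  · refine le_trans (le_trans (le_of_eq ?_) (eLpNorm_mono_measure _
      (Measure.restrict_le_self (s := Ω))))
      (h1 φ (t • e) (htδ.1.trans (min_le_left _ _))
        (by rw [hnorm]; exact htδ.2.trans (min_le_left _ _)))
    refine eLpNorm_congr_ae ?_
    filter_upwards [ae_restrict_mem hΩ.measurableSet] with x hx
    rw [hf, indicator_of_mem hx]
  · refine le_trans (le_trans (le_of_eq ?_) (eLpNorm_mono_measure _
      (Measure.restrict_le_self (s := Ω))))
      (h2 φ (t • e) (htδ.1.trans (min_le_right _ _))
        (by rw [hnorm]; exact htδ.2.trans (min_le_right _ _)))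
    refine eLpNorm_congr_ae ?_
    filter_upwards [ae_restrict_mem hΩ.measurableSet] with x hx
    rw [hgrad x hx, hG, indicator_of_mem hx]

/-- In a bounded Lipschitz domain, smooth functions on the whole space are dense in `W^{1,2}`. -/
theorem exists_smooth_approx (hΩ : IsOpen Ω) (hΩb : Bornology.IsBounded Ω)
    (hlip : HasLipschitzBoundary Ω) (h : IsWeakGradient Ω u g)
    (hu : MemLp u 2 (volume.restrict Ω)) (hg : MemLp g 2 (volume.restrict Ω)) {η : ℝ≥0∞}
    (hη : 0 < η) :
    ∃ w : Euc d → ℝ, ContDiff ℝ ∞ w ∧ HasCompactSupport w ∧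
      eLpNorm (fun x => w x - u x) 2 (volume.restrict Ω) ≤ η ∧
      eLpNorm (fun x => gradient w x - g x) 2 (volume.restrict Ω) ≤ η := by
  have hK : IsCompact (closure Ω) := hΩb.isCompact_closure
  have hloc := fun x₀ : closure Ω => hlip.exists_inward_translation hΩ x₀.2
  choose r hr e c hc t₀ ht₀ hpush using hloc
  obtain ⟨F, hF⟩ := hK.elim_finite_subcover (fun x₀ : closure Ω => Metric.ball (x₀ : Euc d) (r x₀))
    (fun _ => Metric.isOpen_ball) fun x hx =>
      mem_iUnion.2 ⟨⟨x, hx⟩, Metric.mem_ball_self (hr ⟨x, hx⟩)⟩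
  obtain ⟨ρ, hρ⟩ := SmoothPartitionOfUnity.exists_isSubordinate
    (modelWithCornersSelf ℝ (Euc d)) isClosed_closure
    (fun i : F => Metric.ball ((i : closure Ω) : Euc d) (r i)) (fun _ => Metric.isOpen_ball)
    (fun x hx => by
      obtain ⟨i, hi, hxi⟩ := mem_iUnion₂.1 (hF hx)
      exact mem_iUnion.2 ⟨⟨i, hi⟩, hxi⟩)
  have hχ : ∀ i, ContDiff ℝ ∞ (ρ i) := fun i => (ρ i).contMDiff.contDiff
  have hχc : ∀ i, HasCompactSupport (ρ i) := fun i =>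
    Metric.isCompact_of_isClosed_isBounded (isClosed_tsupport _)
      (Metric.isBounded_ball.subset (hρ i))
  have hχd : ∀ i x, DifferentiableAt ℝ (ρ i) x := fun i => (hχ i).differentiable (by simp)
  have hsum : ∀ x ∈ Ω, ∑ i, ρ i x = 1 := fun x hx => by
    have := ρ.sum_eq_one (subset_closure hx)
    rwa [finsum_eq_sum_of_fintype] at this
  -- so that the terms with derivatives of the partition cancel
  have hgsum : ∀ x ∈ Ω, ∑ i, gradient (ρ i) x = 0 := fun x hx => by
    have h1 : fderiv ℝ (fun x => ∑ i, ρ i x) x = 0 := by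
      have : (fun x => ∑ i, ρ i x) =ᶠ[𝓝 x] fun _ => (1 : ℝ) :=
        eventually_of_mem (hΩ.mem_nhds hx) hsum
      rw [this.fderiv_eq, fderiv_fun_const]
      rfl
    rw [fderiv_fun_sum fun i _ => hχd i x] at h1
    ext k
    have h2 := congrArg (fun L => L (EuclideanSpace.single k 1)) h1
    simp only [sum_apply, zero_apply] at h2
    rw [WithLp.ofLp_sum, Finset.sum_apply]
    simp_rw [gradient_apply]
    exact h2
  -- distribute the tolerance over the pieces of the partition
  set N : ℝ≥0∞ := ((F.card + 1 : ℕ) : ℝ≥0∞) with hN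
  have hη' : 0 < η / N := ENNReal.div_pos hη.ne' (ENNReal.natCast_ne_top _)
  choose w hw hwc hw1 hw2 using fun i : F => exists_smooth_approx_local hΩ h hu hg (hχ i) (hχc i)
    (hρ i) (hc i) (ht₀ i) (hpush i) hη'
  have hcard : ∑ _i : F, η / N ≤ η := by
    rw [Finset.sum_const, nsmul_eq_mul, Finset.card_univ, Fintype.card_coe]
    calc (F.card : ℝ≥0∞) * (η / N) ≤ N * (η / N) := by
          gcongr
          rw [hN]
          exact_mod_cast Nat.le_succ _
      _ ≤ η := ENNReal.mul_div_le
  have hwd : ∀ i x, DifferentiableAt ℝ (w i) x := fun i => (hw i).differentiable (by simp)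
  refine ⟨fun x => ∑ i, w i x, ContDiff.sum fun i _ => hw i, ?_, ?_, ?_⟩
  · have : (fun x => ∑ i, w i x) = ∑ i, w i := by ext x; simp
    rw [this]
    exact Finset.sum_induction _ HasCompactSupport (fun _ _ ha hb => ha.add hb)
      HasCompactSupport.zero fun i _ => hwc i
  · have heq : (fun x => (∑ i, w i x) - u x) =ᵐ[volume.restrict Ω]
        ∑ i, fun x => w i x - ρ i x * u x := by
      filter_upwards [ae_restrict_mem hΩ.measurableSet] with x hx
      rw [Finset.sum_apply, Finset.sum_sub_distrib, ← Finset.sum_mul, hsum x hx, one_mul]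
    rw [eLpNorm_congr_ae heq]
    refine (eLpNorm_sum_le (fun i _ => (hw i).continuous.aestronglyMeasurable.sub
      ((hχ i).continuous.aestronglyMeasurable.mul hu.1)) (by norm_num)).trans
      ((Finset.sum_le_sum fun i _ => hw1 i).trans hcard)
  · have heq : (fun x => gradient (fun x => ∑ i, w i x) x - g x) =ᵐ[volume.restrict Ω]
        ∑ i, fun x => gradient (w i) x - (ρ i x • g x + u x • gradient (ρ i) x) := by
      filter_upwards [ae_restrict_mem hΩ.measurableSet] with x hx
      have h1 : gradient (fun x => ∑ i, w i x) x = ∑ i, gradient (w i) x := by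
        simp only [gradient]
        rw [fderiv_fun_sum fun i _ => hwd i x, map_sum]
      rw [h1, Finset.sum_apply, Finset.sum_sub_distrib, Finset.sum_add_distrib, ← Finset.sum_smul,
        hsum x hx, ← Finset.smul_sum, hgsum x hx, one_smul, smul_zero, add_zero]
    rw [eLpNorm_congr_ae heq]
    refine (eLpNorm_sum_le (fun i _ => ?_) (by norm_num)).trans
      ((Finset.sum_le_sum fun i _ => hw2 i).trans hcard)
    exact (continuous_gradient ((hw i).of_le (by simp))).aestronglyMeasurable.sub
      (((hχ i).continuous.aestronglyMeasurable.smul hg.1).add (hu.1.smul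
        (continuous_gradient ((hχ i).of_le (by simp))).aestronglyMeasurable))

end Density

/-! ### Upper bounds for the `Γ`-upper limit -/

section GammaLimsup

variable {X : Type*} [PseudoEMetricSpace X] {F : ℕ → X → ℝ≥0∞}

/-- The `Γ`-upper limit of the sequence `F` at `x` is at most `ℓ`. -/
def GammaLimsupLE (F : ℕ → X → ℝ≥0∞) (x : X) (ℓ : ℝ≥0∞) : Prop :=
  ∀ κ > 0, ∀ᶠ j in atTop, ∃ y, edist y x < κ ∧ F j y ≤ ℓ + κ

/-- A sequence converging to `x` along which the values have upper limit `ℓ₀` bounds the `Γ`-upper limit. -/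
theorem GammaLimsupLE.of_tendsto {y : ℕ → X} {x : X} {ℓ : ℕ → ℝ≥0∞} {ℓ₀ : ℝ≥0∞}
    (hy : Tendsto y atTop (𝓝 x)) (hℓ : Tendsto ℓ atTop (𝓝 ℓ₀)) (hℓ₀ : ℓ₀ ≠ ⊤)
    (h : ∀ᶠ j in atTop, F j (y j) ≤ ℓ j) : GammaLimsupLE F x ℓ₀ := by
  intro κ hκ
  have h1 : ∀ᶠ j in atTop, edist (y j) x < κ :=
    (tendsto_iff_edist_tendsto_0.1 hy).eventually (gt_mem_nhds hκ)
  have h2 : ∀ᶠ j in atTop, ℓ j < ℓ₀ + κ :=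
    hℓ.eventually (gt_mem_nhds (ENNReal.lt_add_right hℓ₀ hκ.ne'))
  filter_upwards [h, h1, h2] with j h h1 h2
  exact ⟨y j, h1, h.trans h2.le⟩

/-- The `Γ`-upper limit is lower semicontinuous. -/
theorem GammaLimsupLE.of_forall {y : ℕ → X} {x : X} {ℓ : ℕ → ℝ≥0∞} {ℓ₀ : ℝ≥0∞}
    (hy : Tendsto y atTop (𝓝 x)) (hℓ : Tendsto ℓ atTop (𝓝 ℓ₀)) (hℓ₀ : ℓ₀ ≠ ⊤)
    (h : ∀ n, GammaLimsupLE F (y n) (ℓ n)) : GammaLimsupLE F x ℓ₀ := by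
  intro κ hκ
  have hκ2 : 0 < κ / 2 := ENNReal.half_pos hκ.ne'
  have h1 : ∀ᶠ j in atTop, edist (y j) x < κ / 2 :=
    (tendsto_iff_edist_tendsto_0.1 hy).eventually (gt_mem_nhds hκ2)
  have h2 : ∀ᶠ j in atTop, ℓ j < ℓ₀ + κ / 2 :=
    hℓ.eventually (gt_mem_nhds (ENNReal.lt_add_right hℓ₀ hκ2.ne'))
  obtain ⟨n, h1, h2⟩ := (h1.and h2).exists
  filter_upwards [h n (κ / 2) hκ2] with j hj
  obtain ⟨z, hz, hzF⟩ := hj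
  refine ⟨z, (edist_triangle z (y n) x).trans_lt ?_, ?_⟩
  · rw [← ENNReal.add_halves κ]
    exact ENNReal.add_lt_add hz h1
  · calc F j z ≤ ℓ n + κ / 2 := hzF
      _ ≤ ℓ₀ + κ / 2 + κ / 2 := by gcongr
      _ = ℓ₀ + κ := by rw [add_assoc, ENNReal.add_halves]

/-- A bound of the `Γ`-upper limit is realized by a sequence: nearly minimize the larger of the distance
to `x` and the excess of `F j` over `ℓ`. -/
theorem GammaLimsupLE.exists_recovery {x : X} {ℓ : ℝ≥0∞} (h : GammaLimsupLE F x ℓ) :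
    ∃ v : ℕ → X, Tendsto v atTop (𝓝 x) ∧ limsup (fun j => F j (v j)) atTop ≤ ℓ := by
  let G : ℕ → X → ℝ≥0∞ := fun j y => max (edist y x) (F j y - ℓ)
  have hinf : Tendsto (fun j => ⨅ y, G j y) atTop (𝓝 0) := by
    refine ENNReal.tendsto_nhds_zero.2 fun κ hκ => ?_
    filter_upwards [h κ hκ] with j hj
    obtain ⟨y, hy, hyF⟩ := hj
    exact (iInf_le _ y).trans (max_le hy.le (tsub_le_iff_left.2 hyF))
  have hx : Nonempty X := ⟨x⟩
  have hch : ∀ j, ∃ y, G j y ≤ (⨅ y, G j y) + ((j : ℝ≥0∞) + 1)⁻¹ := by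
    intro j
    rcases eq_or_ne (⨅ y, G j y) ⊤ with htop | htop
    · exact ⟨x, by rw [htop, top_add]; exact le_top⟩
    · obtain ⟨y, hy⟩ := iInf_lt_iff.1 (ENNReal.lt_add_right htop
        (ENNReal.inv_ne_zero.2
          (ENNReal.add_ne_top.2 ⟨ENNReal.natCast_ne_top j, ENNReal.one_ne_top⟩)))
      exact ⟨y, hy.le⟩
  choose v hv using hch
  have hlim : Tendsto (fun j : ℕ => (⨅ y, G j y) + ((j : ℝ≥0∞) + 1)⁻¹) atTop (𝓝 0) := by
    have h1 : Tendsto (fun j : ℕ => ((j : ℝ≥0∞) + 1)⁻¹) atTop (𝓝 0) := by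
      have := (tendsto_add_atTop_iff_nat 1).2 ENNReal.tendsto_inv_nat_nhds_zero
      simpa using this
    simpa using hinf.add h1
  refine ⟨v, ?_, ?_⟩
  · rw [tendsto_iff_edist_tendsto_0]
    exact tendsto_of_tendsto_of_tendsto_of_le_of_le tendsto_const_nhds hlim (fun _ => bot_le)
      fun j => (le_max_left _ _).trans (hv j)
  · have h2 : Tendsto (fun j : ℕ => ℓ + ((⨅ y, G j y) + ((j : ℝ≥0∞) + 1)⁻¹)) atTop (𝓝 ℓ) := by
      simpa using tendsto_const_nhds.add hlim
    rw [← h2.limsup_eq]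
    refine limsup_le_limsup (Eventually.of_forall fun j => ?_)
    calc F j (v j) ≤ ℓ + (F j (v j) - ℓ) := le_add_tsub
      _ ≤ _ := add_le_add le_rfl ((le_max_right _ _).trans (hv j))

end GammaLimsup

/-! ### Energy of smooth functions -/

/-- The energy of a function whose increments are controlled by a vector field `X`: the quadratic term
contributes the local energy of `X`, and the other terms the second and fourth moments of the kernel,
cut off at a distance `R` exceeding the diameter of `Ω`. -/
theorem gagliardoEnergy_le {d : ℕ} (hd : 1 ≤ d) {Ω : Set (Euc d)}
    {a : Euc d → ℝ} (ha0 : ∀ x, 0 ≤ a x) {ε s R : ℝ} (hs : s < 1)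
    (hR0 : 0 ≤ R) (hR : ∀ x ∈ Ω, ∀ y ∈ Ω, ‖x - y‖ < R) (hΩ : MeasurableSet Ω) {v : Euc d → ℝ}
    {X : Euc d → Euc d} {A B D : ℝ} (hA : 0 ≤ A) (hB : 0 ≤ B) (hD : 0 ≤ D)
    (hT : ∀ x ξ, (v (x + ξ) - v x) ^ 2 ≤ A * inner ℝ (X x) ξ ^ 2 + B * ‖ξ‖ ^ 2 + D * ‖ξ‖ ^ 4)
    (hint : IntegrableOn (fun x => a (ε⁻¹ • x) * ‖X x‖ ^ 2) Ω)
    (hint' : IntegrableOn (fun x => a (ε⁻¹ • x)) Ω) :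
    gagliardoEnergy Ω a ε s v ≤ ENNReal.ofReal
      (sphereArea d / (2 * d) * R ^ (2 - 2 * s) * A * (∫ x in Ω, a (ε⁻¹ • x) * ‖X x‖ ^ 2) +
        (sphereArea d / 2 * R ^ (2 - 2 * s) * B +
          sphereArea d * ((1 - s) / (4 - 2 * s) * R ^ (4 - 2 * s)) * D) *
            ∫ x in Ω, a (ε⁻¹ • x)) := by
  set K := truncatedKernel d s 0 R with hK
  have hK0 : ∀ t, 0 ≤ K t := truncatedKernel_nonneg d hs le_rfl
  have hKm : Measurable K := measurable_truncatedKernel d s 0 R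
  have i2 : Integrable fun ξ : Euc d => K ‖ξ‖ * ‖ξ‖ ^ 2 :=
    integrable_truncatedKernel_mul_norm_pow hd hs le_rfl
  have i4 : Integrable fun ξ : Euc d => K ‖ξ‖ * ‖ξ‖ ^ 4 :=
    integrable_truncatedKernel_mul_norm_pow hd hs (by norm_num)
  have v2 : ∫ ξ : Euc d, K ‖ξ‖ * ‖ξ‖ ^ 2 = sphereArea d / 2 * R ^ (2 - 2 * s) := by
    rw [hK, integral_truncatedKernel_mul_norm_pow hd hs le_rfl hR0 le_rfl]
    have h2 : (1 - s) / (((2 : ℕ) : ℝ) - 2 * s) = 1 / 2 := by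
      push_cast
      rw [div_eq_div_iff (by linarith) (by norm_num)]
      ring
    rw [h2, Real.zero_rpow (by push_cast; linarith)]
    push_cast
    ring
  have v4 : ∫ ξ : Euc d, K ‖ξ‖ * ‖ξ‖ ^ 4 =
      sphereArea d * ((1 - s) / (4 - 2 * s) * R ^ (4 - 2 * s)) := by
    rw [hK, integral_truncatedKernel_mul_norm_pow hd hs le_rfl hR0 (by norm_num),
      Real.zero_rpow (by push_cast; linarith)]
    push_cast
    ring
  set M4 := sphereArea d * ((1 - s) / (4 - 2 * s) * R ^ (4 - 2 * s))
  set M2 := sphereArea d / 2 * R ^ (2 - 2 * s) with hM2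
  -- the inner integral of the bound
  have hinner : ∀ x, ∫⁻ ξ : Euc d, ENNReal.ofReal (a (ε⁻¹ • x) * (K ‖ξ‖ *
      (A * inner ℝ (X x) ξ ^ 2 + B * ‖ξ‖ ^ 2 + D * ‖ξ‖ ^ 4))) =
      ENNReal.ofReal (a (ε⁻¹ • x) * (A * (M2 / d * ‖X x‖ ^ 2) + B * M2 + D * M4)) := by
    intro x
    have j1 : Integrable fun ξ : Euc d => A * (K ‖ξ‖ * inner ℝ (X x) ξ ^ 2) := by
      have := integrable_radial_mul_inner_mul_inner i2 hKm (X x) (X x)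
      simpa [sq] using this.const_mul A
    have j2 : Integrable fun ξ : Euc d => B * (K ‖ξ‖ * ‖ξ‖ ^ 2) := i2.const_mul B
    have j4 : Integrable fun ξ : Euc d => D * (K ‖ξ‖ * ‖ξ‖ ^ 4) := i4.const_mul D
    have j12 : Integrable fun ξ : Euc d => A * (K ‖ξ‖ * inner ℝ (X x) ξ ^ 2) +
      B * (K ‖ξ‖ * ‖ξ‖ ^ 2) := j1.add j2
    have heq : ∀ ξ : Euc d, a (ε⁻¹ • x) * (K ‖ξ‖ *
        (A * inner ℝ (X x) ξ ^ 2 + B * ‖ξ‖ ^ 2 + D * ‖ξ‖ ^ 4)) =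
        a (ε⁻¹ • x) * (A * (K ‖ξ‖ * inner ℝ (X x) ξ ^ 2) +
      B * (K ‖ξ‖ * ‖ξ‖ ^ 2) + D * (K ‖ξ‖ * ‖ξ‖ ^ 4)) := fun ξ => by ring
    have j : Integrable fun ξ : Euc d => a (ε⁻¹ • x) * (A * (K ‖ξ‖ * inner ℝ (X x) ξ ^ 2) +
      B * (K ‖ξ‖ * ‖ξ‖ ^ 2) + D * (K ‖ξ‖ * ‖ξ‖ ^ 4)) := (j12.add j4).const_mul _
    simp_rw [heq]
    rw [← ofReal_integral_eq_lintegral_ofReal j]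
    · rw [integral_const_mul, integral_add j12 j4, integral_add j1 j2, integral_const_mul,
        integral_const_mul, integral_const_mul, integral_radial_mul_inner_sq hd hKm i2, v2, v4]
    · refine Eventually.of_forall fun ξ => ?_
      have := ha0 (ε⁻¹ • x)
      have := hK0 ‖ξ‖
      simp only [Pi.zero_apply]
      positivity
  have hσ := (sphereArea_pos hd).le
  have hM20 : 0 ≤ M2 := by
    rw [← v2]
    exact integral_nonneg fun ξ => mul_nonneg (hK0 _) (by positivity)
  have hM40 : 0 ≤ M4 := by
    rw [← v4]
    exact integral_nonneg fun ξ => mul_nonneg (hK0 _) (by positivity)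
  calc gagliardoEnergy Ω a ε s v
      ≤ ∫⁻ x in Ω, ENNReal.ofReal (a (ε⁻¹ • x) * (A * (M2 / d * ‖X x‖ ^ 2) + B * M2 + D * M4)) := by
        rw [gagliardoEnergy, ← lintegral_const_mul' _ _ ENNReal.ofReal_ne_top]
        refine setLIntegral_mono' hΩ fun x hx => ?_
        rw [← hinner, ← lintegral_const_mul' _ _ ENNReal.ofReal_ne_top,
          ← lintegral_add_right_eq_self (fun ξ => ENNReal.ofReal (a (ε⁻¹ • x) * (K ‖ξ‖ *
            (A * inner ℝ (X x) ξ ^ 2 + B * ‖ξ‖ ^ 2 + D * ‖ξ‖ ^ 4)))) (-x)]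
        refine le_trans (setLIntegral_mono' hΩ (g := fun y => ENNReal.ofReal (a (ε⁻¹ • x) *
          (K ‖y + -x‖ * (A * inner ℝ (X x) (y + -x) ^ 2 + B * ‖y + -x‖ ^ 2 + D * ‖y + -x‖ ^ 4))))
            fun y hy => ?_) (setLIntegral_le_lintegral _ _)
        rw [← ENNReal.ofReal_mul (by linarith)]
        refine ENNReal.ofReal_le_ofReal ?_
        have h0 := ha0 (ε⁻¹ • x)
        rcases eq_or_ne x y with rfl | hxy
        · simp
        · have hmem : ‖y + -x‖ ∈ Ioo 0 R := by
            rw [← sub_eq_add_neg]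
            exact ⟨norm_pos_iff.2 (sub_ne_zero.2 hxy.symm), hR y hy x hx⟩
          have hT' := hT x (y + -x)
          rw [add_neg_cancel_comm_assoc] at hT'
          have hsq : |v x - v y| ^ 2 = (v y - v x) ^ 2 := by rw [sq_abs]; ring
          have hn : ‖x - y‖ = ‖y + -x‖ := by rw [norm_sub_rev, sub_eq_add_neg]
          rw [hK, truncatedKernel, indicator_of_mem hmem, hsq, hn]
          have hp : 0 < ‖y + -x‖ ^ ((d : ℝ) + 2 * s) := Real.rpow_pos_of_pos hmem.1 _
          have h1s : 0 ≤ 1 - s := by linarith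
          calc (1 - s) * (a (ε⁻¹ • x) * ((v y - v x) ^ 2 / ‖y + -x‖ ^ ((d : ℝ) + 2 * s)))
              = a (ε⁻¹ • x) * ((1 - s) / ‖y + -x‖ ^ ((d : ℝ) + 2 * s) * (v y - v x) ^ 2) := by ring
            _ ≤ _ := by gcongr
    _ = ENNReal.ofReal (∫ x in Ω, a (ε⁻¹ • x) *
          (A * (M2 / d * ‖X x‖ ^ 2) + B * M2 + D * M4)) := by
        rw [ofReal_integral_eq_lintegral_ofReal]
        · refine ((hint.const_mul (A * (M2 / d))).add (hint'.const_mul (B * M2 + D * M4))).congr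
            (Eventually.of_forall fun x => ?_)
          simp only [Pi.add_apply]
          ring
        · refine Eventually.of_forall fun x => ?_
          have := ha0 (ε⁻¹ • x)
          simp only [Pi.zero_apply]
          positivity
    _ = _ := by
        congr 1
        have heq : ∀ x, a (ε⁻¹ • x) * (A * (M2 / d * ‖X x‖ ^ 2) + B * M2 + D * M4) =
            A * (M2 / d) * (a (ε⁻¹ • x) * ‖X x‖ ^ 2) + (B * M2 + D * M4) * a (ε⁻¹ • x) :=
          fun x => by ring
        simp_rw [heq]
        rw [integral_add (hint.const_mul _) (hint'.const_mul _), integral_const_mul,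
          integral_const_mul, hM2]
        ring

/-! ### Recovery sequences for smooth functions -/

section Recovery

variable {d : ℕ}

theorem contDiff_gradient {w : Euc d → ℝ} (hw : ContDiff ℝ ∞ w) : ContDiff ℝ ∞ (gradient w) :=
  (LinearIsometryEquiv.contDiff _).comp (hw.fderiv_right (m := ∞) (by simp))

theorem hasCompactSupport_gradient {w : Euc d → ℝ} (hwc : HasCompactSupport w) :
    HasCompactSupport (gradient w) :=
  (hwc.fderiv ℝ).comp_left (map_zero _)

/-- The first two terms `w(x) + ε ∑ i, ∂_i w(x) ψ_i(x / ε)` of the two-scale expansion. -/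
noncomputable def twoScaleExpansion (w : Euc d → ℝ) (ψ : Fin d → Euc d → ℝ) (ε : ℝ) (x : Euc d) :
    ℝ := w x + ε * ∑ i, gradient w x i * ψ i (ε⁻¹ • x)

/-- The field `e_i + ∇ψ` in which a periodic corrector `ψ` modifies the `i`-th direction. -/
noncomputable def correctedDirection (ψ : Fin d → Euc d → ℝ) (i : Fin d) (y : Euc d) : Euc d :=
  EuclideanSpace.single i 1 + gradient (ψ i) y

variable {w : Euc d → ℝ} {ψ : Fin d → Euc d → ℝ}

theorem continuous_twoScaleExpansion (hw : ContDiff ℝ ∞ w) (hψ : ∀ i, ContDiff ℝ ∞ (ψ i)) (ε : ℝ) :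
    Continuous (twoScaleExpansion w ψ ε) := by
  have h1 := (contDiff_gradient hw).continuous
  have h2 := hw.continuous
  have h3 := fun i => (hψ i).continuous
  unfold twoScaleExpansion
  fun_prop

theorem continuous_correctedDirection (hψ : ∀ i, ContDiff ℝ ∞ (ψ i)) (i : Fin d) :
    Continuous (correctedDirection ψ i) :=
  continuous_const.add (continuous_gradient ((hψ i).of_le (by simp)))

theorem IsOnePeriodic.correctedDirection (hψ : ∀ i, IsOnePeriodic (ψ i)) (i : Fin d) :
    IsOnePeriodic (correctedDirection ψ i) := fun k x => by
  simp only [_root_.correctedDirection, (hψ i).gradient k x]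

/-- The increments of the two-scale expansion are given by the field
`∑ i, ∂_i w(x) (e_i + ∇ψ_i(x / ε))` up to an error of second order, in which second derivatives
of size `1 / ε` occur, and a small error of first order. -/
theorem exists_twoScaleExpansion_increment_le (hw : ContDiff ℝ ∞ w) (hwc : HasCompactSupport w)
    (hψ : ∀ i, ContDiff ℝ ∞ (ψ i)) (hψp : ∀ i, IsOnePeriodic (ψ i)) :
    ∃ C, 0 ≤ C ∧ ∀ ε ∈ Ioo (0 : ℝ) 1, ∀ x ξ,
      |twoScaleExpansion w ψ ε (x + ξ) - twoScaleExpansion w ψ ε x -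
        inner ℝ (oscillatingField (gradient w) (correctedDirection ψ) ε x) ξ| ≤
      C * (‖ξ‖ ^ 2 / ε + ε * ‖ξ‖) := by
  set Z := gradient w with hZdef
  have hZ : ContDiff ℝ ∞ Z := contDiff_gradient hw
  have hZc : HasCompactSupport Z := hasCompactSupport_gradient hwc
  obtain ⟨C₁, hC₁0, hC₁⟩ := ((contDiff_infty.1 hw 2).fderiv_right (m := 1)
    (by norm_num)).continuous_fderiv one_ne_zero |>.exists_norm_le_of_hasCompactSupport
    ((hwc.fderiv ℝ).fderiv ℝ)
  obtain ⟨C₂, hC₂0, hC₂⟩ := (isTwoScale_sum_smul (P := ψ) hZc hψp).exists_taylor_le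
    (Ψ := fun z : Euc d × Euc d => ∑ i, Z z.1 i • ψ i z.2) (by
      exact ContDiff.sum fun i _ => (contDiff_apply_euc (hZ.comp contDiff_fst) i).smul
        ((hψ i).comp contDiff_snd))
  obtain ⟨C₃, hC₃0, hC₃⟩ := ((contDiff_infty.1 hZ 1).continuous_fderiv one_ne_zero).exists_norm_le_of_hasCompactSupport (hZc.fderiv ℝ)
  choose M hM using fun i => (hψp i).exists_norm_le (hψ i).continuous
  have hM0 : 0 ≤ ∑ i, M i := Finset.sum_nonneg fun i _ => (norm_nonneg _).trans (hM i 0)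
  refine ⟨C₁ + C₂ + C₃ * ∑ i, M i, by positivity, fun ε hε x ξ => ?_⟩
  have hε0 : 0 < ε := hε.1
  have hdΨ : fderiv ℝ (fun x => ∑ i, Z x i • ψ i (ε⁻¹ • x)) x ξ =
      ∑ i, (Z x i * (ε⁻¹ * fderiv ℝ (ψ i) (ε⁻¹ • x) ξ) +
        fderiv ℝ Z x ξ i * ψ i (ε⁻¹ • x)) := by
    have hZd : DifferentiableAt ℝ Z x := hZ.differentiable (by simp) x
    have hZi : ∀ i, HasFDerivAt (fun x => Z x i)
        ((EuclideanSpace.proj (𝕜 := ℝ) i).comp (fderiv ℝ Z x)) x := fun i =>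
      (EuclideanSpace.proj (𝕜 := ℝ) i).hasFDerivAt.comp x hZd.hasFDerivAt
    have hψi : ∀ i, HasFDerivAt (fun x => ψ i (ε⁻¹ • x))
        ((fderiv ℝ (ψ i) (ε⁻¹ • x)).comp (ε⁻¹ • ContinuousLinearMap.id ℝ (Euc d))) x := fun i =>
      ((hψ i).differentiable (by simp) _).hasFDerivAt.comp x
        ((hasFDerivAt_id x).const_smul ε⁻¹)
    have hsum : HasFDerivAt (fun x => ∑ i, Z x i • ψ i (ε⁻¹ • x)) _ x :=
      HasFDerivAt.fun_sum (u := Finset.univ) fun i _ => (hZi i).smul (hψi i)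
    rw [hsum.fderiv]
    simp
  -- the terms of order one from the derivative of `ε Ψ(x, x / ε)` combine with those of `w` to the
  -- field; the remaining first-order term carries a factor `ε`
  have hid : twoScaleExpansion w ψ ε (x + ξ) - twoScaleExpansion w ψ ε x -
        inner ℝ (oscillatingField Z (correctedDirection ψ) ε x) ξ =
      (w (x + ξ) - w x - fderiv ℝ w x ξ) +
      ε * ((∑ i, Z (x + ξ) i • ψ i (ε⁻¹ • (x + ξ))) - (∑ i, Z x i • ψ i (ε⁻¹ • x)) -
        fderiv ℝ (fun x => ∑ i, Z x i • ψ i (ε⁻¹ • x)) x ξ) +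
      ε * ∑ i, fderiv ℝ Z x ξ i * ψ i (ε⁻¹ • x) := by
    have h1 : inner ℝ (oscillatingField Z (correctedDirection ψ) ε x) ξ =
        fderiv ℝ w x ξ + ∑ i, Z x i * fderiv ℝ (ψ i) (ε⁻¹ • x) ξ := by
      have h2 : fderiv ℝ w x ξ = ∑ i, Z x i * ξ i := by
        rw [← inner_gradient_left, ← hZdef, PiLp.inner_apply]
        exact Finset.sum_congr rfl fun i _ => by simp [mul_comm]
      rw [h2, ← Finset.sum_add_distrib, oscillatingField, sum_inner]
      refine Finset.sum_congr rfl fun i _ => ?_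
      rw [inner_smul_left, correctedDirection, inner_add_left, inner_gradient_left,
        EuclideanSpace.inner_single_left]
      simp
      ring
    rw [hdΨ, h1]
    have h3 : ε * ∑ i, (Z x i * (ε⁻¹ * fderiv ℝ (ψ i) (ε⁻¹ • x) ξ) +
        fderiv ℝ Z x ξ i * ψ i (ε⁻¹ • x)) = (∑ i, Z x i * fderiv ℝ (ψ i) (ε⁻¹ • x) ξ) +
        ε * ∑ i, fderiv ℝ Z x ξ i * ψ i (ε⁻¹ • x) := by
      rw [Finset.sum_add_distrib, mul_add]
      congr 1
      rw [Finset.mul_sum]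
      exact Finset.sum_congr rfl fun i _ => by field_simp
    simp only [twoScaleExpansion, smul_eq_mul, ← hZdef]
    linear_combination h3
  have b1 : |w (x + ξ) - w x - fderiv ℝ w x ξ| ≤ C₁ * (‖ξ‖ ^ 2 / ε) := by
    refine (norm_sub_sub_fderiv_le_of_lipschitz (contDiff_infty.1 hw 2) hC₁ x ξ).trans ?_
    gcongr
    rw [le_div_iff₀ hε0]
    nlinarith [sq_nonneg ‖ξ‖, hε.2]
  have b2 := hC₂ ε hε x ξ
  have b3 : |∑ i, fderiv ℝ Z x ξ i * ψ i (ε⁻¹ • x)| ≤ C₃ * ‖ξ‖ * ∑ i, M i := by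
    refine (Finset.abs_sum_le_sum_abs _ _).trans ?_
    rw [Finset.mul_sum]
    refine Finset.sum_le_sum fun i _ => ?_
    rw [abs_mul]
    refine mul_le_mul ?_ (hM i _) (abs_nonneg _) (by positivity)
    exact (PiLp.norm_apply_le _ i).trans ((fderiv ℝ Z x).le_of_opNorm_le (hC₃ x) ξ)
  rw [hid]
  refine (abs_add_three _ _ _).trans ?_
  rw [abs_mul, abs_mul, abs_of_pos hε0]
  calc _ ≤ C₁ * (‖ξ‖ ^ 2 / ε) + ε * (C₂ / ε ^ 2 * ‖ξ‖ ^ 2) + ε * (C₃ * ‖ξ‖ * ∑ i, M i) := by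
        gcongr
        exact b2
    _ = (C₁ + C₂) * (‖ξ‖ ^ 2 / ε) + (C₃ * ∑ i, M i) * (ε * ‖ξ‖) := by
        field_simp
    _ ≤ _ := by
        have e1 : 0 ≤ ‖ξ‖ ^ 2 / ε := by positivity
        have e2 : 0 ≤ ε * ‖ξ‖ := by positivity
        have e3 : 0 ≤ C₃ * ∑ i, M i := by positivity
        nlinarith [mul_nonneg e3 e1, mul_nonneg (add_nonneg hC₁0 hC₂0) e2]

/-- The increments squared, in the form required by `gagliardoEnergy_le`. -/
theorem exists_twoScaleExpansion_increment_sq_le (hw : ContDiff ℝ ∞ w) (hwc : HasCompactSupport w)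
    (hψ : ∀ i, ContDiff ℝ ∞ (ψ i)) (hψp : ∀ i, IsOnePeriodic (ψ i)) :
    ∃ C, 0 ≤ C ∧ ∀ κ > 0, ∀ ε ∈ Ioo (0 : ℝ) 1, ∀ x ξ,
      (twoScaleExpansion w ψ ε (x + ξ) - twoScaleExpansion w ψ ε x) ^ 2 ≤
        (1 + κ) * inner ℝ (oscillatingField (gradient w) (correctedDirection ψ) ε x) ξ ^ 2 +
        (1 + κ⁻¹) * C * ε ^ 2 * ‖ξ‖ ^ 2 + (1 + κ⁻¹) * C / ε ^ 2 * ‖ξ‖ ^ 4 := by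
  obtain ⟨C, hC0, hC⟩ := exists_twoScaleExpansion_increment_le hw hwc hψ hψp
  refine ⟨2 * C ^ 2, by positivity, fun κ hκ ε hε x ξ => ?_⟩
  have h := hC ε hε x ξ
  set p := twoScaleExpansion w ψ ε (x + ξ) - twoScaleExpansion w ψ ε x
  set q := inner ℝ (oscillatingField (gradient w) (correctedDirection ψ) ε x) ξ
  have hε0 : 0 < ε := hε.1
  have h1 : (p - q) ^ 2 ≤ (C * (‖ξ‖ ^ 2 / ε + ε * ‖ξ‖)) ^ 2 := by
    rw [← sq_abs (p - q)]
    gcongr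
  have h2 : (‖ξ‖ ^ 2 / ε + ε * ‖ξ‖) ^ 2 ≤ 2 * (ε ^ 2 * ‖ξ‖ ^ 2 + ‖ξ‖ ^ 4 / ε ^ 2) := by
    have e : ‖ξ‖ ^ 4 / ε ^ 2 = (‖ξ‖ ^ 2 / ε) ^ 2 := by rw [div_pow]; ring
    rw [e]
    nlinarith [sq_nonneg (‖ξ‖ ^ 2 / ε - ε * ‖ξ‖)]
  -- Young's inequality for `p = q + (p - q)`
  have h3 : p ^ 2 ≤ (1 + κ) * q ^ 2 + (1 + κ⁻¹) * (p - q) ^ 2 := by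
    have e : (1 + κ) * q ^ 2 + (1 + κ⁻¹) * (p - q) ^ 2 - p ^ 2 = κ * (q - κ⁻¹ * (p - q)) ^ 2 := by
      field_simp
      ring
    have : 0 ≤ κ * (q - κ⁻¹ * (p - q)) ^ 2 := by positivity
    linarith
  calc p ^ 2 ≤ (1 + κ) * q ^ 2 + (1 + κ⁻¹) * (p - q) ^ 2 := h3
    _ ≤ (1 + κ) * q ^ 2 + (1 + κ⁻¹) * (C ^ 2 * (2 * (ε ^ 2 * ‖ξ‖ ^ 2 + ‖ξ‖ ^ 4 / ε ^ 2))) := by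
        gcongr
        rw [mul_pow] at h1
        exact h1.trans (by gcongr)
    _ = _ := by ring

end Recovery

section Recovery

variable {d : ℕ} {Ω : Set (Euc d)} {a : Euc d → ℝ} {w : Euc d → ℝ} {ψ : Fin d → Euc d → ℝ}

theorem tendsto_setIntegral_mul_oscillating {f h : Euc d → ℝ} (hΩ : MeasurableSet Ω)
    (hf : IntegrableOn f Ω) (hper : IsOnePeriodic h) (hc : Continuous h) {ε : ℕ → ℝ}
    (hε0 : ∀ j, ε j ≠ 0) (hε : Tendsto ε atTop (𝓝 0)) :
    Tendsto (fun j => ∫ x in Ω, f x * h ((ε j)⁻¹ • x)) atTop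
      (𝓝 ((∫ x in Ω, f x) * ∫ y in unitCube d, h y)) := by
  have := tendsto_integral_mul_oscillating (hf.integrable_indicator hΩ) hper hc hε0 hε
  rw [integral_indicator hΩ] at this
  refine this.congr fun j => ?_
  rw [← integral_indicator hΩ]
  refine integral_congr_ae (Eventually.of_forall fun x => ?_)
  simp only [indicator]
  split_ifs <;> simp

theorem tendsto_twoScaleExpansion (hΩb : Bornology.IsBounded Ω) (hw : ContDiff ℝ ∞ w)
    (hwc : HasCompactSupport w) (hψ : ∀ i, ContDiff ℝ ∞ (ψ i)) (hψp : ∀ i, IsOnePeriodic (ψ i))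
    {ε : ℕ → ℝ} (hε : ∀ j, ε j ∈ Ioo (0 : ℝ) 1) (hε0 : Tendsto ε atTop (𝓝 0)) :
    Tendsto (fun j => ((continuous_twoScaleExpansion hw hψ (ε j)).memLp_restrict_of_isBounded
      hΩb 2).toLp _) atTop (𝓝 ((hw.continuous.memLp_restrict_of_isBounded hΩb 2).toLp w)) := by
  obtain ⟨C, hC0, hC⟩ := (isTwoScale_sum_smul (P := ψ)
    (hasCompactSupport_gradient hwc) hψp).exists_norm_le (by
      have h1 := (contDiff_gradient hw).continuous
      have h2 := fun i => (hψ i).continuous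
      fun_prop)
  rw [Lp.tendsto_Lp_iff_tendsto_eLpNorm'']
  have hfin : volume.restrict Ω univ ≠ ⊤ := by
    rw [Measure.restrict_apply_univ]
    exact hΩb.measure_lt_top.ne
  have hlim : Tendsto (fun j => volume.restrict Ω univ ^ (2 : ℝ≥0∞).toReal⁻¹ *
      ENNReal.ofReal (ε j * C)) atTop (𝓝 0) := by
    have h1 : Tendsto (fun j => ENNReal.ofReal (ε j * C)) atTop (𝓝 0) := by
      have := ENNReal.tendsto_ofReal (hε0.mul_const C)
      simpa using this
    have h2 := ENNReal.Tendsto.const_mul (a := volume.restrict Ω univ ^ (2 : ℝ≥0∞).toReal⁻¹) h1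
      (Or.inr (ENNReal.rpow_ne_top_of_nonneg (by simp) hfin))
    simpa using h2
  refine tendsto_of_tendsto_of_tendsto_of_le_of_le tendsto_const_nhds hlim (fun _ => bot_le)
    fun j => ?_
  refine eLpNorm_le_of_ae_bound (Eventually.of_forall fun x => ?_)
  have := hC (x, (ε j)⁻¹ • x)
  simp only [Pi.sub_apply, twoScaleExpansion, add_sub_cancel_left, norm_mul]
  rw [Real.norm_of_nonneg (hε j).1.le]
  gcongr
  · exact (hε j).1.le
  · exact this

theorem tendsto_integral_norm_sq_oscillatingField (hΩ : MeasurableSet Ω)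
    (hΩb : Bornology.IsBounded Ω) (hac : Continuous a) (hap : IsOnePeriodic a)
    {Z : Euc d → Euc d} (hZ : Continuous Z) {P : Fin d → Euc d → Euc d}
    (hP : ∀ i, Continuous (P i)) (hPp : ∀ i, IsOnePeriodic (P i))
    {ε : ℕ → ℝ} (hε : ∀ j, ε j ∈ Ioo (0 : ℝ) 1) (hε0 : Tendsto ε atTop (𝓝 0)) :
    Tendsto (fun j => ∫ x in Ω, a ((ε j)⁻¹ • x) * ‖oscillatingField Z P (ε j) x‖ ^ 2) atTop
      (𝓝 (∑ i, ∑ k, (∫ x in Ω, Z x i * Z x k) *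
        ∫ y in unitCube d, a y * inner ℝ (P i y) (P k y))) := by
  have hc : ∀ i k, Continuous fun y => a y * inner ℝ (P i y) (P k y) := fun i k =>
    hac.mul ((hP i).inner (hP k))
  have heq : ∀ j, ∫ x in Ω, a ((ε j)⁻¹ • x) * ‖oscillatingField Z P (ε j) x‖ ^ 2 =
      ∑ i, ∑ k, ∫ x in Ω, Z x i * Z x k *
        (fun y => a y * inner ℝ (P i y) (P k y)) ((ε j)⁻¹ • x) := by
    intro j
    have hi : ∀ i k, IntegrableOn (fun x => Z x i * Z x k *
        (fun y => a y * inner ℝ (P i y) (P k y)) ((ε j)⁻¹ • x)) Ω := fun i k =>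
      Continuous.integrableOn_of_isBounded
        (((by fun_prop : Continuous fun x => Z x i * Z x k)).mul
          ((hc i k).comp (continuous_const_smul _))) hΩb
    have hpt : ∀ x, a ((ε j)⁻¹ • x) * ‖oscillatingField Z P (ε j) x‖ ^ 2 = ∑ i, ∑ k,
        Z x i * Z x k * (fun y => a y * inner ℝ (P i y) (P k y)) ((ε j)⁻¹ • x) := fun x => by
      rw [norm_sq_oscillatingField, Finset.mul_sum]
      refine Finset.sum_congr rfl fun i _ => ?_
      rw [Finset.mul_sum]
      exact Finset.sum_congr rfl fun k _ => by ring
    simp_rw [hpt]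
    rw [integral_finsetSum _ fun i _ => integrable_finsetSum _ fun k _ => hi i k]
    exact Finset.sum_congr rfl fun i _ => integral_finsetSum _ fun k _ => hi i k
  simp_rw [heq]
  refine tendsto_finsetSum _ fun i _ => tendsto_finsetSum _ fun k _ => ?_
  refine tendsto_setIntegral_mul_oscillating hΩ ?_ ?_ (hc i k) (fun j => (hε j).1.ne') hε0
  · exact Continuous.integrableOn_of_isBounded (by fun_prop) hΩb
  · intro l y
    simp only [hap l y, hPp i l y, hPp k l y]

/-- The upper bound for a smooth function `w` with fixed smooth correctors `ψ i`, which need not be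
optimal. -/
theorem gammaLimsupLE_of_smooth (hd : 1 ≤ d) (hΩ : IsOpen Ω) (hΩb : Bornology.IsBounded Ω)
    (hac : Continuous a) (hap : IsOnePeriodic a) (ha0 : ∀ x, 0 ≤ a x)
    {ε s : ℕ → ℝ} (hε : ∀ j, ε j ∈ Ioo (0 : ℝ) 1)
    (hε0 : Tendsto ε atTop (𝓝 0)) (hs : ∀ j, s j ∈ Ioo (0 : ℝ) 1)
    (hs1 : Tendsto s atTop (𝓝 1)) (hsε : Tendsto (fun j => (1 - s j) / ε j ^ 2) atTop (𝓝 0))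
    (hw : ContDiff ℝ ∞ w) (hwc : HasCompactSupport w)
    (hψ : ∀ i, ContDiff ℝ ∞ (ψ i)) (hψp : ∀ i, IsOnePeriodic (ψ i)) :
    GammaLimsupLE (fun j (u : Lp ℝ 2 (volume.restrict Ω)) => gagliardoEnergy Ω a (ε j) (s j) u)
      ((hw.continuous.memLp_restrict_of_isBounded hΩb 2).toLp w)
      (ENNReal.ofReal (sphereArea d / (2 * d) *
        ∑ i, ∑ k, (∫ x in Ω, gradient w x i * gradient w x k) *
          ∫ y in unitCube d,
            a y * inner ℝ (correctedDirection ψ i y) (correctedDirection ψ k y))) := by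
  set S := ∑ i, ∑ k, (∫ x in Ω, gradient w x i * gradient w x k) *
    ∫ y in unitCube d, a y * inner ℝ (correctedDirection ψ i y) (correctedDirection ψ k y)
  obtain ⟨C, hC0, hC⟩ := exists_twoScaleExpansion_increment_sq_le hw hwc hψ hψp
  obtain ⟨R, hR0, hR⟩ : ∃ R : ℝ, 0 < R ∧ ∀ x ∈ Ω, ∀ y ∈ Ω, ‖x - y‖ < R := by
    refine ⟨Metric.diam Ω + 1, by positivity, fun x hx y hy => ?_⟩
    rw [← dist_eq_norm]
    linarith [Metric.dist_le_diam_of_mem hΩb hx hy]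
  have hPc := continuous_correctedDirection hψ
  have hZc := (contDiff_gradient hw).continuous
  have hI := tendsto_integral_norm_sq_oscillatingField hΩ.measurableSet hΩb hac hap hZc hPc
    (IsOnePeriodic.correctedDirection hψp) hε hε0
  have hJ : Tendsto (fun j => ∫ x in Ω, a ((ε j)⁻¹ • x)) atTop
      (𝓝 ((∫ x in Ω, (1 : ℝ)) * ∫ y in unitCube d, a y)) := by
    have := tendsto_setIntegral_mul_oscillating hΩ.measurableSet (f := fun _ => (1 : ℝ))
      (continuous_const.integrableOn_of_isBounded hΩb) hap hac (fun j => (hε j).1.ne') hε0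
    simpa using this
  have hR2 : Tendsto (fun j => R ^ (2 - 2 * s j)) atTop (𝓝 1) := by
    have h1 : Tendsto (fun j => 2 - 2 * s j) atTop (𝓝 (2 - 2 * 1)) :=
      tendsto_const_nhds.sub (hs1.const_mul 2)
    have := (tendsto_const_nhds (x := R)).rpow h1 (Or.inl hR0.ne')
    simpa using this
  have hR4 : Tendsto (fun j => R ^ (4 - 2 * s j) / (4 - 2 * s j)) atTop
      (𝓝 (R ^ (4 - 2 * 1 : ℝ) / (4 - 2 * 1))) := by
    have h1 : Tendsto (fun j => 4 - 2 * s j) atTop (𝓝 (4 - 2 * 1)) :=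
      tendsto_const_nhds.sub (hs1.const_mul 2)
    exact ((tendsto_const_nhds (x := R)).rpow h1 (Or.inl hR0.ne')).div h1 (by norm_num)
  -- the bound with a factor `1 + κ`, which comes from Young's inequality for the increments
  have hκ : ∀ κ > 0, GammaLimsupLE
      (fun j (u : Lp ℝ 2 (volume.restrict Ω)) => gagliardoEnergy Ω a (ε j) (s j) u)
      ((hw.continuous.memLp_restrict_of_isBounded hΩb 2).toLp w)
      (ENNReal.ofReal (sphereArea d / (2 * d) * (1 + κ) * S)) := by
    intro κ hκ
    have hlim : Tendsto (fun j =>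
        sphereArea d / (2 * d) * R ^ (2 - 2 * s j) * (1 + κ) * (∫ x in Ω, a ((ε j)⁻¹ • x) *
          ‖oscillatingField (gradient w) (correctedDirection ψ) (ε j) x‖ ^ 2) +
        (sphereArea d / 2 * R ^ (2 - 2 * s j) * ((1 + κ⁻¹) * C * ε j ^ 2) +
          sphereArea d * ((1 - s j) / (4 - 2 * s j) * R ^ (4 - 2 * s j)) *
            ((1 + κ⁻¹) * C / ε j ^ 2)) * ∫ x in Ω, a ((ε j)⁻¹ • x)) atTop
        (𝓝 (sphereArea d / (2 * d) * (1 + κ) * S)) := by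
      have t1 := ((hR2.const_mul (sphereArea d / (2 * d))).mul_const (1 + κ)).mul hI
      have t2 := (hR2.const_mul (sphereArea d / 2)).mul ((hε0.pow 2).const_mul ((1 + κ⁻¹) * C))
      -- here the assumption on `(1 - s) / ε²` enters
      have t3 := (hsε.mul hR4).const_mul (sphereArea d * ((1 + κ⁻¹) * C))
      have t := t1.add ((t2.add t3).mul hJ)
      refine (t.congr fun j => ?_).trans (le_of_eq ?_)
      · ring
      · congr 1
        simp only [S]
        ring
    refine GammaLimsupLE.of_tendsto (tendsto_twoScaleExpansion hΩb hw hwc hψ hψp hε hε0)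
      (ENNReal.tendsto_ofReal hlim) ENNReal.ofReal_ne_top (Eventually.of_forall fun j => ?_)
    rw [gagliardoEnergy_congr (MemLp.coeFn_toLp _)]
    have hε' := (hε j).1
    refine gagliardoEnergy_le hd ha0 (hs j).2 hR0.le hR hΩ.measurableSet (by positivity)
      (by positivity) (by positivity) (hC κ hκ (ε j) (hε j)) ?_ ?_
    · refine Continuous.integrableOn_of_isBounded ?_ hΩb
      unfold oscillatingField
      fun_prop
    · exact Continuous.integrableOn_of_isBounded (by fun_prop) hΩb
  refine GammaLimsupLE.of_forall (y := fun _ => _) tendsto_const_nhds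
    (ℓ := fun n : ℕ => ENNReal.ofReal (sphereArea d / (2 * d) * (1 + 1 / ((n : ℝ) + 1)) * S))
    (ENNReal.tendsto_ofReal ?_) ENNReal.ofReal_ne_top fun n => hκ _ (by positivity)
  have := ((tendsto_one_div_add_atTop_nhds_zero_nat (𝕜 := ℝ)).const_add 1).const_mul
    (sphereArea d / (2 * d)) |>.mul_const S
  simpa using this

/-- The upper bound for smooth functions, as the correctors become optimal. -/
theorem gammaLimsupLE_homogenized_of_smooth (hd : 1 ≤ d) (hΩ : IsOpen Ω)
    (hΩb : Bornology.IsBounded Ω) (hac : Continuous a) (hap : IsOnePeriodic a) (ha0 : ∀ x, 0 ≤ a x)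
    {ε s : ℕ → ℝ} (hε : ∀ j, ε j ∈ Ioo (0 : ℝ) 1)
    (hε0 : Tendsto ε atTop (𝓝 0)) (hs : ∀ j, s j ∈ Ioo (0 : ℝ) 1)
    (hs1 : Tendsto s atTop (𝓝 1)) (hsε : Tendsto (fun j => (1 - s j) / ε j ^ 2) atTop (𝓝 0))
    (hw : ContDiff ℝ ∞ w) (hwc : HasCompactSupport w) :
    GammaLimsupLE (fun j (u : Lp ℝ 2 (volume.restrict Ω)) => gagliardoEnergy Ω a (ε j) (s j) u)
      ((hw.continuous.memLp_restrict_of_isBounded hΩb 2).toLp w)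
      (ENNReal.ofReal (sphereArea d / (2 * d) *
        ∫ x in Ω, quadForm (homMatrix hac) (gradient w x))) := by
  obtain ⟨ψ, hψ, hψp, hlim⟩ := exists_smooth_correctors hac ha0
  have hZc := (contDiff_gradient hw).continuous
  refine GammaLimsupLE.of_forall (y := fun _ => _) tendsto_const_nhds
    (ENNReal.tendsto_ofReal (Tendsto.const_mul _ ?_)) ENNReal.ofReal_ne_top fun n =>
      gammaLimsupLE_of_smooth hd hΩ hΩb hac hap ha0 hε hε0 hs hs1 hsε hw hwc (hψ n) (hψp n)
  have h : ∫ x in Ω, quadForm (homMatrix hac) (gradient w x) =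
      ∑ i, ∑ k, (∫ x in Ω, gradient w x i * gradient w x k) * homMatrix hac i k := by
    have hi : ∀ i k, IntegrableOn (fun x => homMatrix hac i k *
        (gradient w x i * gradient w x k)) Ω := fun i k =>
      Continuous.integrableOn_of_isBounded (by fun_prop) hΩb
    simp_rw [quadForm_eq_sum]
    rw [integral_finsetSum _ fun i _ => integrable_finsetSum _ fun k _ => hi i k]
    refine Finset.sum_congr rfl fun i _ => ?_
    rw [integral_finsetSum _ fun k _ => hi i k]
    refine Finset.sum_congr rfl fun k _ => ?_
    rw [integral_const_mul, mul_comm]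
  rw [h]
  exact tendsto_finsetSum _ fun i _ => tendsto_finsetSum _ fun k _ => (hlim i k).const_mul _

end Recovery

/-! ### Recovery sequences in `W^{1,2}` -/

section Density

variable {d : ℕ} {Ω : Set (Euc d)}

theorem tendsto_integral_quadForm {μ : Measure (Euc d)} (A : Matrix (Fin d) (Fin d) ℝ)
    {G : ℕ → Euc d → Euc d} {g : Euc d → Euc d} (hG : ∀ n, MemLp (G n) 2 μ) (hg : MemLp g 2 μ)
    (h : Tendsto (fun n => eLpNorm (G n - g) 2 μ) atTop (𝓝 0)) :
    Tendsto (fun n => ∫ x, quadForm A (G n x) ∂μ) atTop (𝓝 (∫ x, quadForm A (g x) ∂μ)) := by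
  let L : Euc d →L[ℝ] Euc d := LinearMap.toContinuousLinearMap A.toEuclideanLin
  have heq : ∀ {f : Euc d → Euc d} (hf : MemLp f 2 μ), ∫ x, quadForm A (f x) ∂μ =
      inner ℝ (L.compLpL 2 μ (hf.toLp f)) (hf.toLp f) := by
    intro f hf
    rw [L2.inner_def]
    refine integral_congr_ae ?_
    filter_upwards [hf.coeFn_toLp, L.coeFn_compLpL (hf.toLp f)] with x h1 h2
    rw [h2, h1]
    rfl
  simp_rw [heq hg, fun n => heq (hG n)]
  have h1 := (Lp.tendsto_Lp_iff_tendsto_eLpNorm'' G hG g hg).2 h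
  exact (((L.compLpL 2 μ).continuous.tendsto _).comp h1).inner h1

/-- The upper bound on `W^{1,2}(Ω)`, by density of the smooth functions. -/
theorem gammaLimsupLE_homogenizedEnergy (hd : 1 ≤ d) (hΩ : IsOpen Ω)
    (hΩb : Bornology.IsBounded Ω) (hlip : HasLipschitzBoundary Ω)
    {a : Euc d → ℝ} (hac : Continuous a) (hap : IsOnePeriodic a) (ha0 : ∀ x, 0 ≤ a x)
    {ε s : ℕ → ℝ} (hε : ∀ j, ε j ∈ Ioo (0 : ℝ) 1)
    (hε0 : Tendsto ε atTop (𝓝 0)) (hs : ∀ j, s j ∈ Ioo (0 : ℝ) 1)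
    (hs1 : Tendsto s atTop (𝓝 1)) (hsε : Tendsto (fun j => (1 - s j) / ε j ^ 2) atTop (𝓝 0))
    {u : Lp ℝ 2 (volume.restrict Ω)} (hu : MemW12 Ω u) :
    GammaLimsupLE (fun j (u : Lp ℝ 2 (volume.restrict Ω)) => gagliardoEnergy Ω a (ε j) (s j) u)
      u (homogenizedEnergy Ω (homMatrix hac) u) := by
  obtain ⟨g, hg, hg2⟩ := hu.2
  have hη : ∀ n : ℕ, (0 : ℝ≥0∞) < ((n : ℝ≥0∞) + 1)⁻¹ := fun n =>
    ENNReal.inv_pos.2 (ENNReal.add_ne_top.2 ⟨ENNReal.natCast_ne_top n, ENNReal.one_ne_top⟩)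
  have hη0 : Tendsto (fun n : ℕ => ((n : ℝ≥0∞) + 1)⁻¹) atTop (𝓝 0) := by
    have := (tendsto_add_atTop_iff_nat 1).2 ENNReal.tendsto_inv_nat_nhds_zero
    simpa using this
  choose w hw hwc hwu hwg using fun n =>
    exists_smooth_approx hΩ hΩb hlip hg (Lp.memLp u) hg2 (hη n)
  rw [homogenizedEnergy, if_pos hu]
  have hint : ∫ x in Ω, quadForm (homMatrix hac) (weakGradient Ω u x) =
      ∫ x in Ω, quadForm (homMatrix hac) (g x) :=
    integral_congr_ae ((hg.weakGradient_ae_eq hΩ).mono fun x hx => by simp only [hx])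
  rw [hint]
  refine GammaLimsupLE.of_forall
    (y := fun n => ((hw n).continuous.memLp_restrict_of_isBounded hΩb 2).toLp (w n)) ?_
    (ENNReal.tendsto_ofReal (Tendsto.const_mul _ (tendsto_integral_quadForm (homMatrix hac)
      (G := fun n => gradient (w n)) (fun n => ?_) hg2 ?_)))
    ENNReal.ofReal_ne_top fun n =>
      gammaLimsupLE_homogenized_of_smooth hd hΩ hΩb hac hap ha0 hε hε0 hs hs1 hsε (hw n) (hwc n)
  · rw [tendsto_iff_edist_tendsto_0]
    refine tendsto_of_tendsto_of_tendsto_of_le_of_le tendsto_const_nhds hη0 (fun _ => bot_le)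
      fun n => ?_
    refine le_trans (le_of_eq ?_) (hwu n)
    rw [Lp.edist_def]
    refine eLpNorm_congr_ae ?_
    filter_upwards [((hw n).continuous.memLp_restrict_of_isBounded hΩb 2).coeFn_toLp] with x hx
    rw [Pi.sub_apply, hx]
  · exact (contDiff_gradient (hw n)).continuous.memLp_restrict_of_isBounded hΩb 2
  · exact tendsto_of_tendsto_of_tendsto_of_le_of_le tendsto_const_nhds hη0 (fun _ => bot_le)
      hwg

end Density

theorem theorem1 {d : ℕ} (hd : 1 ≤ d) {Ω : Set (Euc d)} (hΩ_open : IsOpen Ω)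
    (hΩ_bdd : Bornology.IsBounded Ω) (hΩ_lip : HasLipschitzBoundary Ω)
    {a : Euc d → ℝ} (ha_cont : Continuous a) (ha_per : IsOnePeriodic a)
    {α β : ℝ} (hα : 0 < α) (ha_bdd : ∀ x, α ≤ a x ∧ a x ≤ β)
    {s : ℝ → ℝ} (hs : ∀ ε ∈ Ioo (0 : ℝ) 1, s ε ∈ Ioo (0 : ℝ) 1)
    (hs_lim : Tendsto (fun ε => (1 - s ε) / ε ^ 2) (𝓝[>] 0) (𝓝 0)) :
    ∃ A : Matrix (Fin d) (Fin d) ℝ, IsHomogenizedMatrix a A ∧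
      IsGammaLimitAtZero
        (fun (ε : ℝ) (u : Lp ℝ 2 (volume.restrict Ω)) => gagliardoEnergy Ω a ε (s ε) u)
        (fun u : Lp ℝ 2 (volume.restrict Ω) => homogenizedEnergy Ω A u) := by
  have hαa : ∀ x, α ≤ a x := fun x => (ha_bdd x).1
  have ha0 : ∀ x, 0 ≤ a x := fun x => hα.le.trans (hαa x)
  refine ⟨homMatrix ha_cont, isHomogenizedMatrix_homMatrix ha_cont hα hαa fun x => (ha_bdd x).2,
    fun ε hε hε0 => ?_⟩
  have hs' : ∀ j, s (ε j) ∈ Ioo (0 : ℝ) 1 := fun j => hs _ (hε j)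
  have hsε : Tendsto (fun j => (1 - s (ε j)) / ε j ^ 2) atTop (𝓝 0) :=
    hs_lim.comp (tendsto_nhdsWithin_iff.2 ⟨hε0, Eventually.of_forall fun j => (hε j).1⟩)
  have hs1 : Tendsto (fun j => s (ε j)) atTop (𝓝 1) := by
    have h := (hsε.mul (hε0.pow 2)).const_sub 1
    rw [zero_mul, sub_zero] at h
    refine h.congr fun j => ?_
    rw [div_mul_cancel₀ _ (pow_ne_zero 2 (hε j).1.ne')]
    ring
  refine ⟨fun u v hv => ?_, fun u => ?_⟩
  · exact homogenizedEnergy_le_liminf hd hΩ_open hΩ_bdd ha_cont ha_per hα hαa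
      (fun x => (ha_bdd x).2) hε hε0 hs' hs1 hsε hv
  · by_cases hu : MemW12 Ω u
    · exact (gammaLimsupLE_homogenizedEnergy hd hΩ_open hΩ_bdd hΩ_lip ha_cont ha_per ha0 hε hε0
        hs' hs1 hsε hu).exists_recovery
    · refine ⟨fun _ => u, tendsto_const_nhds, ?_⟩
      rw [homogenizedEnergy, if_neg hu]
      exact le_top
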